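/- Let $0<\xi<1$, $\psi(\eta)=1-\xi\cos\eta$, $\mu(\varphi)=\frac1{\xi^2}+\bigl(1-\frac1{\xi^2}\bigr)\cos\varphi$, and for $k\in\mathbb Z$ let $$s_k(\eta)=\int_0^{2\pi}\frac{e^{-ik\varphi}}{(\mu(\varphi)-\cos\eta)^{1/2}}\,d\varphi,\qquad a_k(\eta,\eta')=\frac{8\pi\sqrt2\,\xi}{1-\xi^2}\,\frac{\psi(\eta')^{3/2}}{\psi(\eta)^{3/2}}\int_0^{2\pi}k(\eta,\eta';\varphi)\,e^{-ik\varphi}\,d\varphi,$$ where $$k(\eta,\eta';\varphi)=\frac{1-\xi^2}{8\pi\sqrt2\,\xi}\frac{\psi(\eta)^{1/2}}{\psi(\eta')^{3/2}}\frac1{(\mu(\varphi)-\cos(\eta-\eta'))^{1/2}}-\frac{1-\xi^2}{8\pi\sqrt2\,\xi^3}\frac{\psi(\eta)^{3/2}}{\psi(\eta')^{3/2}}\frac{1-\cos\varphi}{(\mu(\varphi)-\cos(\eta-\eta'))^{3/2}}$$ is the kernel, in toroidal coordinates, of the Neumann--Poincaré operator on the torus with parameter $\xi$. Let $$\mathcal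 S_k[g](\eta)=\int_0^{2\pi}s_k(\eta-\eta')g(\eta')\,d\eta',\qquad \mathcal A_k[g](\eta)=\int_0^{2\pi}a_k(\eta,\eta')g(\eta')\,d\eta'$$ be the corresponding integral operators, acting on distributions on the circle $T=\mathbb R/2\pi\mathbb Z$ by transposition. With $\hat u(l)=\frac1{2\pi}\int_0^{2\pi}u(\eta)e^{-il\eta}\,d\eta$ let $H^{-1/2}(T)$ be the space of distributions $u$ with $\|u\|_{-1/2}^2=\sum_{l\in\mathbb Z}(1+l^2)^{-1/2}|\hat u(l)|^2<\infty$, and let $$H(T)=\{g\;:\;\psi^{3/2}g\in H^{-1/2}(T)\},\qquad \|g\|_H=\|\psi^{3/2}g\|_{-1/2}.$$ For $g_1,g_2\in H(T)$ put $\langle g_1,g_2\rangle_k=\int_0^{2\pi}g_1\,\overline{\mathcal S_k[g_2]}\,d\eta$, understood as the duality pairing $2\pi\sum_{l\in\mathbb Z}\hat g_1(l)\,\overline{\widehat{\mathcal S_k[g_2]}(l)}$. Then for every $k\in\mathbb Z$: the series defining $\langle g_1,g_2\rangle_k$ converges absolutely for all $g_1,g_2\in H(T)$; smooth functions belong to $H(T)$,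 and for smooth functions $\langle g_1,g_2\rangle_k$ and $\mathcal A_k[g]$ are given by the integrals above; $\langle\cdot,\cdot\rangle_k$ is an inner product on $H(T)$, and there is a constant $C_k>1$ (depending on $k$ and $\xi$) such that $$C_k^{-1}\|g\|_H^2\le\langle g,g\rangle_k\le C_k\|g\|_H^2\qquad\text{for all }g\in H(T);$$ moreover $\mathcal A_k$ maps $H(T)$ into itself, is compact on $H(T)$, and is self-adjoint: $$\langle\mathcal A_k[g_1],g_2\rangle_k=\langle g_1,\mathcal A_k[g_2]\rangle_k\qquad\text{for all }g_1,g_2\in H(T).$$ -/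

import Mathlib

open scoped ContDiff

namespace ToroidalNP

noncomputable section

/-! ### Smooth test functions and distributions on the circle `T = ℝ / 2πℤ` -/

/-- `C^∞(T)`: the smooth `2π`-periodic complex functions on `ℝ`. -/
def TestFun : Submodule ℂ (ℝ → ℂ) where
  carrier := {f | ContDiff ℝ ∞ f ∧ Function.Periodic f (2 * Real.pi)}
  add_mem' := fun ha hb => ⟨ha.1.add hb.1, ha.2.add hb.2⟩
  zero_mem' := ⟨contDiff_const, fun _ => rfl⟩
  smul_mem' := fun c f hf => ⟨hf.1.const_smul c, fun x => by simp [hf.2 x]⟩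

/-- All derivatives of `φ` of order at most `N` are bounded by `M`. -/
def BoundedBy (N : ℕ) (M : ℝ) (φ : TestFun) : Prop :=
  ∀ j ≤ N, ∀ x, ‖iteratedDeriv j φ.1 x‖ ≤ M

lemma BoundedBy.nonneg {N : ℕ} {M : ℝ} {φ : TestFun} (h : BoundedBy N M φ) : 0 ≤ M :=
  (norm_nonneg _).trans (h 0 (Nat.zero_le _) 0)

lemma BoundedBy.mono {N N' : ℕ} {M : ℝ} {φ : TestFun} (h : BoundedBy N' M φ) (hN : N ≤ N') :
    BoundedBy N M φ := fun j hj x => h j (hj.trans hN) x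

/-- Distributions on `T`: the linear functionals on `C^∞(T)` that are continuous for the
`C^∞` topology, that is, bounded by some `C^N` norm. -/
def PerDist : Submodule ℂ (TestFun →ₗ[ℂ] ℂ) where
  carrier := {u | ∃ (N : ℕ) (C : ℝ), ∀ (φ : TestFun) (M : ℝ), BoundedBy N M φ → ‖u φ‖ ≤ C * M}
  add_mem' := by
    rintro u v ⟨N, C, h⟩ ⟨N', C', h'⟩
    refine ⟨max N N', C + C', fun φ M hM => ?_⟩
    have h1 := h φ M (hM.mono (le_max_left _ _))
    have h2 := h' φ M (hM.mono (le_max_right _ _))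
    rw [LinearMap.add_apply, add_mul]
    exact (norm_add_le _ _).trans (add_le_add h1 h2)
  zero_mem' := ⟨0, 0, fun φ M _ => by simp⟩
  smul_mem' := by
    rintro c u ⟨N, C, h⟩
    refine ⟨N, ‖c‖ * C, fun φ M hM => ?_⟩
    rw [LinearMap.smul_apply, norm_smul, mul_assoc]
    exact mul_le_mul_of_nonneg_left (h φ M hM) (norm_nonneg _)

/-- Continuity of a linear map on `C^∞(T)`. -/
def ContTest (A : TestFun →ₗ[ℂ] TestFun) : Prop :=
  ∀ N : ℕ, ∃ (N' : ℕ) (C : ℝ), ∀ (φ : TestFun) (M : ℝ),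
    BoundedBy N' M φ → BoundedBy N (C * M) (A φ)

/-- The transpose of a continuous linear map on `C^∞(T)`, acting on distributions:
`φ ↦ u (A φ)`. -/
def transposeOp (A : TestFun →ₗ[ℂ] TestFun) (hA : ContTest A) : PerDist →ₗ[ℂ] PerDist where
  toFun := fun u => ⟨u.1.comp A, by
    obtain ⟨N, C, h⟩ := u.2
    obtain ⟨N', C', h'⟩ := hA N
    exact ⟨N', C * C', fun φ M hM => by
      rw [mul_assoc]
      exact h (A φ) (C' * M) (h' φ M hM)⟩⟩
  map_add' := fun _ _ => rfl
  map_smul' := fun _ _ => rfl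

lemma contTestFun (φ : TestFun) : Continuous φ.1 := φ.2.1.continuous

lemma exists_bound_of_periodic {f : ℝ → ℂ} (hf : Continuous f)
    (hp : Function.Periodic f (2 * Real.pi)) : ∃ M, ∀ x, ‖f x‖ ≤ M := by
  have hb := hp.isBounded_of_continuous (by positivity) hf
  obtain ⟨M, hM⟩ := hb.exists_norm_le
  exact ⟨M, fun x => hM _ (Set.mem_range_self x)⟩

lemma derivPeriodic {f : ℝ → ℂ} (hp : Function.Periodic f (2 * Real.pi)) :
    Function.Periodic (deriv f) (2 * Real.pi) := fun x => by
  have h : (fun y => f (y + 2 * Real.pi)) = f := funext hp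
  rw [← deriv_comp_add_const, h]

/-- The derivative of a test function. -/
def derivTest (φ : TestFun) : TestFun :=
  ⟨deriv φ.1, (contDiff_infty_iff_deriv.1 φ.2.1).2, derivPeriodic φ.2.2⟩

lemma exists_boundedBy (N : ℕ) : ∀ φ : TestFun, ∃ M, BoundedBy N M φ := by
  induction N with
  | zero =>
    intro φ
    obtain ⟨M, hM⟩ := exists_bound_of_periodic (contTestFun φ) φ.2.2
    refine ⟨M, fun j hj x => ?_⟩
    obtain rfl : j = 0 := by omega
    simpa using hM x
  | succ n ih =>
    intro φ
    obtain ⟨M, hM⟩ := exists_bound_of_periodic (contTestFun φ) φ.2.2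
    obtain ⟨M', hM'⟩ := ih (derivTest φ)
    refine ⟨max M M', fun j hj x => ?_⟩
    cases j with
    | zero => simpa using Or.inl (hM x)
    | succ j =>
      rw [iteratedDeriv_succ']
      exact (hM' j (by omega) x).trans (le_max_right _ _)

/-- Multiplication by a smooth function, on test functions. -/
def mulTest (m : TestFun) : TestFun →ₗ[ℂ] TestFun where
  toFun := fun φ => ⟨fun x => m.1 x * φ.1 x, m.2.1.mul φ.2.1, m.2.2.mul φ.2.2⟩
  map_add' := fun φ χ => by ext x; simp [mul_add]
  map_smul' := fun c φ => by ext x; simp [mul_left_comm]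

lemma contTest_mulTest (m : TestFun) : ContTest (mulTest m) := by
  intro N
  obtain ⟨B, hB⟩ := exists_boundedBy N m
  refine ⟨N, 2 ^ N * B, fun φ M hM j hj x => ?_⟩
  have hB0 := hB.nonneg
  have hM0 := hM.nonneg
  have h1 : ContDiffAt ℝ j m.1 x := (m.2.1.of_le (by exact_mod_cast le_top)).contDiffAt
  have h2 : ContDiffAt ℝ j φ.1 x := (φ.2.1.of_le (by exact_mod_cast le_top)).contDiffAt
  have h3 := iteratedDeriv_mul h1 h2
  change ‖iteratedDeriv j (m.1 * φ.1) x‖ ≤ _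
  rw [h3]
  calc _ ≤ ∑ i ∈ Finset.range (j + 1), (j.choose i : ℝ) * (B * M) := by
        refine norm_sum_le_of_le _ fun i hi => ?_
        rw [norm_mul, norm_mul, mul_assoc]
        have hi' : i ≤ j := Nat.lt_succ_iff.1 (Finset.mem_range.1 hi)
        have e1 := hB i (hi'.trans hj) x
        have e2 := hM (j - i) ((Nat.sub_le _ _).trans hj) x
        rw [Complex.norm_natCast]
        gcongr
    _ = 2 ^ j * (B * M) := by
        rw [← Finset.sum_mul]
        congr 1
        exact_mod_cast Nat.sum_range_choose j
    _ ≤ 2 ^ N * (B * M) := by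
        gcongr
        norm_num
    _ = 2 ^ N * B * M := by ring

/-- The product `m u` of a smooth function and a distribution: `(m u) φ = u (m φ)`. -/
def mulDist (m : TestFun) : PerDist →ₗ[ℂ] PerDist := transposeOp (mulTest m) (contTest_mulTest m)

/-- The distribution `φ ↦ ∫_0^{2π} g φ` of a smooth function `g`. -/
def ofTest (g : TestFun) : PerDist :=
  ⟨{ toFun := fun φ => ∫ x in (0 : ℝ)..(2 * Real.pi), g.1 x * φ.1 x
     map_add' := fun φ χ => by
      have h := intervalIntegral.integral_add (a := 0) (b := 2 * Real.pi)
        (μ := MeasureTheory.volume)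
        (((contTestFun g).mul (contTestFun φ)).intervalIntegrable _ _)
        (((contTestFun g).mul (contTestFun χ)).intervalIntegrable _ _)
      simp only [Pi.mul_apply] at h
      rw [← h]
      simp [mul_add]
     map_smul' := fun c φ => by
      simp [← intervalIntegral.integral_const_mul, mul_left_comm] }, by
    obtain ⟨B, hB⟩ := exists_boundedBy 0 g
    refine ⟨0, B * (2 * Real.pi), fun φ M hM => ?_⟩
    have h := intervalIntegral.norm_integral_le_of_norm_le_const (a := 0) (b := 2 * Real.pi)
      (f := fun x => g.1 x * φ.1 x) (C := B * M) (fun x _ => by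
        rw [norm_mul]
        have e1 := hB 0 le_rfl x
        have e2 := hM 0 le_rfl x
        simp only [iteratedDeriv_zero] at e1 e2
        exact mul_le_mul e1 e2 (norm_nonneg _) hB.nonneg)
    rw [sub_zero, abs_of_pos Real.two_pi_pos] at h
    calc _ ≤ B * M * (2 * Real.pi) := h
      _ = _ := by ring⟩

/-- The function `e^{-ilη}`. -/
def expTest (l : ℤ) : TestFun :=
  ⟨fun η => Complex.exp (-(Complex.I * l * (η : ℂ))), by
    refine ⟨?_, fun x => ?_⟩
    · have h : ContDiff ℝ ∞ (fun η : ℝ => (η : ℂ)) := Complex.ofRealCLM.contDiff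
      exact (contDiff_const.mul h).neg.cexp
    · rw [Complex.exp_eq_exp_iff_exists_int]
      exact ⟨-l, by push_cast; ring⟩⟩

/-- The Fourier coefficient `û(l) = (1/2π) ∫_0^{2π} u(η) e^{-ilη} dη` of a distribution. -/
def fourierCoef (l : ℤ) : PerDist →ₗ[ℂ] ℂ where
  toFun := fun u => (1 / (2 * (Real.pi : ℂ))) * u.1 (expTest l)
  map_add' := fun u v => by simp [mul_add]
  map_smul' := fun c u => by simp [mul_left_comm]

/-! ### Sobolev spaces on the circle -/

/-- The sequence `(1 + l²)^{s/2} û(l)`. -/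
def weightedCoef (s : ℝ) : PerDist →ₗ[ℂ] (ℤ → ℂ) where
  toFun := fun u l => (((1 + (l : ℝ) ^ 2) ^ (s / 2) : ℝ) : ℂ) * fourierCoef l u
  map_add' := fun u v => by ext l; simp [mul_add]
  map_smul' := fun c u => by ext l; simp [mul_left_comm]

lemma norm_weightedCoef_sq (s : ℝ) (u : PerDist) (l : ℤ) :
    ‖weightedCoef s u l‖ ^ (2 : ENNReal).toReal
      = (1 + (l : ℝ) ^ 2) ^ s * ‖fourierCoef l u‖ ^ 2 := by
  have h : (0 : ℝ) ≤ 1 + (l : ℝ) ^ 2 := by positivity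
  rw [ENNReal.toReal_ofNat, Real.rpow_ofNat]
  change ‖(((1 + (l : ℝ) ^ 2) ^ (s / 2) : ℝ) : ℂ) * fourierCoef l u‖ ^ 2 = _
  rw [norm_mul, mul_pow, Complex.norm_real, Real.norm_eq_abs, sq_abs, ← Real.rpow_natCast,
    ← Real.rpow_mul h]
  congr 2
  push_cast
  ring

lemma memlp_weightedCoef_iff (s : ℝ) (u : PerDist) :
    Memℓp (weightedCoef s u) 2 ↔
      Summable fun l : ℤ => (1 + (l : ℝ) ^ 2) ^ s * ‖fourierCoef l u‖ ^ 2 := by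
  rw [memℓp_gen_iff (by norm_num)]
  simp only [norm_weightedCoef_sq]

/-- The Sobolev space `H^s(T)` of the distributions with `∑_l (1 + l²)^s |û(l)|² < ∞`. -/
def sobolev (s : ℝ) : Submodule ℂ PerDist where
  carrier := {u | Summable fun l : ℤ => (1 + (l : ℝ) ^ 2) ^ s * ‖fourierCoef l u‖ ^ 2}
  add_mem' := fun {u v} hu hv => by
    change Summable _ at hu
    change Summable _ at hv
    change Summable _
    rw [← memlp_weightedCoef_iff] at hu hv ⊢
    rw [map_add]
    exact hu.add hv
  zero_mem' := by
    change Summable _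
    rw [← memlp_weightedCoef_iff, map_zero]
    exact zero_memℓp
  smul_mem' := fun c u hu => by
    change Summable _ at hu
    change Summable _
    rw [← memlp_weightedCoef_iff] at hu ⊢
    rw [map_smul]
    exact hu.const_smul c

/-! ### The space `H(T)` -/

/-- `ψ(η) = 1 - ξ cos η`. -/
def psi (ξ : ℝ) (η : ℝ) : ℝ := 1 - ξ * Real.cos η

lemma psi_pos (ξ : Set.Ioo (0 : ℝ) 1) (η : ℝ) : 0 < psi ξ η := by
  have h := Real.cos_le_one η
  have h0 := ξ.2.1
  have h1 := ξ.2.2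
  unfold psi
  nlinarith

lemma psi_contDiff (ξ : ℝ) : ContDiff ℝ ∞ (psi ξ) :=
  contDiff_const.sub (contDiff_const.mul Real.contDiff_cos)

lemma psi_periodic (ξ : ℝ) : Function.Periodic (psi ξ) (2 * Real.pi) := fun x => by
  simp [psi]

/-- The power `ψ^p` as a smooth function on the circle. -/
def psiPow (ξ : Set.Ioo (0 : ℝ) 1) (p : ℝ) : TestFun :=
  ⟨fun η => ((psi ξ η ^ p : ℝ) : ℂ),
    Complex.ofRealCLM.contDiff.comp
      ((psi_contDiff ξ).rpow_const_of_ne fun x => (psi_pos ξ x).ne'),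
    fun x => by
      change ((psi ξ (x + 2 * Real.pi) ^ p : ℝ) : ℂ) = _
      rw [psi_periodic (ξ : ℝ) x]⟩

/-- `H(T) = {g | ψ^{3/2} g ∈ H^{-1/2}(T)}`. -/
def HT (ξ : Set.Ioo (0 : ℝ) 1) : Submodule ℂ PerDist :=
  (sobolev (-1 / 2)).comap (mulDist (psiPow ξ (3 / 2)))

/-- The map `g ↦ ((1 + l²)^{-1/4} (ψ^{3/2} g)^(l))_l` from `H(T)` to `ℓ²(ℤ)`. -/
def HT.toL2 (ξ : Set.Ioo (0 : ℝ) 1) : HT ξ →ₗ[ℂ] lp (fun _ : ℤ => ℂ) 2 where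
  toFun := fun g => ⟨weightedCoef (-1 / 2) (mulDist (psiPow ξ (3 / 2)) g.1),
    (memlp_weightedCoef_iff _ _).2 g.2⟩
  map_add' := fun g h => by
    ext l
    simp only [Submodule.coe_add, map_add]
    rfl
  map_smul' := fun c g => by
    ext l
    simp only [Submodule.coe_smul, map_smul]
    rfl

/-- `H(T)` carries the norm `‖g‖_H = ‖ψ^{3/2} g‖_{-1/2}`; see `HT.norm_sq`. -/
instance HT.instSeminormedAddCommGroup (ξ : Set.Ioo (0 : ℝ) 1) :
    SeminormedAddCommGroup (HT ξ) :=
  SeminormedAddCommGroup.induced _ _ (HT.toL2 ξ)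

instance HT.instNormedSpace (ξ : Set.Ioo (0 : ℝ) 1) : NormedSpace ℂ (HT ξ) :=
  NormedSpace.induced ℂ _ _ (HT.toL2 ξ)

lemma HT.norm_sq (ξ : Set.Ioo (0 : ℝ) 1) (g : HT ξ) :
    ‖g‖ ^ 2 = ∑' l : ℤ, (1 + (l : ℝ) ^ 2) ^ (-1 / 2 : ℝ) *
      ‖fourierCoef l (mulDist (psiPow ξ (3 / 2)) g.1)‖ ^ 2 := by
  have h := lp.norm_rpow_eq_tsum (p := 2) (by norm_num) (HT.toL2 ξ g)
  change ‖g‖ ^ (2 : ENNReal).toReal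
    = ∑' l : ℤ, ‖weightedCoef (-1 / 2) (mulDist (psiPow ξ (3 / 2)) g.1) l‖ ^ (2 : ENNReal).toReal
    at h
  simp only [norm_weightedCoef_sq] at h
  rwa [ENNReal.toReal_ofNat, Real.rpow_ofNat] at h

/-! ### Integral operators on distributions -/

/-- The kernels `K(η, η')` whose integral operator extends to distributions by transposition:
`φ ↦ ∫_0^{2π} K(η, ·) φ(η) dη` is a continuous linear map of `C^∞(T)`. -/
structure RegularKernel (K : ℝ → ℝ → ℂ) : Prop where
  integrable : ∀ (x : ℝ) (φ : TestFun),
    IntervalIntegrable (fun η => K η x * φ.1 η) MeasureTheory.volume 0 (2 * Real.pi)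
  mem : ∀ φ : TestFun, (fun x => ∫ η in (0 : ℝ)..(2 * Real.pi), K η x * φ.1 η) ∈ TestFun
  bound : ∀ N : ℕ, ∃ (N' : ℕ) (C : ℝ), ∀ (φ : TestFun) (M : ℝ),
    BoundedBy N' M φ → BoundedBy N (C * M) ⟨_, mem φ⟩

/-- `φ ↦ ∫_0^{2π} K(η, ·) φ(η) dη` on test functions. -/
def kernelTest (K : ℝ → ℝ → ℂ) (hK : RegularKernel K) : TestFun →ₗ[ℂ] TestFun where
  toFun := fun φ => ⟨fun x => ∫ η in (0 : ℝ)..(2 * Real.pi), K η x * φ.1 η, hK.mem φ⟩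
  map_add' := fun φ χ => by
    ext x
    change (∫ η in (0 : ℝ)..(2 * Real.pi), K η x * (φ.1 η + χ.1 η)) = _ + _
    rw [← intervalIntegral.integral_add (hK.integrable x φ) (hK.integrable x χ)]
    simp [mul_add]
  map_smul' := fun c φ => by
    ext x
    simp [← intervalIntegral.integral_const_mul, mul_left_comm]

/-- The integral operator `g ↦ ∫_0^{2π} K(·, η') g(η') dη'` on distributions. -/
def kernelOp (K : ℝ → ℝ → ℂ) (hK : RegularKernel K) : PerDist →ₗ[ℂ] PerDist :=
  transposeOp (kernelTest K hK) hK.bound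

lemma RegularKernel.congr {K L : ℝ → ℝ → ℂ} (hK : RegularKernel K)
    (h : ∀ x, ∀ᵐ η, K η x = L η x) : RegularKernel L := by
  have e : ∀ (φ : TestFun), (fun x => ∫ η in (0 : ℝ)..(2 * Real.pi), L η x * φ.1 η)
      = fun x => ∫ η in (0 : ℝ)..(2 * Real.pi), K η x * φ.1 η := fun φ => by
    ext x
    refine intervalIntegral.integral_congr_ae ?_
    filter_upwards [h x] with η hη _
    rw [hη]
  have hm : ∀ φ : TestFun, (fun x => ∫ η in (0 : ℝ)..(2 * Real.pi), L η x * φ.1 η) ∈ TestFun :=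
    fun φ => (e φ).symm ▸ hK.mem φ
  refine ⟨fun x φ => ?_, hm, fun N => ?_⟩
  · refine (hK.integrable x φ).congr_ae (MeasureTheory.ae_restrict_of_ae ?_)
    filter_upwards [h x] with η hη
    rw [hη]
  · obtain ⟨N', C, hC⟩ := hK.bound N
    refine ⟨N', C, fun φ M hM => ?_⟩
    have := hC φ M hM
    have e' : (⟨_, hm φ⟩ : TestFun) = ⟨_, hK.mem φ⟩ := Subtype.ext (e φ)
    rwa [e']

lemma RegularKernel.sub {K L : ℝ → ℝ → ℂ} (hK : RegularKernel K) (hL : RegularKernel L) :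
    RegularKernel (fun η x => K η x - L η x) := by
  have e : ∀ (φ : TestFun),
      (fun x => ∫ η in (0 : ℝ)..(2 * Real.pi), (K η x - L η x) * φ.1 η)
      = (kernelTest K hK φ - kernelTest L hL φ).1 := fun φ => by
    ext x
    simp only [sub_mul]
    exact intervalIntegral.integral_sub (hK.integrable x φ) (hL.integrable x φ)
  have hm : ∀ φ : TestFun,
      (fun x => ∫ η in (0 : ℝ)..(2 * Real.pi), (K η x - L η x) * φ.1 η) ∈ TestFun :=
    fun φ => (e φ).symm ▸ (kernelTest K hK φ - kernelTest L hL φ).2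
  refine ⟨fun x φ => ?_, hm, fun N => ?_⟩
  · simp only [sub_mul]
    exact (hK.integrable x φ).sub (hL.integrable x φ)
  · obtain ⟨N₁, C₁, h₁⟩ := hK.bound N
    obtain ⟨N₂, C₂, h₂⟩ := hL.bound N
    refine ⟨max N₁ N₂, C₁ + C₂, fun φ M hM j hj x => ?_⟩
    have b₁ := h₁ φ M (hM.mono (le_max_left _ _)) j hj x
    have b₂ := h₂ φ M (hM.mono (le_max_right _ _)) j hj x
    change ‖iteratedDeriv j
      (fun x => ∫ η in (0 : ℝ)..(2 * Real.pi), (K η x - L η x) * φ.1 η) x‖ ≤ _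
    rw [e φ]
    have hs : iteratedDeriv j (kernelTest K hK φ - kernelTest L hL φ).1 x
        = iteratedDeriv j (kernelTest K hK φ).1 x - iteratedDeriv j (kernelTest L hL φ).1 x :=
      iteratedDeriv_sub
        ((kernelTest K hK φ).2.1.of_le (by exact_mod_cast le_top)).contDiffAt
        ((kernelTest L hL φ).2.1.of_le (by exact_mod_cast le_top)).contDiffAt
    rw [hs, add_mul]
    exact (norm_sub_le _ _).trans (add_le_add b₁ b₂)

/-- The correlation `x ↦ ∫_0^{2π} w(u) φ(u + x) du`. -/
def corr (w : ℝ → ℂ) (φ : TestFun) (x : ℝ) : ℂ :=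
  ∫ u in (0 : ℝ)..(2 * Real.pi), w u * φ.1 (u + x)

lemma corr_hasDerivAt {w : ℝ → ℂ}
    (hw : IntervalIntegrable w MeasureTheory.volume 0 (2 * Real.pi)) (φ : TestFun) (x : ℝ) :
    HasDerivAt (corr w φ) (corr w (derivTest φ) x) x := by
  obtain ⟨M, hM⟩ := exists_boundedBy 0 (derivTest φ)
  have hint : ∀ (χ : TestFun) (y : ℝ), IntervalIntegrable (fun u => w u * χ.1 (u + y))
      MeasureTheory.volume 0 (2 * Real.pi) := fun χ y =>
    hw.mul_continuousOn ((contTestFun χ).comp (continuous_id.add continuous_const)).continuousOn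
  refine (intervalIntegral.hasDerivAt_integral_of_dominated_loc_of_deriv_le
    (F := fun y u => w u * φ.1 (u + y)) (F' := fun y u => w u * (derivTest φ).1 (u + y))
    (bound := fun u => ‖w u‖ * M) (s := Set.univ) Filter.univ_mem
    (Filter.Eventually.of_forall fun y => ?_) (hint φ x) ?_ ?_ (hw.norm.mul_const M) ?_).2
  · exact ((intervalIntegrable_iff.1 (hint φ y)).aestronglyMeasurable)
  · exact ((intervalIntegrable_iff.1 (hint (derivTest φ) x)).aestronglyMeasurable)
  · refine Filter.Eventually.of_forall fun u _ y _ => ?_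
    rw [norm_mul]
    have := hM 0 le_rfl (u + y)
    rw [iteratedDeriv_zero] at this
    gcongr
  · refine Filter.Eventually.of_forall fun u _ y _ => ?_
    have hd : HasDerivAt φ.1 ((derivTest φ).1 (u + y)) (u + y) :=
      ((contDiff_infty_iff_deriv.1 φ.2.1).1 (u + y)).hasDerivAt
    exact (hd.comp_const_add u y).const_mul (w u)

lemma corr_deriv {w : ℝ → ℂ}
    (hw : IntervalIntegrable w MeasureTheory.volume 0 (2 * Real.pi)) (φ : TestFun) :
    deriv (corr w φ) = corr w (derivTest φ) := funext fun x => (corr_hasDerivAt hw φ x).deriv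

lemma corr_mem {w : ℝ → ℂ}
    (hw : IntervalIntegrable w MeasureTheory.volume 0 (2 * Real.pi)) (φ : TestFun) :
    corr w φ ∈ TestFun := by
  refine ⟨contDiff_infty.2 fun n => ?_, fun x => ?_⟩
  · induction n generalizing φ with
    | zero =>
      have : Continuous (corr w φ) :=
        (show Differentiable ℝ (corr w φ) from
          fun x => (corr_hasDerivAt hw φ x).differentiableAt).continuous
      exact_mod_cast contDiff_zero.2 this
    | succ n ih =>
      push_cast
      refine contDiff_succ_iff_deriv.2
        ⟨fun x => (corr_hasDerivAt hw φ x).differentiableAt, fun h => ?_, ?_⟩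
      · exact absurd h (by simp)
      · rw [corr_deriv hw]
        exact ih _
  · simp only [corr]
    congr 1
    ext u
    rw [← add_assoc, φ.2.2]

lemma corr_bound {w : ℝ → ℂ}
    (hw : IntervalIntegrable w MeasureTheory.volume 0 (2 * Real.pi)) (j : ℕ) (φ : TestFun) (M : ℝ)
    (hM : BoundedBy j M φ) (x : ℝ) :
    ‖iteratedDeriv j (corr w φ) x‖ ≤ (∫ u in (0 : ℝ)..(2 * Real.pi), ‖w u‖) * M := by
  induction j generalizing φ with
  | zero =>
    rw [iteratedDeriv_zero, ← intervalIntegral.integral_mul_const]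
    refine intervalIntegral.norm_integral_le_of_norm_le Real.two_pi_pos.le
      (Filter.Eventually.of_forall fun u _ => ?_) (hw.norm.mul_const M)
    rw [norm_mul]
    have := hM 0 le_rfl (u + x)
    rw [iteratedDeriv_zero] at this
    gcongr
  | succ j ih =>
    rw [iteratedDeriv_succ', corr_deriv hw]
    refine ih (derivTest φ) fun i hi y => ?_
    have := hM (i + 1) (by omega) y
    rwa [iteratedDeriv_succ'] at this

lemma regularKernel_conv {w : ℝ → ℂ} (hp : Function.Periodic w (2 * Real.pi))
    (hw : IntervalIntegrable w MeasureTheory.volume 0 (2 * Real.pi)) (m : TestFun) :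
    RegularKernel (fun η x => m.1 η * w (η - x)) := by
  have e : ∀ φ : TestFun,
      (fun x => ∫ η in (0 : ℝ)..(2 * Real.pi), m.1 η * w (η - x) * φ.1 η)
        = corr w (mulTest m φ) := fun φ => by
    ext x
    have h1 : (fun η => m.1 η * w (η - x) * φ.1 η)
        = fun η => (fun u => w u * (mulTest m φ).1 (u + x)) (η - x) := by
      ext η
      simp only [sub_add_cancel]
      change _ = w (η - x) * (m.1 η * φ.1 η)
      ring
    rw [h1, intervalIntegral.integral_comp_sub_right (fun u => w u * (mulTest m φ).1 (u + x)) x]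
    have hper : Function.Periodic (fun u => w u * (mulTest m φ).1 (u + x)) (2 * Real.pi) :=
      fun u => by
        change w (u + 2 * Real.pi) * (mulTest m φ).1 (u + 2 * Real.pi + x) = _
        rw [hp u, add_right_comm, (mulTest m φ).2.2]
    have h2 := hper.intervalIntegral_add_eq (0 - x) 0
    rw [show 0 - x + 2 * Real.pi = 2 * Real.pi - x by ring, zero_add] at h2
    rw [h2]
    rfl
  have hm : ∀ φ : TestFun,
      (fun x => ∫ η in (0 : ℝ)..(2 * Real.pi), m.1 η * w (η - x) * φ.1 η) ∈ TestFun :=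
    fun φ => (e φ).symm ▸ corr_mem hw _
  refine ⟨fun x φ => ?_, hm, fun N => ?_⟩
  · have hx : IntervalIntegrable (fun η => w (η - x)) MeasureTheory.volume 0 (2 * Real.pi) := by
      have h0 : IntervalIntegrable w MeasureTheory.volume (0 - x) (2 * Real.pi - x) :=
        hp.intervalIntegrable₀ Real.two_pi_pos.ne' hw _ _
      have := h0.comp_sub_right x
      simpa using this
    have := hx.mul_continuousOn (g := fun η => m.1 η * φ.1 η)
      ((contTestFun m).mul (contTestFun φ)).continuousOn
    refine this.congr fun η _ => ?_
    ring
  · obtain ⟨N', C, hC⟩ := contTest_mulTest m N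
    refine ⟨N', (∫ u in (0 : ℝ)..(2 * Real.pi), ‖w u‖) * C, fun φ M hM j hj x => ?_⟩
    change ‖iteratedDeriv j
      (fun x => ∫ η in (0 : ℝ)..(2 * Real.pi), m.1 η * w (η - x) * φ.1 η) x‖ ≤ _
    rw [e φ, mul_assoc]
    exact corr_bound hw j _ _ ((hC φ M hM).mono hj) x

/-! ### The kernels -/

/-- `μ(φ) = 1/ξ² + (1 - 1/ξ²) cos φ`. -/
def mu (ξ φ : ℝ) : ℝ := 1 / ξ ^ 2 + (1 - 1 / ξ ^ 2) * Real.cos φ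

/-- The kernel `k(η, η'; φ)` of the Neumann–Poincaré operator on the torus in toroidal
coordinates. -/
def npKernel (ξ η η' φ : ℝ) : ℝ :=
  (1 - ξ ^ 2) / (8 * Real.pi * √2 * ξ) * (psi ξ η ^ (1 / 2 : ℝ) / psi ξ η' ^ (3 / 2 : ℝ)) *
      (1 / (mu ξ φ - Real.cos (η - η')) ^ (1 / 2 : ℝ)) -
    (1 - ξ ^ 2) / (8 * Real.pi * √2 * ξ ^ 3) * (psi ξ η ^ (3 / 2 : ℝ) / psi ξ η' ^ (3 / 2 : ℝ)) *
      ((1 - Real.cos φ) / (mu ξ φ - Real.cos (η - η')) ^ (3 / 2 : ℝ))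

/-- `a_k(η, η')`: the `k`-th Fourier mode of the kernel of the Neumann–Poincaré operator in the
toroidal angle, conjugated by `ψ^{3/2}` and normalized. -/
def aKernel (ξ : ℝ) (k : ℤ) (η η' : ℝ) : ℂ :=
  (∫ φ in (0 : ℝ)..(2 * Real.pi),
      (npKernel ξ η η' φ : ℂ) * Complex.exp (-(Complex.I * k * (φ : ℂ)))) *
    ((psi ξ η' ^ (3 / 2 : ℝ) / psi ξ η ^ (3 / 2 : ℝ) : ℝ) : ℂ) *
    ((8 * Real.pi * √2 * ξ / (1 - ξ ^ 2) : ℝ) : ℂ)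

/-- `s_k(η) = ∫_0^{2π} e^{-ikφ} / (μ(φ) - cos η)^{1/2} dφ`. -/
def sFun (ξ : ℝ) (k : ℤ) (η : ℝ) : ℂ :=
  ∫ φ in (0 : ℝ)..(2 * Real.pi),
    Complex.exp (-(Complex.I * k * (φ : ℂ))) / (((mu ξ φ - Real.cos η) ^ (1 / 2 : ℝ) : ℝ) : ℂ)

/-- The second integral in the expression of `a_k`. -/
def tFun (ξ : ℝ) (k : ℤ) (η : ℝ) : ℂ :=
  ∫ φ in (0 : ℝ)..(2 * Real.pi),
    ((1 - Real.cos φ : ℝ) : ℂ) * Complex.exp (-(Complex.I * k * (φ : ℂ))) /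
      (((mu ξ φ - Real.cos η) ^ (3 / 2 : ℝ) : ℝ) : ℂ)


lemma mu_sub_cos (ξ φ η : ℝ) : mu ξ φ - Real.cos η
    = (1 / ξ ^ 2 - 1) * (1 - Real.cos φ) + (1 - Real.cos η) := by
  unfold mu
  ring

lemma coef_pos (ξ : Set.Ioo (0 : ℝ) 1) : 0 < 1 / (ξ : ℝ) ^ 2 - 1 := by
  have h0 := ξ.2.1
  have h1 := ξ.2.2
  rw [sub_pos, lt_div_iff₀ (by positivity)]
  nlinarith

lemma one_sub_cos_eq (x : ℝ) : 1 - Real.cos x = 2 * Real.sin (x / 2) ^ 2 := by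
  have h := Real.cos_sq (x / 2)
  have h' := Real.sin_sq_add_cos_sq (x / 2)
  rw [show 2 * (x / 2) = x by ring] at h
  linarith

lemma sin_half_pos {x : ℝ} (hx : x ∈ Set.Ioo 0 (2 * Real.pi)) : 0 < Real.sin (x / 2) :=
  Real.sin_pos_of_pos_of_lt_pi (by linarith [hx.1]) (by linarith [hx.2])

lemma intervalIntegrable_sin_half : IntervalIntegrable
    (fun x : ℝ => Real.sin (x / 2) ^ (-(1 / 2) : ℝ)) MeasureTheory.volume 0 (2 * Real.pi) := by
  have hmeas : Measurable (fun x : ℝ => Real.sin (x / 2) ^ (-(1 / 2) : ℝ)) := by fun_prop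
  have h1 : IntervalIntegrable (fun x : ℝ => Real.sin (x / 2) ^ (-(1 / 2) : ℝ))
      MeasureTheory.volume 0 Real.pi := by
    have h0 : IntervalIntegrable (fun x : ℝ => (1 / Real.pi) ^ (-(1 / 2) : ℝ) * x ^ (-(1 / 2) : ℝ))
        MeasureTheory.volume 0 Real.pi :=
      (intervalIntegral.intervalIntegrable_rpow' (by norm_num)).const_mul _
    refine h0.mono_fun hmeas.aestronglyMeasurable ?_
    rw [Filter.EventuallyLE, MeasureTheory.ae_restrict_iff' measurableSet_uIoc]
    refine Filter.Eventually.of_forall fun x hx => ?_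
    rw [Set.uIoc_of_le Real.pi_pos.le] at hx
    have hx0 := hx.1
    have hs : 1 / Real.pi * x ≤ Real.sin (x / 2) := by
      have := Real.mul_le_sin (x := x / 2) (by linarith) (by linarith [hx.2])
      calc 1 / Real.pi * x = 2 / Real.pi * (x / 2) := by ring
        _ ≤ _ := this
    have hp : 0 < 1 / Real.pi * x := by positivity
    rw [← Real.mul_rpow (by positivity) hx0.le,
      Real.norm_of_nonneg (Real.rpow_nonneg (hp.le.trans hs) _),
      Real.norm_of_nonneg (Real.rpow_nonneg hp.le _)]
    exact Real.rpow_le_rpow_of_nonpos hp hs (by norm_num)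
  have h2 := h1.comp_sub_left (2 * Real.pi)
  have h3 : (fun x : ℝ => Real.sin ((2 * Real.pi - x) / 2) ^ (-(1 / 2) : ℝ))
      = fun x : ℝ => Real.sin (x / 2) ^ (-(1 / 2) : ℝ) := by
    ext x
    rw [show (2 * Real.pi - x) / 2 = Real.pi - x / 2 by ring, Real.sin_pi_sub]
  rw [h3, sub_zero, show 2 * Real.pi - Real.pi = Real.pi by ring] at h2
  exact h1.trans h2.symm

lemma kernel_bound (ξ : Set.Ioo (0 : ℝ) 1) {η φ : ℝ} (hη : η ∈ Set.Ioo 0 (2 * Real.pi))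
    (hφ : φ ∈ Set.Ioo 0 (2 * Real.pi)) :
    0 < mu ξ φ - Real.cos η ∧ ((mu ξ φ - Real.cos η) ^ (1 / 2 : ℝ))⁻¹ ≤
      (4 * √(1 / (ξ : ℝ) ^ 2 - 1)) ^ (-(1 / 2) : ℝ) * Real.sin (η / 2) ^ (-(1 / 2) : ℝ) *
        Real.sin (φ / 2) ^ (-(1 / 2) : ℝ) := by
  have hc := coef_pos ξ
  have h1 := sin_half_pos hη
  have h2 := sin_half_pos hφ
  have hs := Real.sqrt_pos.2 hc
  have hpos : 0 < 4 * √(1 / (ξ : ℝ) ^ 2 - 1) * Real.sin (η / 2) * Real.sin (φ / 2) := by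
    positivity
  have hle : 4 * √(1 / (ξ : ℝ) ^ 2 - 1) * Real.sin (η / 2) * Real.sin (φ / 2)
      ≤ mu ξ φ - Real.cos η := by
    rw [mu_sub_cos, one_sub_cos_eq, one_sub_cos_eq]
    have hsq := Real.sq_sqrt hc.le
    nlinarith [sq_nonneg (√(1 / (ξ : ℝ) ^ 2 - 1) * Real.sin (φ / 2) - Real.sin (η / 2))]
  have hD := hpos.trans_le hle
  refine ⟨hD, ?_⟩
  rw [← Real.rpow_neg hD.le, ← Real.mul_rpow (by positivity) h1.le,
    ← Real.mul_rpow (by positivity) h2.le]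
  exact Real.rpow_le_rpow_of_nonpos hpos hle (by norm_num)

lemma integrable_of_kernel_bound (h : ℝ → ℝ → ℂ) (hm : Measurable (Function.uncurry h)) (B : ℝ)
    (hb : ∀ η ∈ Set.Ioo 0 (2 * Real.pi), ∀ φ ∈ Set.Ioo 0 (2 * Real.pi),
      ‖h η φ‖ ≤ B * Real.sin (η / 2) ^ (-(1 / 2) : ℝ) * Real.sin (φ / 2) ^ (-(1 / 2) : ℝ)) :
    IntervalIntegrable (fun η => ∫ φ in (0 : ℝ)..(2 * Real.pi), h η φ)
      MeasureTheory.volume 0 (2 * Real.pi) := by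
  have hmeas : MeasureTheory.StronglyMeasurable
      (fun η => ∫ φ in (0 : ℝ)..(2 * Real.pi), h η φ) := by
    simp only [intervalIntegral.integral_of_le Real.two_pi_pos.le]
    exact hm.stronglyMeasurable.integral_prod_right
  have hend : ∀ᵐ x : ℝ, x ≠ 2 * Real.pi := by
    simp [MeasureTheory.ae_iff]
  refine ((intervalIntegrable_sin_half.const_mul B).mul_const
    (∫ φ in (0 : ℝ)..(2 * Real.pi), Real.sin (φ / 2) ^ (-(1 / 2) : ℝ))).mono_fun
    hmeas.aestronglyMeasurable ?_
  rw [Filter.EventuallyLE, MeasureTheory.ae_restrict_iff' measurableSet_uIoc]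
  filter_upwards [hend] with η hη hη'
  rw [Set.uIoc_of_le Real.two_pi_pos.le] at hη'
  have hη₁ : η ∈ Set.Ioo 0 (2 * Real.pi) := ⟨hη'.1, lt_of_le_of_ne hη'.2 hη⟩
  refine le_trans ?_ (le_abs_self _)
  rw [← intervalIntegral.integral_const_mul]
  refine intervalIntegral.norm_integral_le_of_norm_le Real.two_pi_pos.le ?_
    (intervalIntegrable_sin_half.const_mul _)
  filter_upwards [hend] with φ hφ hφ'
  exact hb η hη₁ φ ⟨hφ'.1, lt_of_le_of_ne hφ'.2 hφ⟩

lemma norm_cexp_mode (k : ℤ) (φ : ℝ) : ‖Complex.exp (-(Complex.I * k * (φ : ℂ)))‖ = 1 := by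
  rw [show -(Complex.I * k * (φ : ℂ)) = ((-(k * φ) : ℝ) : ℂ) * Complex.I by push_cast; ring]
  exact Complex.norm_exp_ofReal_mul_I _

lemma sFun_integrable (ξ : Set.Ioo (0 : ℝ) 1) (k : ℤ) :
    IntervalIntegrable (sFun ξ k) MeasureTheory.volume 0 (2 * Real.pi) := by
  refine integrable_of_kernel_bound (fun η φ => Complex.exp (-(Complex.I * k * (φ : ℂ))) /
    (((mu ξ φ - Real.cos η) ^ (1 / 2 : ℝ) : ℝ) : ℂ)) ?_
    ((4 * √(1 / (ξ : ℝ) ^ 2 - 1)) ^ (-(1 / 2) : ℝ)) fun η hη φ hφ => ?_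
  · unfold mu Function.uncurry
    fun_prop
  · obtain ⟨hD, hb⟩ := kernel_bound ξ hη hφ
    rw [norm_div, norm_cexp_mode, Complex.norm_real,
      Real.norm_of_nonneg (Real.rpow_nonneg hD.le _), one_div]
    exact hb

lemma tFun_integrable (ξ : Set.Ioo (0 : ℝ) 1) (k : ℤ) :
    IntervalIntegrable (tFun ξ k) MeasureTheory.volume 0 (2 * Real.pi) := by
  refine integrable_of_kernel_bound (fun η φ => ((1 - Real.cos φ : ℝ) : ℂ) *
    Complex.exp (-(Complex.I * k * (φ : ℂ))) /
    (((mu ξ φ - Real.cos η) ^ (3 / 2 : ℝ) : ℝ) : ℂ)) ?_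
    ((1 / (ξ : ℝ) ^ 2 - 1)⁻¹ * (4 * √(1 / (ξ : ℝ) ^ 2 - 1)) ^ (-(1 / 2) : ℝ))
    fun η hη φ hφ => ?_
  · unfold mu Function.uncurry
    fun_prop
  · obtain ⟨hD, hb⟩ := kernel_bound ξ hη hφ
    have hc := coef_pos ξ
    have h1 : 0 ≤ 1 - Real.cos φ := by linarith [Real.cos_le_one φ]
    have h2 : 0 ≤ 1 - Real.cos η := by linarith [Real.cos_le_one η]
    have hq : (1 - Real.cos φ) / (mu ξ φ - Real.cos η) ≤ (1 / (ξ : ℝ) ^ 2 - 1)⁻¹ := by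
      rw [div_le_iff₀ hD, inv_mul_eq_div, le_div_iff₀ hc, mu_sub_cos]
      linarith
    have h32 : (mu ξ φ - Real.cos η) ^ (3 / 2 : ℝ)
        = (mu ξ φ - Real.cos η) * (mu ξ φ - Real.cos η) ^ (1 / 2 : ℝ) := by
      rw [show (3 / 2 : ℝ) = 1 + 1 / 2 by norm_num, Real.rpow_add hD, Real.rpow_one]
    rw [norm_div, norm_mul, norm_cexp_mode, Complex.norm_real, Complex.norm_real,
      Real.norm_of_nonneg (Real.rpow_nonneg hD.le _), Real.norm_of_nonneg h1, mul_one, h32,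
      ← div_div, div_eq_mul_inv _ ((mu ξ φ - Real.cos η) ^ (1 / 2 : ℝ)), mul_assoc, mul_assoc]
    rw [mul_assoc] at hb
    exact mul_le_mul hq hb (by positivity) (by positivity)

lemma sFun_periodic (ξ : ℝ) (k : ℤ) : Function.Periodic (sFun ξ k) (2 * Real.pi) := fun x => by
  simp [sFun]

lemma tFun_periodic (ξ : ℝ) (k : ℤ) : Function.Periodic (tFun ξ k) (2 * Real.pi) := fun x => by
  simp [tFun]

/-- The expression of `a_k` through `s_k` away from the diagonal. -/
lemma aKernel_eq (ξ : Set.Ioo (0 : ℝ) 1) (k : ℤ) {η η' : ℝ} (h : Real.cos (η - η') ≠ 1) :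
    aKernel ξ k η η' = ((psi ξ η ^ (-1 : ℝ) : ℝ) : ℂ) * sFun ξ k (η - η') -
      ((1 / (ξ : ℝ) ^ 2 : ℝ) : ℂ) * tFun ξ k (η - η') := by
  have hD : ∀ φ, 0 < mu ξ φ - Real.cos (η - η') := fun φ => by
    have h1 : 0 ≤ 1 - Real.cos φ := by linarith [Real.cos_le_one φ]
    have h2 : 0 < 1 - Real.cos (η - η') :=
      sub_pos.2 (lt_of_le_of_ne (Real.cos_le_one _) h)
    rw [mu_sub_cos]
    have := coef_pos ξ
    positivity
  have hmu : Continuous (fun φ => mu ξ φ - Real.cos (η - η')) := by unfold mu; fun_prop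
  have hpow : ∀ p : ℝ, Continuous
      (fun φ => (((mu ξ φ - Real.cos (η - η')) ^ p : ℝ) : ℂ)) := fun p =>
    Complex.continuous_ofReal.comp (hmu.rpow_const fun φ => Or.inl (hD φ).ne')
  have hne : ∀ (p φ : ℝ), (((mu ξ φ - Real.cos (η - η')) ^ p : ℝ) : ℂ) ≠ 0 := fun p φ =>
    Complex.ofReal_ne_zero.2 (Real.rpow_pos_of_pos (hD φ) p).ne'
  have hs : IntervalIntegrable (fun φ : ℝ => Complex.exp (-(Complex.I * k * (φ : ℂ))) /
      (((mu ξ φ - Real.cos (η - η')) ^ (1 / 2 : ℝ) : ℝ) : ℂ)) MeasureTheory.volume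
      0 (2 * Real.pi) :=
    (Continuous.div (by fun_prop) (hpow _) (hne _)).intervalIntegrable _ _
  have ht : IntervalIntegrable (fun φ : ℝ => ((1 - Real.cos φ : ℝ) : ℂ) *
      Complex.exp (-(Complex.I * k * (φ : ℂ))) /
      (((mu ξ φ - Real.cos (η - η')) ^ (3 / 2 : ℝ) : ℝ) : ℂ)) MeasureTheory.volume
      0 (2 * Real.pi) :=
    (Continuous.div (by fun_prop) (hpow _) (hne _)).intervalIntegrable _ _
  unfold aKernel sFun tFun
  rw [← intervalIntegral.integral_const_mul, ← intervalIntegral.integral_const_mul,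
    ← intervalIntegral.integral_sub (hs.const_mul _) (ht.const_mul _),
    ← intervalIntegral.integral_mul_const, ← intervalIntegral.integral_mul_const]
  congr 1
  ext φ
  have hψ := psi_pos ξ η
  have hψ' := psi_pos ξ η'
  have e1 : psi ξ η ^ (3 / 2 : ℝ) = psi ξ η * psi ξ η ^ (1 / 2 : ℝ) := by
    rw [show (3 / 2 : ℝ) = 1 + 1 / 2 by norm_num, Real.rpow_add hψ, Real.rpow_one]
  have hξ := ξ.2.1.ne'
  have hξ1 : (1 - (ξ : ℝ) ^ 2) ≠ 0 := by nlinarith [ξ.2.1, ξ.2.2]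
  have hx1 := (Real.rpow_pos_of_pos hψ (1 / 2)).ne'
  have hx2 := (Real.rpow_pos_of_pos hψ' (3 / 2)).ne'
  have hreal : npKernel ξ η η' φ * (psi ξ η' ^ (3 / 2 : ℝ) / psi ξ η ^ (3 / 2 : ℝ)) *
      (8 * Real.pi * √2 * ξ / (1 - (ξ : ℝ) ^ 2))
      = psi ξ η ^ (-1 : ℝ) * (1 / (mu ξ φ - Real.cos (η - η')) ^ (1 / 2 : ℝ)) -
        1 / (ξ : ℝ) ^ 2 * ((1 - Real.cos φ) / (mu ξ φ - Real.cos (η - η')) ^ (3 / 2 : ℝ)) := by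
    unfold npKernel
    rw [e1, Real.rpow_neg_one]
    have hy1 := (Real.rpow_pos_of_pos (hD φ) (1 / 2)).ne'
    have hy2 := (Real.rpow_pos_of_pos (hD φ) (3 / 2)).ne'
    have hpi := Real.pi_ne_zero
    have h2 : √(2 : ℝ) ≠ 0 := by positivity
    have hψ0 := hψ.ne'
    generalize (mu ξ φ - Real.cos (η - η')) ^ (1 / 2 : ℝ) = y1 at *
    generalize (mu ξ φ - Real.cos (η - η')) ^ (3 / 2 : ℝ) = y2 at *
    generalize psi ξ η' ^ (3 / 2 : ℝ) = x2 at *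
    generalize psi ξ η ^ (1 / 2 : ℝ) = x1 at *
    field_simp
  have hc := congrArg (fun r : ℝ => (r : ℂ) * Complex.exp (-(Complex.I * k * (φ : ℂ)))) hreal
  push_cast at hc ⊢
  linear_combination hc

lemma ae_cos_ne_one (x : ℝ) : ∀ᵐ η : ℝ, Real.cos (η - x) ≠ 1 := by
  rw [MeasureTheory.ae_iff]
  refine Set.Countable.measure_zero ?_ _
  refine (Set.countable_range (fun n : ℤ => (n : ℝ) * (2 * Real.pi) + x)).mono fun η hη => ?_
  simp only [ne_eq, not_not, Set.mem_ofPred_eq] at hη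
  obtain ⟨n, hn⟩ := (Real.cos_eq_one_iff _).1 hη
  exact ⟨n, by simp only [hn]; ring⟩

lemma sKernel_regular (ξ : Set.Ioo (0 : ℝ) 1) (k : ℤ) :
    RegularKernel (fun η η' => sFun ξ k (η - η')) := by
  have h := regularKernel_conv (sFun_periodic ξ k) (sFun_integrable ξ k) (psiPow ξ 0)
  refine h.congr fun x => Filter.Eventually.of_forall fun η => ?_
  simp [psiPow]

lemma aKernel_regular (ξ : Set.Ioo (0 : ℝ) 1) (k : ℤ) : RegularKernel (aKernel ξ k) := by
  have h1 := regularKernel_conv (sFun_periodic ξ k) (sFun_integrable ξ k) (psiPow ξ (-1))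
  have h2 := regularKernel_conv (tFun_periodic ξ k) (tFun_integrable ξ k)
    (((1 / (ξ : ℝ) ^ 2 : ℝ) : ℂ) • psiPow ξ 0)
  refine (h1.sub h2).congr fun x => ?_
  filter_upwards [ae_cos_ne_one x] with η hη
  rw [aKernel_eq ξ k hη]
  simp [psiPow]

/-! ### The operators and the sesquilinear form -/

/-- `S_k[g](η) = ∫_0^{2π} s_k(η - η') g(η') dη'`. -/
def opS (ξ : Set.Ioo (0 : ℝ) 1) (k : ℤ) : PerDist →ₗ[ℂ] PerDist :=
  kernelOp (fun η η' => sFun ξ k (η - η')) (sKernel_regular ξ k)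

/-- `A_k[g](η) = ∫_0^{2π} a_k(η, η') g(η') dη'`. -/
def opA (ξ : Set.Ioo (0 : ℝ) 1) (k : ℤ) : PerDist →ₗ[ℂ] PerDist :=
  kernelOp (aKernel ξ k) (aKernel_regular ξ k)

/-- The terms of the duality pairing `∫_0^{2π} u conj(v) dη = 2π ∑_l û(l) conj(v̂(l))`. -/
def pairingTerm (u v : PerDist) (l : ℤ) : ℂ :=
  2 * (Real.pi : ℂ) * (fourierCoef l u * (starRingEnd ℂ) (fourierCoef l v))

/-- The duality pairing `∫_0^{2π} u conj(v) dη` of distributions on the circle. -/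
def pairing (u v : PerDist) : ℂ := ∑' l : ℤ, pairingTerm u v l

/-- `⟨g₁, g₂⟩_k = ∫_0^{2π} g₁ conj(S_k[g₂]) dη`. -/
def formK (ξ : Set.Ioo (0 : ℝ) 1) (k : ℤ) (g₁ g₂ : PerDist) : ℂ := pairing g₁ (opS ξ k g₂)

end

end ToroidalNP
open ToroidalNP

/-!
Since `μ(φ) - cos η = (ξ⁻² - 1)(1 - cos φ) + (1 - cos η)`, the kernel of `A_k` is
`ψ(η)⁻¹ s_k(η - η') - ξ⁻² t_k(η - η')` with two integrable, real and even functions `s_k`, `t_k`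
(`opA_eq`). So `A_k = ψ⁻¹ S_k - ξ⁻² T_k`, where `S_k` and `T_k` are Fourier multipliers with real
symbols `σ(l)` and `τ(l)` (`fourierCoef_convDist`), and the whole statement is about these two
multipliers and about multiplication by powers of `ψ`.

* Multiplication by a smooth function is bounded on `H^{-1/2}(T)`, by Peetre's and Young's
  inequalities (`exists_mulDist_bound`). Hence `H(T)` is `H^{-1/2}(T)` with an equivalent norm, and
  `(1 + l²)^{-1/4} ĝ(l)` are coordinates that identify it with `ℓ²(ℤ)` (`HT.exists_coefEquiv`).
  This uses that a distribution is determined by its Fourier coefficients, because Fourier series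
  of test functions converge in `C^∞(T)` (`hasSum_dist_apply`), and that every sequence of
  polynomial growth occurs, because the coefficients of test functions decay rapidly
  (`exists_perDist_of_growth`).
* The symbol `σ(l)` lies between two positive multiples of `(1 + l²)^{-1/2}` (`exists_le_symbS`,
  `exists_symbS_le`). Writing `D^{-1/2} = π^{-1/2} ∫_0^∞ t^{-1/2} e^{-tD} dt` for
  `D = μ(φ) - cos η` separates the variables and gives
  `σ(l) = π^{-1/2} ∫_0^∞ t^{-1/2} p_t(l) p_{ct}(k) dt` with `c = ξ⁻² - 1`, where
  `p_t(n) = ∫_0^{2π} e^{-t(1 - cos x)} cos(nx) dx ≥ 0` is the heat kernel of `ℤ`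
  (`convCoef_sFun`). The bounds then follow from `p_t(n) ≤ C t^{-1/2}`,
  `n² p_t(n) ≤ C t^{1/2}`, and `p_t(n) ≥ c₀ t^{-1/2}` once `t` exceeds a multiple of `1 + n²`.
  Since `⟨g, g⟩_k = 2π ∑ σ(l) |ĝ(l)|²`, the form is an inner product equivalent to that of `H(T)`.
* By the Riemann–Lebesgue lemma `σ` and `τ` tend to zero, so `S_k` and `T_k` are compact on `H(T)`
  (`isCompactOperator_multiplier`), and so is `A_k`.
* Self-adjointness says that `S_k A_k = S_k ψ⁻¹ S_k - ξ⁻² S_k T_k` is symmetric for the duality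
  pairing, which is clear because `ψ`, `σ` and `τ` are real (`formK_opA_symm`). The double series
  behind it converges absolutely since `S_k` maps `H(T)` into `ℓ²` on the Fourier side
  (`pairing_mulDist`).
-/

open scoped ContDiff

namespace ToroidalNP

open MeasureTheory Filter Topology

/-! ### Fourier series of test functions and distributions -/

/-- The `l`-th Fourier coefficient as a linear functional on test functions. -/
noncomputable def testCoef (l : ℤ) : TestFun →ₗ[ℂ] ℂ :=
  (1 / (2 * (Real.pi : ℂ))) • (ofTest (expTest l)).1

lemma ofTest_apply (g φ : TestFun) :
    (ofTest g).1 φ = ∫ x in (0 : ℝ)..(2 * Real.pi), g.1 x * φ.1 x := rfl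

lemma ofTest_comm (g φ : TestFun) : (ofTest g).1 φ = (ofTest φ).1 g := by
  simp only [ofTest_apply, mul_comm]

lemma fourierCoef_apply (l : ℤ) (u : PerDist) :
    fourierCoef l u = (1 / (2 * (Real.pi : ℂ))) * u.1 (expTest l) := rfl

lemma fourierCoef_ofTest (l : ℤ) (φ : TestFun) : fourierCoef l (ofTest φ) = testCoef l φ := by
  rw [fourierCoef_apply, ofTest_comm]; rfl

lemma testCoef_apply (l : ℤ) (φ : TestFun) :
    testCoef l φ = (1 / (2 * (Real.pi : ℂ))) *
      ∫ x in (0 : ℝ)..(2 * Real.pi), φ.1 x * Complex.exp (-(Complex.I * l * (x : ℂ))) := by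
  rw [← fourierCoef_ofTest]; rfl

lemma expTest_apply (l : ℤ) (x : ℝ) :
    (expTest l).1 x = Complex.exp (-(Complex.I * l * (x : ℂ))) := rfl

lemma expTest_add (l m : ℤ) (x : ℝ) :
    (expTest (l + m)).1 x = (expTest l).1 x * (expTest m).1 x := by
  simp only [expTest_apply, ← Complex.exp_add]
  congr 1; push_cast; ring

lemma norm_expTest (l : ℤ) (x : ℝ) : ‖(expTest l).1 x‖ = 1 := norm_cexp_mode l x

lemma conj_expTest (l : ℤ) (x : ℝ) :
    (starRingEnd ℂ) ((expTest l).1 x) = (expTest (-l)).1 x := by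
  simp [expTest_apply, ← Complex.exp_conj]

lemma mulTest_expTest (l m : ℤ) : mulTest (expTest l) (expTest m) = expTest (l + m) := by
  ext x; exact (expTest_add l m x).symm

lemma testCoef_mulTest_expTest (l m : ℤ) (φ : TestFun) :
    testCoef l (mulTest φ (expTest m)) = testCoef (l + m) φ := by
  simp only [testCoef_apply]
  congr 1
  refine intervalIntegral.integral_congr fun x _ => ?_
  change φ.1 x * (expTest m).1 x * (expTest l).1 x = φ.1 x * (expTest (l + m)).1 x
  rw [expTest_add]; ring

lemma two_pi_ne_zero_complex : (2 * (Real.pi : ℂ)) ≠ 0 := by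
  simp [Real.pi_ne_zero]

lemma hasDerivAt_expTest (l : ℤ) (x : ℝ) :
    HasDerivAt (expTest l).1 (-(Complex.I * l) * (expTest l).1 x) x := by
  have h : HasDerivAt (fun y : ℝ => (y : ℂ)) 1 x := Complex.ofRealCLM.hasDerivAt
  have := ((h.const_mul (Complex.I * l)).neg).cexp
  convert! this using 1
  change -(Complex.I * l) * (expTest l).1 x
    = (expTest l).1 x * -(Complex.I * l * 1)
  ring

lemma testFun_hasDerivAt (φ : TestFun) (x : ℝ) : HasDerivAt φ.1 ((derivTest φ).1 x) x :=
  ((contDiff_infty_iff_deriv.1 φ.2.1).1 x).hasDerivAt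

lemma testFun_eval_two_pi (φ : TestFun) : φ.1 (2 * Real.pi) = φ.1 0 := by
  have := φ.2.2 0
  rwa [zero_add] at this

lemma testCoef_derivTest (l : ℤ) (φ : TestFun) :
    testCoef l (derivTest φ) = Complex.I * l * testCoef l φ := by
  have h := intervalIntegral.integral_mul_deriv_eq_deriv_mul (a := 0) (b := 2 * Real.pi)
    (u := (expTest l).1) (v := φ.1) (fun x _ => hasDerivAt_expTest l x)
    (fun x _ => testFun_hasDerivAt φ x)
    ((continuous_const.mul (contTestFun _)).intervalIntegrable _ _)
    ((contTestFun (derivTest φ)).intervalIntegrable _ _)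
  rw [testFun_eval_two_pi, testFun_eval_two_pi, sub_self, zero_sub] at h
  simp only [neg_mul, intervalIntegral.integral_neg, neg_neg, mul_assoc,
    intervalIntegral.integral_const_mul] at h
  change (1 / (2 * (Real.pi : ℂ))) * (∫ x in (0 : ℝ)..(2 * Real.pi),
    (expTest l).1 x * (derivTest φ).1 x) = _
  rw [h]
  change _ = Complex.I * l * ((1 / (2 * (Real.pi : ℂ))) * (∫ x in (0 : ℝ)..(2 * Real.pi),
    (expTest l).1 x * φ.1 x))
  ring

lemma iteratedDeriv_eq_iterate_derivTest (j : ℕ) (φ : TestFun) :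
    iteratedDeriv j φ.1 = (derivTest^[j] φ).1 := by
  induction j generalizing φ with
  | zero => simp
  | succ j ih => rw [iteratedDeriv_succ', Function.iterate_succ_apply]; exact ih (derivTest φ)

lemma testCoef_iterate_derivTest (j : ℕ) (l : ℤ) (φ : TestFun) :
    testCoef l (derivTest^[j] φ) = (Complex.I * l) ^ j * testCoef l φ := by
  induction j generalizing φ with
  | zero => simp
  | succ j ih => rw [Function.iterate_succ_apply, ih, testCoef_derivTest]; ring

lemma norm_testCoef_le {M : ℝ} {φ : TestFun} (h : ∀ x, ‖φ.1 x‖ ≤ M) (l : ℤ) :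
    ‖testCoef l φ‖ ≤ M := by
  have h1 := intervalIntegral.norm_integral_le_of_norm_le_const (a := 0) (b := 2 * Real.pi)
    (f := fun x => φ.1 x * Complex.exp (-(Complex.I * l * (x : ℂ)))) (C := M) (fun x _ => by
      rw [norm_mul, norm_cexp_mode, mul_one]; exact h x)
  rw [sub_zero, abs_of_pos Real.two_pi_pos] at h1
  rw [testCoef_apply, norm_mul]
  have h2 : ‖1 / (2 * (Real.pi : ℂ))‖ = (2 * Real.pi)⁻¹ := by
    simp [abs_of_pos Real.pi_pos]
  rw [h2, inv_mul_le_iff₀ Real.two_pi_pos]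
  linarith

/-- Rapid decay of the Fourier coefficients of a test function. -/
lemma testCoef_decay {p : ℕ} {M : ℝ} {φ : TestFun} (h : BoundedBy (2 * p) M φ) (l : ℤ) :
    (1 + (l : ℝ) ^ 2) ^ p * ‖testCoef l φ‖ ≤ 2 ^ p * M := by
  have h0 : ‖testCoef l φ‖ ≤ M := norm_testCoef_le (fun x => by simpa using h 0 (by omega) x) l
  have h1 : ((l : ℝ) ^ 2) ^ p * ‖testCoef l φ‖ ≤ M := by
    have h2 := norm_testCoef_le (φ := derivTest^[2 * p] φ) (M := M) (fun x => by
      rw [← iteratedDeriv_eq_iterate_derivTest]; exact h _ le_rfl x) l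
    rw [testCoef_iterate_derivTest, norm_mul, norm_pow, norm_mul, Complex.norm_I, one_mul,
      Complex.norm_intCast, pow_mul, sq_abs] at h2
    exact h2
  rcases le_total ((l : ℝ) ^ 2) 1 with hl | hl
  · calc _ ≤ (1 + 1 : ℝ) ^ p * M := by gcongr
      _ = _ := by norm_num
  · calc _ ≤ ((l : ℝ) ^ 2 + (l : ℝ) ^ 2) ^ p * ‖testCoef l φ‖ := by gcongr
      _ = 2 ^ p * (((l : ℝ) ^ 2) ^ p * ‖testCoef l φ‖) := by rw [← two_mul, mul_pow]; ring
      _ ≤ _ := by gcongr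

lemma summable_inv_one_add_sq : Summable fun l : ℤ => (1 + (l : ℝ) ^ 2)⁻¹ := by
  have h := (Real.summable_one_div_int_pow (p := 2)).2 (by norm_num)
  refine Summable.of_norm_bounded_eventually (g := fun l : ℤ => 1 / (l : ℝ) ^ 2) h ?_
  have : ∀ᶠ l : ℤ in cofinite, l ≠ 0 := (Set.finite_singleton (0 : ℤ)).eventually_cofinite_notMem
  filter_upwards [this] with l hl
  rw [Real.norm_of_nonneg (by positivity), one_div]
  have : (0 : ℝ) < (l : ℝ) ^ 2 := by positivity
  gcongr
  linarith

lemma summable_testCoef (p : ℕ) (φ : TestFun) :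
    Summable fun l : ℤ => (1 + (l : ℝ) ^ 2) ^ p * ‖testCoef l φ‖ := by
  obtain ⟨M, hM⟩ := exists_boundedBy (2 * (p + 1)) φ
  refine Summable.of_nonneg_of_le (fun l => by positivity) (fun l => ?_)
    (summable_inv_one_add_sq.mul_left (2 ^ (p + 1) * M))
  rw [← div_eq_mul_inv, le_div_iff₀ (by positivity)]
  have := testCoef_decay hM l
  calc _ = (1 + (l : ℝ) ^ 2) ^ (p + 1) * ‖testCoef l φ‖ := by ring
    _ ≤ _ := this

lemma summable_norm_testCoef (φ : TestFun) : Summable fun l : ℤ => ‖testCoef l φ‖ := by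
  simpa using summable_testCoef 0 φ

/-- A test function is the sum of its Fourier series. -/
lemma hasSum_fourier_testFun (φ : TestFun) (x : ℝ) :
    HasSum (fun n : ℤ => testCoef n φ * (expTest (-n)).1 x) (φ.1 x) := by
  have : Fact (0 < 2 * Real.pi) := ⟨Real.two_pi_pos⟩
  let f : C(AddCircle (2 * Real.pi), ℂ) :=
    ⟨φ.2.2.lift, continuous_coinduced_dom.2 (contTestFun φ)⟩
  have hπ : (Real.pi : ℂ) ≠ 0 := by simp [Real.pi_ne_zero]
  have hc : ∀ n : ℤ, fourierCoeff f n = testCoef n φ := fun n => by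
    rw [fourierCoeff_eq_intervalIntegral (f : AddCircle (2 * Real.pi) → ℂ) n 0, testCoef_apply,
      zero_add, Complex.real_smul]
    push_cast
    congr 1
    refine intervalIntegral.integral_congr fun y _ => ?_
    change fourier (-n) (y : AddCircle (2 * Real.pi)) * φ.1 y = _
    rw [fourier_coe_apply, mul_comm]
    congr 2
    push_cast
    field_simp
  have hs : Summable (fourierCoeff f) := by
    rw [← summable_norm_iff]
    simpa only [hc] using summable_norm_testCoef φ
  have h := has_pointwise_sum_fourier_series_of_summable hs (x : AddCircle (2 * Real.pi))
  have e : ∀ n : ℤ, fourier n (x : AddCircle (2 * Real.pi)) = (expTest (-n)).1 x := fun n => by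
    rw [fourier_coe_apply, expTest_apply]
    congr 1
    push_cast
    field_simp
  simp only [hc, e, smul_eq_mul] at h
  exact h

/-- The sup norm is at most the `ℓ¹` norm of the Fourier coefficients. -/
lemma norm_le_tsum_testCoef (φ : TestFun) (x : ℝ) : ‖φ.1 x‖ ≤ ∑' n : ℤ, ‖testCoef n φ‖ := by
  rw [← (hasSum_fourier_testFun φ x).tsum_eq]
  refine (norm_tsum_le_tsum_norm ?_).trans_eq ?_ <;>
  simp only [norm_mul, norm_expTest, mul_one]
  exact summable_norm_testCoef φ

lemma testCoef_expTest (l m : ℤ) : testCoef l (expTest m) = if l + m = 0 then 1 else 0 := by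
  have hc := two_pi_ne_zero_complex
  have h0 : ∀ n : ℤ, testCoef n (expTest 0) = if n = 0 then 1 else 0 := fun n => by
    by_cases hn : n = 0
    · subst hn
      rw [testCoef_apply]
      simp only [expTest_apply]
      simp
      field_simp
    · rw [if_neg hn]
      have h1 := testCoef_derivTest n (expTest 0)
      have h2 : derivTest (expTest 0) = 0 := by
        ext x
        change deriv (expTest 0).1 x = 0
        rw [(hasDerivAt_expTest 0 x).deriv]
        simp
      rw [h2, map_zero] at h1
      have h3 : Complex.I * (n : ℂ) ≠ 0 := mul_ne_zero Complex.I_ne_zero (by exact_mod_cast hn)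
      exact (mul_eq_zero.1 h1.symm).resolve_left h3
  rw [← h0, ← testCoef_mulTest_expTest, mulTest_expTest, zero_add]

/-- The Fourier series of a test function converges in the `C^∞` topology. -/
lemma boundedBy_sub_partial_sum (φ : TestFun) (N : ℕ) (F : Finset ℤ) :
    BoundedBy N (∑' n : {n // n ∉ F}, (1 + ((n : ℤ) : ℝ) ^ 2) ^ N * ‖testCoef n φ‖)
      (φ - ∑ n ∈ F, testCoef n φ • expTest (-n)) := by
  intro j hj x
  rw [iteratedDeriv_eq_iterate_derivTest]
  refine (norm_le_tsum_testCoef _ x).trans ?_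
  have hcoef : ∀ l, testCoef l (φ - ∑ n ∈ F, testCoef n φ • expTest (-n))
      = if l ∈ F then 0 else testCoef l φ := fun l => by
    simp only [map_sub, map_sum, map_smul, testCoef_expTest, smul_eq_mul, mul_ite, mul_one,
      mul_zero, ← sub_eq_add_neg, sub_eq_zero, Finset.sum_ite_eq]
    split_ifs <;> simp
  simp only [testCoef_iterate_derivTest, hcoef]
  have hs := summable_testCoef N φ
  have hle : ∀ l : ℤ, ‖(Complex.I * l) ^ j * (if l ∈ F then 0 else testCoef l φ)‖
      ≤ ({n | n ∉ F} : Set ℤ).indicator (fun l => (1 + (l : ℝ) ^ 2) ^ N * ‖testCoef l φ‖) l := by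
    intro l
    by_cases hl : l ∈ F
    · simp [hl]
    · rw [if_neg hl, Set.indicator_of_mem (show l ∈ {n | n ∉ F} from hl), norm_mul, norm_pow,
        norm_mul, Complex.norm_I, one_mul, Complex.norm_intCast]
      gcongr
      have h1 : |(l : ℝ)| ≤ 1 + (l : ℝ) ^ 2 := by
        rw [← sq_abs]; nlinarith [sq_nonneg (|(l : ℝ)| - 1)]
      calc |(l : ℝ)| ^ j ≤ (1 + (l : ℝ) ^ 2) ^ j := by gcongr
        _ ≤ _ := pow_le_pow_right₀ (by nlinarith [sq_nonneg (l : ℝ)]) hj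
  have hs' := hs.indicator {n | n ∉ F}
  have h := Summable.tsum_le_tsum hle (Summable.of_nonneg_of_le (fun _ => norm_nonneg _) hle hs')
    hs'
  rwa [← tsum_subtype] at h

/-- The value of a distribution on a test function through the Fourier coefficients of both. -/
lemma hasSum_dist_apply (u : PerDist) (φ : TestFun) :
    HasSum (fun l : ℤ => 2 * (Real.pi : ℂ) * (testCoef (-l) φ * fourierCoef l u)) (u.1 φ) := by
  have key : HasSum (fun n : ℤ => testCoef n φ * u.1 (expTest (-n))) (u.1 φ) := by
    obtain ⟨N, C, hC⟩ := u.2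
    have ht := tendsto_tsum_compl_atTop_zero
      (fun l : ℤ => (1 + (l : ℝ) ^ 2) ^ N * ‖testCoef l φ‖)
    rw [HasSum, SummationFilter.unconditional_filter, tendsto_iff_norm_sub_tendsto_zero]
    refine squeeze_zero (fun _ => norm_nonneg _) (fun F => ?_) (by simpa using ht.const_mul C)
    rw [norm_sub_rev]
    have := hC _ _ (boundedBy_sub_partial_sum φ N F)
    simpa only [map_sub, map_sum, map_smul, smul_eq_mul] using this
  rw [← (Equiv.neg ℤ).hasSum_iff] at key
  convert! key using 1
  ext l
  have := two_pi_ne_zero_complex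
  simp only [fourierCoef_apply, Function.comp_apply, Equiv.neg_apply, neg_neg]
  field_simp

/-- A distribution is determined by its Fourier coefficients. -/
lemma perDist_ext {u v : PerDist} (h : ∀ l, fourierCoef l u = fourierCoef l v) : u = v := by
  ext φ
  have h1 := hasSum_dist_apply u φ
  simp only [h] at h1
  exact h1.unique (hasSum_dist_apply v φ)

/-- Every sequence of polynomial growth is the sequence of Fourier coefficients of a
distribution. -/
lemma exists_perDist_of_growth (c : ℤ → ℂ) (p : ℕ) (B : ℝ)
    (hc : ∀ l : ℤ, ‖c l‖ ≤ B * (1 + (l : ℝ) ^ 2) ^ p) :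
    ∃ u : PerDist, ∀ l, fourierCoef l u = c l := by
  have hB : 0 ≤ B := by simpa using (norm_nonneg _).trans (hc 0)
  have hle : ∀ (φ : TestFun) (M : ℝ), BoundedBy (2 * (p + 1)) M φ → ∀ l : ℤ,
      ‖2 * (Real.pi : ℂ) * (testCoef (-l) φ * c l)‖
        ≤ 2 * Real.pi * (2 ^ (p + 1) * M * B) * (1 + (l : ℝ) ^ 2)⁻¹ := by
    intro φ M hM l
    have h1 := testCoef_decay hM (-l)
    push_cast at h1
    rw [neg_sq] at h1
    rw [← div_eq_mul_inv, le_div_iff₀ (by positivity), norm_mul (2 * (Real.pi : ℂ)),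
      norm_mul (testCoef (-l) φ)]
    have h2 : ‖2 * (Real.pi : ℂ)‖ = 2 * Real.pi := by simp [abs_of_pos Real.pi_pos]
    rw [h2]
    calc 2 * Real.pi * (‖testCoef (-l) φ‖ * ‖c l‖) * (1 + (l : ℝ) ^ 2)
        ≤ 2 * Real.pi * (‖testCoef (-l) φ‖ * (B * (1 + (l : ℝ) ^ 2) ^ p)) * (1 + (l : ℝ) ^ 2) := by
          gcongr; exact hc l
      _ = 2 * Real.pi * ((1 + (l : ℝ) ^ 2) ^ (p + 1) * ‖testCoef (-l) φ‖ * B) := by ring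
      _ ≤ _ := by gcongr
  have hsum : ∀ φ : TestFun, Summable fun l : ℤ => 2 * (Real.pi : ℂ) * (testCoef (-l) φ * c l) :=
    fun φ => by
      obtain ⟨M, hM⟩ := exists_boundedBy (2 * (p + 1)) φ
      exact Summable.of_norm_bounded (summable_inv_one_add_sq.mul_left _) (hle φ M hM)
  let f : TestFun →ₗ[ℂ] ℂ :=
    { toFun := fun φ => ∑' l : ℤ, 2 * (Real.pi : ℂ) * (testCoef (-l) φ * c l)
      map_add' := fun φ χ => by
        rw [← (hsum φ).tsum_add (hsum χ)]
        congr 1; ext l; rw [map_add]; ring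
      map_smul' := fun a φ => by
        rw [RingHom.id_apply, smul_eq_mul, ← tsum_mul_left]
        congr 1; ext l; rw [map_smul, smul_eq_mul]; ring }
  refine ⟨⟨f, 2 * (p + 1), 2 * Real.pi * (2 ^ (p + 1) * B) * ∑' l : ℤ, (1 + (l : ℝ) ^ 2)⁻¹,
    fun φ M hM => ?_⟩, fun l => ?_⟩
  · refine (tsum_of_norm_bounded (summable_inv_one_add_sq.mul_left _).hasSum
      (hle φ M hM)).trans_eq ?_
    rw [tsum_mul_left]; ring
  · rw [fourierCoef_apply]
    change (1 / (2 * (Real.pi : ℂ))) *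
      (∑' n : ℤ, 2 * (Real.pi : ℂ) * (testCoef (-n) (expTest l) * c n)) = c l
    rw [tsum_eq_single l]
    · rw [testCoef_expTest, if_pos (by ring)]
      have := two_pi_ne_zero_complex
      field_simp
    · intro n hn
      rw [testCoef_expTest, if_neg (by omega)]
      simp

/-! ### Discrete Young inequalities -/

lemma summable_conv_prod {b x : ℤ → ℝ} (hb : Summable b) (hx : Summable x) (hb0 : ∀ n, 0 ≤ b n)
    (hx0 : ∀ n, 0 ≤ x n) : Summable fun p : ℤ × ℤ => b (p.1 - p.2) * x p.2 := by
  have h := hb.mul_of_nonneg hx hb0 hx0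
  let e : ℤ × ℤ ≃ ℤ × ℤ :=
    ⟨fun p => (p.1 - p.2, p.2), fun p => (p.1 + p.2, p.2), fun p => by simp, fun p => by simp⟩
  exact e.summable_iff.2 h

lemma tsum_conv {b x : ℤ → ℝ} (hb : Summable b) (hx : Summable x) (hb0 : ∀ n, 0 ≤ b n)
    (hx0 : ∀ n, 0 ≤ x n) :
    HasSum (fun l : ℤ => ∑' j, b (l - j) * x j) ((∑' n, b n) * ∑' n, x n) := by
  have h := summable_conv_prod hb hx hb0 hx0
  have h1 := h.hasSum.prod_fiberwise (fun l => (h.prod_factor l).hasSum)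
  convert! h1 using 1
  let e : ℤ × ℤ ≃ ℤ × ℤ :=
    ⟨fun p => (p.1 - p.2, p.2), fun p => (p.1 + p.2, p.2), fun p => by simp, fun p => by simp⟩
  rw [hb.tsum_mul_tsum hx (hb.mul_of_nonneg hx hb0 hx0)]
  exact (e.tsum_eq (fun p : ℤ × ℤ => b p.1 * x p.2)).symm

/-- Cauchy–Schwarz for a series with nonnegative weights. -/
lemma sq_tsum_mul_le {a x : ℤ → ℝ} (ha : Summable a) (ha0 : ∀ n, 0 ≤ a n)
    (hx : Summable fun n => a n * x n ^ 2) :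
    Summable (fun n => a n * x n) ∧ (∑' n, a n * x n) ^ 2 ≤ (∑' n, a n) * ∑' n, a n * x n ^ 2 := by
  have hs : Summable (fun n => a n * x n) := by
    refine Summable.of_norm_bounded (ha.add hx) fun n => ?_
    rw [norm_mul, Real.norm_of_nonneg (ha0 n), ← mul_one_add]
    refine mul_le_mul_of_nonneg_left ?_ (ha0 n)
    rw [Real.norm_eq_abs, ← sq_abs]
    nlinarith [sq_nonneg (|x n| - 1)]
  refine ⟨hs, ?_⟩
  -- The quadratic polynomial `∑ a n (r - x n)²` in `r` is nonnegative.
  have hq : ∀ r : ℝ, 0 ≤ (∑' n, a n) * (r * r) + (-2 * ∑' n, a n * x n) * r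
      + ∑' n, a n * x n ^ 2 := fun r => by
    have h1 := ((ha.hasSum.mul_right (r * r)).add
      ((hs.hasSum.mul_left (-2)).mul_right r)).add hx.hasSum
    refine h1.nonneg fun n => ?_
    have : a n * (r * r) + -2 * (a n * x n) * r + a n * x n ^ 2 = a n * (r - x n) ^ 2 := by ring
    rw [this]
    exact mul_nonneg (ha0 n) (sq_nonneg _)
  have := discrim_le_zero hq
  rw [discrim] at this
  nlinarith

/-- Young's inequality `ℓ¹ * ℓ² ⊂ ℓ²`. -/
lemma young_sq {b x : ℤ → ℝ} (hb : Summable b) (hb0 : ∀ n, 0 ≤ b n)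
    (hx : Summable fun n => x n ^ 2) :
    (∀ l, Summable fun j => b (l - j) * x j) ∧
    Summable (fun l => (∑' j, b (l - j) * x j) ^ 2) ∧
    ∑' l, (∑' j, b (l - j) * x j) ^ 2 ≤ (∑' n, b n) ^ 2 * ∑' n, x n ^ 2 := by
  have h := summable_conv_prod hb hx hb0 (fun _ => sq_nonneg _)
  have hshift : ∀ l : ℤ, Summable (fun j => b (l - j)) := fun l =>
    (Equiv.subLeft l).summable_iff.2 hb
  have hB : ∀ l : ℤ, ∑' j, b (l - j) = ∑' n, b n := fun l => (Equiv.subLeft l).tsum_eq b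
  have hcs := fun l => sq_tsum_mul_le (hshift l) (fun j => hb0 (l - j)) (h.prod_factor l)
  have ht := (tsum_conv hb hx hb0 (fun _ => sq_nonneg _)).mul_left (∑' n, b n)
  have hle : ∀ l, (∑' j, b (l - j) * x j) ^ 2
      ≤ (∑' n, b n) * ∑' j, b (l - j) * x j ^ 2 := fun l => by
    have := (hcs l).2
    rwa [hB] at this
  have hs := Summable.of_nonneg_of_le (fun _ => sq_nonneg _) hle ht.summable
  refine ⟨fun l => (hcs l).1, hs, ?_⟩
  refine (hs.tsum_le_tsum hle ht.summable).trans_eq ?_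
  rw [ht.tsum_eq]; ring

/-- Absolute convergence of the bilinear form `∑ b(l - j) x_j y_l` on `ℓ²` for `b ∈ ℓ¹`. -/
lemma summable_bilinear {b x y : ℤ → ℝ} (hb : Summable b) (hb0 : ∀ n, 0 ≤ b n)
    (hx : Summable fun n => x n ^ 2) (hy : Summable fun n => y n ^ 2) :
    Summable fun p : ℤ × ℤ => b (p.1 - p.2) * x p.2 * y p.1 := by
  have h1 := summable_conv_prod hb hx hb0 (fun _ => sq_nonneg _)
  have h2 := summable_conv_prod ((Equiv.neg ℤ).summable_iff.2 hb) hy (fun _ => hb0 _)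
    (fun _ => sq_nonneg _)
  have h3 := (Equiv.prodComm ℤ ℤ).summable_iff.2 h2
  refine Summable.of_norm_bounded (h1.add h3) fun p => ?_
  simp only [Function.comp_apply, Equiv.prodComm_apply, Prod.fst_swap, Prod.snd_swap,
    Equiv.neg_apply, neg_sub]
  rw [mul_assoc, norm_mul, Real.norm_of_nonneg (hb0 _), ← mul_add]
  refine mul_le_mul_of_nonneg_left ?_ (hb0 _)
  rw [norm_mul, Real.norm_eq_abs, Real.norm_eq_abs, ← sq_abs (x p.2), ← sq_abs (y p.1)]
  nlinarith [sq_nonneg (|x p.2| - |y p.1|), sq_nonneg (|x p.2|), sq_nonneg (|y p.1|)]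

/-! ### Multiplication by smooth functions on `H^{-1/2}(T)` -/

lemma hasSum_fourierCoef_mulDist (m : TestFun) (u : PerDist) (l : ℤ) :
    HasSum (fun j : ℤ => testCoef (l - j) m * fourierCoef j u) (fourierCoef l (mulDist m u)) := by
  have h := (hasSum_dist_apply u (mulTest m (expTest l))).mul_left (1 / (2 * (Real.pi : ℂ)))
  convert! h using 1
  ext j
  have := two_pi_ne_zero_complex
  rw [testCoef_mulTest_expTest, neg_add_eq_sub]
  field_simp

/-- The squared norm of `H^{-1/2}(T)`. -/
noncomputable def sobSq (u : PerDist) : ℝ :=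
  ∑' l : ℤ, (1 + (l : ℝ) ^ 2) ^ (-1 / 2 : ℝ) * ‖fourierCoef l u‖ ^ 2

lemma weight_sq (l : ℤ) (z : ℂ) : ((1 + (l : ℝ) ^ 2) ^ (-1 / 4 : ℝ) * ‖z‖) ^ 2
    = (1 + (l : ℝ) ^ 2) ^ (-1 / 2 : ℝ) * ‖z‖ ^ 2 := by
  have h : (0 : ℝ) ≤ 1 + (l : ℝ) ^ 2 := by positivity
  rw [mul_pow, ← Real.rpow_natCast ((1 + (l : ℝ) ^ 2) ^ (-1 / 4 : ℝ)), ← Real.rpow_mul h]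
  norm_num

lemma mem_sobolev_iff (u : PerDist) : u ∈ sobolev (-1 / 2) ↔
    Summable fun l : ℤ => (1 + (l : ℝ) ^ 2) ^ (-1 / 2 : ℝ) * ‖fourierCoef l u‖ ^ 2 := Iff.rfl

/-- A form of Peetre's inequality. -/
lemma weight_peetre (l j : ℤ) : (1 + (l : ℝ) ^ 2) ^ (-1 / 4 : ℝ)
    ≤ 2 * (1 + ((l - j : ℤ) : ℝ) ^ 2) * (1 + (j : ℝ) ^ 2) ^ (-1 / 4 : ℝ) := by
  have hl : (0 : ℝ) < 1 + (l : ℝ) ^ 2 := by positivity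
  have hj : (0 : ℝ) < 1 + (j : ℝ) ^ 2 := by positivity
  -- `1 + j² ≤ d (1 + l²)`; the power `d^{1/4}` it produces is bounded by `d`.
  set d : ℝ := 2 * (1 + ((l - j : ℤ) : ℝ) ^ 2) with hd
  have hd1 : 1 ≤ d := by rw [hd]; nlinarith [sq_nonneg ((l - j : ℤ) : ℝ)]
  have hle : 1 + (j : ℝ) ^ 2 ≤ d * (1 + (l : ℝ) ^ 2) := by
    rw [hd]; push_cast
    nlinarith [sq_nonneg (2 * (l : ℝ) - j), sq_nonneg ((l : ℝ) * (l - j)), sq_nonneg ((l : ℝ) - j)]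
  have h1 : (d * (1 + (l : ℝ) ^ 2)) ^ (-1 / 4 : ℝ) ≤ (1 + (j : ℝ) ^ 2) ^ (-1 / 4 : ℝ) :=
    Real.rpow_le_rpow_of_nonpos hj hle (by norm_num)
  rw [Real.mul_rpow (by linarith) hl.le] at h1
  have h2 : d ^ (-1 : ℝ) ≤ d ^ (-1 / 4 : ℝ) := Real.rpow_le_rpow_of_exponent_le hd1 (by norm_num)
  rw [Real.rpow_neg_one] at h2
  have h3 := mul_le_mul_of_nonneg_right h2 (Real.rpow_nonneg hl.le (-1 / 4))
  have h4 := h3.trans h1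
  rwa [inv_mul_le_iff₀ (by linarith)] at h4

/-- Multiplication by a smooth function `m` is bounded on `H^{-1/2}(T)`: by Peetre's inequality the
weighted coefficients of `m u` are dominated by a convolution of those of `u` with the summable
sequence `2 (1 + n²) |m̂(n)|`. -/
lemma exists_mulDist_bound (m : TestFun) : ∃ C : ℝ, 0 ≤ C ∧ ∀ u ∈ sobolev (-1 / 2),
    mulDist m u ∈ sobolev (-1 / 2) ∧ sobSq (mulDist m u) ≤ C * sobSq u := by
  set b : ℤ → ℝ := fun n => 2 * (1 + (n : ℝ) ^ 2) * ‖testCoef n m‖ with hbdef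
  have hb : Summable b := by
    have := (summable_testCoef 1 m).mul_left 2
    simpa only [hbdef, pow_one, mul_assoc] using this
  have hb0 : ∀ n, 0 ≤ b n := fun n => by positivity
  refine ⟨(∑' n, b n) ^ 2, by positivity, fun u hu => ?_⟩
  rw [mem_sobolev_iff] at hu ⊢
  simp only [sobSq]
  simp only [← weight_sq] at hu ⊢
  obtain ⟨h1, h2, h3⟩ := young_sq hb hb0 hu
  have hle : ∀ l : ℤ, ((1 + (l : ℝ) ^ 2) ^ (-1 / 4 : ℝ) * ‖fourierCoef l (mulDist m u)‖) ^ 2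
      ≤ (∑' j, b (l - j) * ((1 + (j : ℝ) ^ 2) ^ (-1 / 4 : ℝ) * ‖fourierCoef j u‖)) ^ 2 := by
    intro l
    refine pow_le_pow_left₀ (by positivity) ?_ 2
    have hs := hasSum_fourierCoef_mulDist m u l
    rw [← hs.tsum_eq]
    have hn := hs.summable.norm
    refine (mul_le_mul_of_nonneg_left (norm_tsum_le_tsum_norm hn) (by positivity)).trans ?_
    rw [← tsum_mul_left]
    refine (hn.mul_left _).tsum_le_tsum (fun j => ?_) (h1 l)
    rw [norm_mul, ← mul_assoc]
    have := weight_peetre l j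
    calc _ ≤ 2 * (1 + ((l - j : ℤ) : ℝ) ^ 2) * (1 + (j : ℝ) ^ 2) ^ (-1 / 4 : ℝ)
          * ‖testCoef (l - j) m‖ * ‖fourierCoef j u‖ := by gcongr
      _ = _ := by rw [hbdef]; ring
  have hs := Summable.of_nonneg_of_le (fun _ => sq_nonneg _) hle h2
  exact ⟨hs, (hs.tsum_le_tsum hle h2).trans h3⟩

lemma intervalIntegral_conj (f : ℝ → ℂ) (a b : ℝ) :
    ∫ x in a..b, (starRingEnd ℂ) (f x) = (starRingEnd ℂ) (∫ x in a..b, f x) := by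
  simp only [intervalIntegral, integral_conj, map_sub]

lemma testCoef_conj {m : TestFun} (hm : ∀ x, (starRingEnd ℂ) (m.1 x) = m.1 x) (n : ℤ) :
    (starRingEnd ℂ) (testCoef n m) = testCoef (-n) m := by
  rw [testCoef_apply, testCoef_apply, map_mul, ← intervalIntegral_conj]
  congr 1
  · simp [Complex.conj_ofNat]
  · refine intervalIntegral.integral_congr fun x _ => ?_
    change (starRingEnd ℂ) (m.1 x * (expTest n).1 x) = m.1 x * (expTest (-n)).1 x
    rw [map_mul, hm, conj_expTest]

/-- Multiplication by a real function is symmetric for the duality pairing. -/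
lemma pairing_mulDist {m : TestFun} (hm : ∀ x, (starRingEnd ℂ) (m.1 x) = m.1 x) {u v : PerDist}
    (hu : Summable fun l => ‖fourierCoef l u‖ ^ 2) (hv : Summable fun l => ‖fourierCoef l v‖ ^ 2) :
    ∃ s, HasSum (pairingTerm (mulDist m u) v) s ∧ HasSum (pairingTerm u (mulDist m v)) s := by
  let F : ℤ × ℤ → ℂ := fun p => 2 * (Real.pi : ℂ) *
    (testCoef (p.1 - p.2) m * fourierCoef p.2 u * (starRingEnd ℂ) (fourierCoef p.1 v))
  have hs : Summable F := by
    have h0 := summable_bilinear (summable_norm_testCoef m) (fun _ => norm_nonneg _) hu hv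
    refine Summable.mul_left _ (Summable.of_norm (h0.congr fun p => ?_))
    rw [norm_mul, norm_mul, RCLike.norm_conj]
  have h1 : ∀ l, HasSum (fun j => F (l, j)) (pairingTerm (mulDist m u) v l) := fun l => by
    have h0 := ((hasSum_fourierCoef_mulDist m u l).mul_right
      ((starRingEnd ℂ) (fourierCoef l v))).mul_left (2 * (Real.pi : ℂ))
    exact h0
  have h2 : ∀ j, HasSum (fun l => F (l, j)) (pairingTerm u (mulDist m v) j) := fun j => by
    have h0 := ((Complex.hasSum_conj'.2 (hasSum_fourierCoef_mulDist m v j)).mul_left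
      (fourierCoef j u)).mul_left (2 * (Real.pi : ℂ))
    convert! h0 using 1
    ext l
    rw [map_mul, testCoef_conj hm, neg_sub]
    simp only [F]
    ring
  have h3 := hs.hasSum.prod_fiberwise h1
  have h4 := HasSum.prod_fiberwise (f := fun p : ℤ × ℤ => F (p.2, p.1))
    ((Equiv.prodComm ℤ ℤ).hasSum_iff.2 hs.hasSum) h2
  exact ⟨_, h3, h4⟩

/-! ### Diagonal operators on `ℓ²(ℤ)` -/

/-- The space `ℓ²(ℤ)`. -/
noncomputable abbrev EllTwo := lp (fun _ : ℤ => ℂ) 2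

/-- The diagonal operator on `ℓ²(ℤ)` of a bounded sequence. -/
noncomputable def diagOp (τ : ℤ → ℂ) (B : ℝ) (hτ : ∀ l, ‖τ l‖ ≤ B) : EllTwo →L[ℂ] EllTwo :=
  have hle : ∀ (c : EllTwo) (l : ℤ), ‖τ l * c l‖ ≤ ‖((B : ℂ) • c) l‖ := fun c l => by
    rw [lp.coeFn_smul, Pi.smul_apply, smul_eq_mul, norm_mul, norm_mul, Complex.norm_real]
    exact mul_le_mul_of_nonneg_right ((hτ l).trans (le_abs_self _)) (norm_nonneg _)
  LinearMap.mkContinuous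
    { toFun := fun c => ⟨fun l => τ l * c l, (lp.memℓp ((B : ℂ) • c)).mono' (hle c)⟩
      map_add' := fun c d => by ext l; exact mul_add _ _ _
      map_smul' := fun a c => by ext l; exact mul_left_comm _ _ _ } |B| (fun c => by
    refine (lp.norm_mono two_ne_zero (hle c)).trans ?_
    rw [norm_smul, Complex.norm_real, Real.norm_eq_abs])

lemma diagOp_apply {τ : ℤ → ℂ} {B : ℝ} (hτ : ∀ l, ‖τ l‖ ≤ B) (c : EllTwo) (l : ℤ) :
    diagOp τ B hτ c l = τ l * c l := rfl

/-- A diagonal operator with finitely many nonzero entries. -/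
noncomputable def finDiagOp (τ : ℤ → ℂ) (F : Finset ℤ) : EllTwo →L[ℂ] EllTwo :=
  ∑ l ∈ F, (lp.singleContinuousLinearMap ℂ (fun _ : ℤ => ℂ) 2 l).comp
    (τ l • lp.evalCLM ℂ (fun _ : ℤ => ℂ) 2 l)

lemma finDiagOp_apply (τ : ℤ → ℂ) (F : Finset ℤ) (c : EllTwo) (l : ℤ) :
    finDiagOp τ F c l = if l ∈ F then τ l * c l else 0 := by
  rw [finDiagOp, sum_apply, lp.coeFn_sum, Finset.sum_apply]
  have : ∀ j ∈ F, ((lp.singleContinuousLinearMap ℂ (fun _ : ℤ => ℂ) 2 j).comp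
    (τ j • lp.evalCLM ℂ (fun _ : ℤ => ℂ) 2 j)) c l = if l = j then τ j * c j else 0 := by
    intro j _
    change lp.single (E := fun _ : ℤ => ℂ) 2 j (τ j * c j) l = _
    split_ifs with h
    · subst h; exact lp.single_apply_self _ _ _
    · exact lp.single_apply_ne _ _ _ h
  rw [Finset.sum_congr rfl this, Finset.sum_ite_eq]

lemma isCompactOperator_finDiagOp (τ : ℤ → ℂ) (F : Finset ℤ) :
    IsCompactOperator (finDiagOp τ F) := by
  rw [finDiagOp]
  induction F using Finset.induction_on with
  | empty => simpa using isCompactOperator_zero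
  | insert a s ha ih =>
    rw [Finset.sum_insert ha]
    refine IsCompactOperator.add ?_ ih
    exact (isCompactOperator_of_locallyCompactSpace_rng
      (lp.singleContinuousLinearMap ℂ (fun _ : ℤ => ℂ) 2 a)).comp_clm _

/-- A diagonal operator whose entries tend to zero is compact. -/
lemma isCompactOperator_diagOp {τ : ℤ → ℂ} {B : ℝ} (hτ : ∀ l, ‖τ l‖ ≤ B)
    (h0 : Tendsto τ cofinite (𝓝 0)) : IsCompactOperator (diagOp τ B hτ) := by
  refine isCompactOperator_of_tendsto (l := atTop) (F := finDiagOp τ) ?_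
    (Eventually.of_forall (isCompactOperator_finDiagOp τ))
  rw [Metric.tendsto_atTop]
  intro ε hε
  have h1 := (Metric.tendsto_nhds.1 h0) (ε / 2) (half_pos hε)
  rw [eventually_cofinite] at h1
  refine ⟨h1.toFinset, fun F hF => ?_⟩
  rw [dist_eq_norm]
  refine lt_of_le_of_lt (ContinuousLinearMap.opNorm_le_bound _ (half_pos hε).le fun c => ?_)
    (half_lt_self hε)
  have hle : ∀ l, ‖(finDiagOp τ F - diagOp τ B hτ) c l‖ ≤ ‖(((ε / 2 : ℝ) : ℂ) • c) l‖ := by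
    intro l
    rw [sub_apply, lp.coeFn_sub, Pi.sub_apply, finDiagOp_apply, diagOp_apply]
    split_ifs with hl
    · rw [sub_self, norm_zero]; exact norm_nonneg _
    · rw [zero_sub, norm_neg, lp.coeFn_smul, Pi.smul_apply, smul_eq_mul, norm_mul, norm_mul,
        Complex.norm_real, Real.norm_of_nonneg (half_pos hε).le]
      refine mul_le_mul_of_nonneg_right ?_ (norm_nonneg _)
      by_contra hc
      refine hl (hF (h1.mem_toFinset.2 ?_))
      change ¬ dist (τ l) 0 < ε / 2
      rw [dist_zero_right]
      linarith
  refine (lp.norm_mono two_ne_zero hle).trans_eq ?_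
  rw [norm_smul, Complex.norm_real, Real.norm_of_nonneg (half_pos hε).le]

/-! ### The space `H(T)` is `H^{-1/2}(T)` with an equivalent norm -/

lemma mulTest_psiPow (ξ : Set.Ioo (0 : ℝ) 1) (p : ℝ) (φ : TestFun) :
    mulTest (psiPow ξ p) (mulTest (psiPow ξ (-p)) φ) = φ := by
  ext x
  change ((psi ξ x ^ p : ℝ) : ℂ) * (((psi ξ x ^ (-p) : ℝ) : ℂ) * φ.1 x) = φ.1 x
  rw [← mul_assoc, ← Complex.ofReal_mul, ← Real.rpow_add (psi_pos ξ x), add_neg_cancel,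
    Real.rpow_zero, Complex.ofReal_one, one_mul]

lemma mulDist_psiPow (ξ : Set.Ioo (0 : ℝ) 1) (p : ℝ) (u : PerDist) :
    mulDist (psiPow ξ (-p)) (mulDist (psiPow ξ p) u) = u := by
  ext φ
  exact congrArg u.1 (mulTest_psiPow ξ p φ)

lemma mem_HT_iff (ξ : Set.Ioo (0 : ℝ) 1) (g : PerDist) : g ∈ HT ξ ↔ g ∈ sobolev (-1 / 2) := by
  refine ⟨fun h => ?_, fun h => ?_⟩
  · obtain ⟨C, -, hC⟩ := exists_mulDist_bound (psiPow ξ (-(3 / 2)))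
    have := (hC _ h).1
    rwa [mulDist_psiPow] at this
  · obtain ⟨C, -, hC⟩ := exists_mulDist_bound (psiPow ξ (3 / 2))
    exact (hC _ h).1

lemma HT.norm_sq_eq (ξ : Set.Ioo (0 : ℝ) 1) (g : HT ξ) :
    ‖g‖ ^ 2 = sobSq (mulDist (psiPow ξ (3 / 2)) g.1) := HT.norm_sq ξ g

lemma exists_norm_sq_le_sobSq (ξ : Set.Ioo (0 : ℝ) 1) :
    ∃ C : ℝ, 0 ≤ C ∧ ∀ g : HT ξ, ‖g‖ ^ 2 ≤ C * sobSq g.1 := by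
  obtain ⟨C, h0, hC⟩ := exists_mulDist_bound (psiPow ξ (3 / 2))
  refine ⟨C, h0, fun g => ?_⟩
  rw [HT.norm_sq_eq]
  exact (hC _ ((mem_HT_iff ξ _).1 g.2)).2

lemma exists_sobSq_le_norm_sq (ξ : Set.Ioo (0 : ℝ) 1) :
    ∃ C : ℝ, 0 ≤ C ∧ ∀ g : HT ξ, sobSq g.1 ≤ C * ‖g‖ ^ 2 := by
  obtain ⟨C, h0, hC⟩ := exists_mulDist_bound (psiPow ξ (-(3 / 2)))
  refine ⟨C, h0, fun g => ?_⟩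
  rw [HT.norm_sq_eq]
  have := (hC _ g.2).2
  rwa [mulDist_psiPow] at this

/-- The map `g ↦ ((1 + l²)^{-1/4} ĝ(l))_l` from `H(T)` to `ℓ²(ℤ)`. -/
noncomputable def HT.coefMap (ξ : Set.Ioo (0 : ℝ) 1) : HT ξ →ₗ[ℂ] EllTwo where
  toFun := fun g => ⟨weightedCoef (-1 / 2) g.1,
    (memlp_weightedCoef_iff _ _).2 ((mem_HT_iff ξ _).1 g.2)⟩
  map_add' := fun g h => by
    ext l
    simp only [Submodule.coe_add, map_add]
    rfl
  map_smul' := fun c g => by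
    ext l
    simp only [Submodule.coe_smul, map_smul]
    rfl

lemma HT.norm_coefMap_sq (ξ : Set.Ioo (0 : ℝ) 1) (g : HT ξ) :
    ‖HT.coefMap ξ g‖ ^ 2 = sobSq g.1 := by
  have h := lp.norm_rpow_eq_tsum (p := 2) (by norm_num) (HT.coefMap ξ g)
  change ‖HT.coefMap ξ g‖ ^ (2 : ENNReal).toReal
    = ∑' l : ℤ, ‖weightedCoef (-1 / 2) g.1 l‖ ^ (2 : ENNReal).toReal at h
  simp only [norm_weightedCoef_sq] at h
  rwa [ENNReal.toReal_ofNat, Real.rpow_ofNat] at h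

lemma HT.coefMap_bijective (ξ : Set.Ioo (0 : ℝ) 1) : Function.Bijective (HT.coefMap ξ) := by
  have hpos : ∀ l : ℤ, (0 : ℝ) < 1 + (l : ℝ) ^ 2 := fun l => by positivity
  have hne : ∀ l : ℤ, (((1 + (l : ℝ) ^ 2) ^ (-1 / 2 / 2 : ℝ) : ℝ) : ℂ) ≠ 0 := fun l =>
    Complex.ofReal_ne_zero.2 (Real.rpow_pos_of_pos (hpos l) _).ne'
  refine ⟨fun g h hgh => Subtype.ext (perDist_ext fun l => ?_), fun c => ?_⟩
  · have := congrArg (fun c : EllTwo => c l) hgh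
    exact mul_left_cancel₀ (hne l) this
  · obtain ⟨u, hu⟩ := exists_perDist_of_growth
      (fun l => (((1 + (l : ℝ) ^ 2) ^ (1 / 4 : ℝ) : ℝ) : ℂ) * c l) 1 ‖c‖ (fun l => by
        rw [norm_mul, Complex.norm_real, Real.norm_of_nonneg (Real.rpow_nonneg (hpos l).le _),
          mul_comm]
        have h1 := lp.norm_apply_le_norm two_ne_zero c l
        have h2 : (1 + (l : ℝ) ^ 2) ^ (1 / 4 : ℝ) ≤ (1 + (l : ℝ) ^ 2) ^ 1 := by
          rw [pow_one]
          conv_rhs => rw [← Real.rpow_one (1 + (l : ℝ) ^ 2)]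
          exact Real.rpow_le_rpow_of_exponent_le (by nlinarith [sq_nonneg (l : ℝ)]) (by norm_num)
        exact mul_le_mul h1 h2 (Real.rpow_nonneg (hpos l).le _) (norm_nonneg _))
    have hw : ∀ l : ℤ, weightedCoef (-1 / 2) u l = c l := fun l => by
      change (((1 + (l : ℝ) ^ 2) ^ (-1 / 2 / 2 : ℝ) : ℝ) : ℂ) * fourierCoef l u = c l
      rw [hu, ← mul_assoc, ← Complex.ofReal_mul, ← Real.rpow_add (hpos l)]
      norm_num
    have hmem : u ∈ HT ξ := by
      rw [mem_HT_iff]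
      refine (memlp_weightedCoef_iff _ _).1 ?_
      rw [funext hw]
      exact lp.memℓp c
    exact ⟨⟨u, hmem⟩, lp.ext (funext hw)⟩

/-- `H(T)` is isomorphic, as a topological vector space, to `ℓ²(ℤ)`. -/
lemma HT.exists_coefEquiv (ξ : Set.Ioo (0 : ℝ) 1) :
    ∃ e : HT ξ ≃L[ℂ] EllTwo, ∀ g, e g = HT.coefMap ξ g := by
  obtain ⟨C, hC, h1⟩ := exists_sobSq_le_norm_sq ξ
  obtain ⟨D, hD, h2⟩ := exists_norm_sq_le_sobSq ξ
  let e := LinearEquiv.ofBijective (HT.coefMap ξ) (HT.coefMap_bijective ξ)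
  refine ⟨e.toContinuousLinearEquivOfBounds (√C) (√D) (fun g => ?_) (fun c => ?_), fun g => rfl⟩
  · refine (sq_le_sq₀ (norm_nonneg _) (by positivity)).1 ?_
    rw [mul_pow, Real.sq_sqrt hC]
    exact (HT.norm_coefMap_sq ξ g).trans_le (h1 g)
  · refine (sq_le_sq₀ (norm_nonneg _) (by positivity)).1 ?_
    rw [mul_pow, Real.sq_sqrt hD]
    have h3 := HT.norm_coefMap_sq ξ (e.symm c)
    rw [show HT.coefMap ξ (e.symm c) = c from e.apply_symm_apply c] at h3
    rw [h3]
    exact h2 _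

/-- A Fourier multiplier tending to zero is compact on `H(T)`. -/
lemma isCompactOperator_multiplier (ξ : Set.Ioo (0 : ℝ) 1) (T : PerDist →ₗ[ℂ] PerDist) (τ : ℤ → ℂ)
    (hT : ∀ l u, fourierCoef l (T u) = τ l * fourierCoef l u) (B : ℝ) (hB : ∀ l, ‖τ l‖ ≤ B)
    (h0 : Tendsto τ cofinite (𝓝 0)) :
    ∃ h : ∀ g ∈ HT ξ, T g ∈ HT ξ, IsCompactOperator (T.restrict h) := by
  have hw : ∀ (u : PerDist) (l : ℤ),
      weightedCoef (-1 / 2) (T u) l = τ l * weightedCoef (-1 / 2) u l := fun u l => by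
    change _ * fourierCoef l (T u) = τ l * (_ * fourierCoef l u)
    rw [hT]; ring
  have hmem : ∀ g ∈ HT ξ, T g ∈ HT ξ := fun g hg => by
    rw [mem_HT_iff] at hg ⊢
    refine (memlp_weightedCoef_iff _ _).1 ?_
    rw [funext (hw g)]
    exact lp.memℓp (diagOp τ B hB ⟨_, (memlp_weightedCoef_iff _ _).2 hg⟩)
  obtain ⟨e, he⟩ := HT.exists_coefEquiv ξ
  refine ⟨hmem, ?_⟩
  have h1 := ((isCompactOperator_diagOp hB h0).comp_clm (e : HT ξ →L[ℂ] EllTwo)).clm_comp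
    (e.symm : EllTwo →L[ℂ] HT ξ)
  convert! h1 using 1
  ext1 g
  refine e.injective ?_
  change e (T.restrict hmem g) = e (e.symm (diagOp τ B hB (e g)))
  rw [e.apply_symm_apply, he, he]
  exact lp.ext (funext (hw g.1))

/-- Multiplication by a smooth function is continuous on `H(T)`. -/
lemma exists_clm_mulDist (ξ : Set.Ioo (0 : ℝ) 1) (m : TestFun) :
    ∃ M : HT ξ →L[ℂ] HT ξ, ∀ g, (M g).1 = mulDist m g.1 := by
  obtain ⟨C, hC, h1⟩ := exists_sobSq_le_norm_sq ξ
  obtain ⟨D, hD, h2⟩ := exists_norm_sq_le_sobSq ξ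
  obtain ⟨E, hE, h3⟩ := exists_mulDist_bound m
  have hmem : ∀ g ∈ HT ξ, mulDist m g ∈ HT ξ := fun g hg => by
    rw [mem_HT_iff] at hg ⊢
    exact (h3 g hg).1
  have hb : ∀ g : HT ξ, ‖(mulDist m).restrict hmem g‖ ≤ √(D * (E * C)) * ‖g‖ := fun g => by
    have e1 := h2 ((mulDist m).restrict hmem g)
    have e2 := (h3 _ ((mem_HT_iff ξ _).1 g.2)).2
    have e3 := h1 g
    rw [LinearMap.coe_restrict_apply] at e1
    rw [← sq_le_sq₀ (norm_nonneg _) (by positivity), mul_pow, Real.sq_sqrt (by positivity)]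
    calc _ ≤ D * sobSq (mulDist m g.1) := e1
      _ ≤ D * (E * sobSq g.1) := by gcongr
      _ ≤ D * (E * (C * ‖g‖ ^ 2)) := by gcongr
      _ = _ := by ring
  exact ⟨((mulDist m).restrict hmem).mkContinuous _ hb, fun g =>
    LinearMap.coe_restrict_apply hmem g⟩

/-! ### The heat kernel `∫_0^{2π} e^{-t(1 - cos x)} cos(nx) dx` of the integers -/

/-- The Fourier coefficients of `e^{-t(1 - cos x)}`; up to a factor `2π`, the transition
probabilities of the continuous time simple random walk on `ℤ`. -/
noncomputable def heatCoef (t : ℝ) (n : ℤ) : ℝ :=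
  ∫ x in (0 : ℝ)..(2 * Real.pi), Real.exp (-t * (1 - Real.cos x)) * Real.cos (n * x)

lemma heatCoef_zero_right (t : ℝ) :
    heatCoef t 0 = ∫ x in (0 : ℝ)..(2 * Real.pi), Real.exp (-t * (1 - Real.cos x)) := by
  simp [heatCoef]

lemma continuous_heat (t : ℝ) : Continuous fun x : ℝ => Real.exp (-t * (1 - Real.cos x)) := by
  fun_prop

lemma abs_integral_heat_mul_le {B s : ℝ} {g : ℝ → ℝ}
    (h : ∀ x, |g x| ≤ B * Real.exp (-s * (1 - Real.cos x))) :
    |∫ x in (0 : ℝ)..(2 * Real.pi), g x| ≤ B * heatCoef s 0 := by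
  rw [heatCoef_zero_right, ← intervalIntegral.integral_const_mul, ← Real.norm_eq_abs]
  exact intervalIntegral.norm_integral_le_of_norm_le Real.two_pi_pos.le
    (Eventually.of_forall fun x _ => h x)
    ((continuous_const.mul (continuous_heat s)).intervalIntegrable _ _)

lemma abs_heatCoef_le (t : ℝ) (n : ℤ) : |heatCoef t n| ≤ heatCoef t 0 := by
  have := abs_integral_heat_mul_le (B := 1) (s := t)
    (g := fun x => Real.exp (-t * (1 - Real.cos x)) * Real.cos (n * x)) fun x => by
      rw [abs_mul, Real.abs_exp, one_mul]
      exact mul_le_of_le_one_right (Real.exp_pos _).le (Real.abs_cos_le_one _)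
  rwa [one_mul] at this

/-- The constant `C` in the diagonal bound `C t^{-1/2}` of the heat kernel, the value given by the
comparison with `∫ e^{-2tx²/π²} dx` over `ℝ`. -/
noncomputable def heatConst : ℝ := √(Real.pi ^ 3 / 2)

lemma heatConst_pos : 0 < heatConst := Real.sqrt_pos.2 (by positivity)

/-- Upper bound on the diagonal, by comparison with a Gaussian integral over `ℝ`. -/
lemma heatCoef_zero_le {t : ℝ} (ht : 0 < t) : heatCoef t 0 ≤ heatConst / √t := by
  set b : ℝ := 2 * t / Real.pi ^ 2 with hb
  have hb0 : 0 < b := by positivity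
  have hper : Function.Periodic (fun x : ℝ => Real.exp (-t * (1 - Real.cos x))) (2 * Real.pi) :=
    fun x => by simp
  have h1 := hper.intervalIntegral_add_eq 0 (-Real.pi)
  rw [zero_add, show -Real.pi + 2 * Real.pi = Real.pi by ring] at h1
  have hI := integrable_exp_neg_mul_sq hb0
  rw [heatCoef_zero_right, h1]
  calc ∫ x in -Real.pi..Real.pi, Real.exp (-t * (1 - Real.cos x))
      ≤ ∫ x in -Real.pi..Real.pi, Real.exp (-b * x ^ 2) := by
        refine intervalIntegral.integral_mono_on (by linarith [Real.pi_pos])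
          ((continuous_heat t).intervalIntegrable _ _)
          (Continuous.intervalIntegrable (by fun_prop) _ _) fun x hx => ?_
        have := Real.cos_le_one_sub_mul_cos_sq (abs_le.2 hx)
        refine Real.exp_le_exp.2 ?_
        have h2 : t * (2 / Real.pi ^ 2 * x ^ 2) ≤ t * (1 - Real.cos x) := by
          gcongr; linarith
        have h3 : b * x ^ 2 = t * (2 / Real.pi ^ 2 * x ^ 2) := by rw [hb]; ring
        linarith
    _ ≤ ∫ x, Real.exp (-b * x ^ 2) := by
        rw [intervalIntegral.integral_of_le (by linarith [Real.pi_pos])]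
        exact setIntegral_le_integral hI (Eventually.of_forall fun x => (Real.exp_pos _).le)
    _ = heatConst / √t := by
        rw [integral_gaussian, heatConst, ← Real.sqrt_div (by positivity)]
        congr 1
        rw [hb]; field_simp

/-- Lower bound on the diagonal: on `[0, t^{-1/2}]` the integrand is at least `e^{-1/2}`. -/
lemma le_heatCoef_zero {t : ℝ} (ht : 1 ≤ t) : Real.exp (-(1 / 2)) / √t ≤ heatCoef t 0 := by
  have ht0 : 0 < t := by linarith
  have hs : 1 ≤ √t := Real.one_le_sqrt.2 ht
  have hs0 : 0 < √t := by linarith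
  have hle : 1 / √t ≤ 2 * Real.pi := by
    have : 1 / √t ≤ 1 := by rw [div_le_one hs0]; exact hs
    linarith [Real.pi_gt_three]
  have hc := continuous_heat t
  rw [heatCoef_zero_right,
    ← intervalIntegral.integral_add_adjacent_intervals (hc.intervalIntegrable 0 (1 / √t))
      (hc.intervalIntegrable _ _)]
  have h2 : 0 ≤ ∫ x in (1 / √t)..(2 * Real.pi), Real.exp (-t * (1 - Real.cos x)) :=
    intervalIntegral.integral_nonneg hle fun x _ => (Real.exp_pos _).le
  have h1 : ∫ _ in (0 : ℝ)..(1 / √t), Real.exp (-(1 / 2))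
      ≤ ∫ x in (0 : ℝ)..(1 / √t), Real.exp (-t * (1 - Real.cos x)) := by
    refine intervalIntegral.integral_mono_on (by positivity) (by simp)
      (hc.intervalIntegrable _ _) fun x hx => Real.exp_le_exp.2 ?_
    have e1 := Real.one_sub_sq_div_two_le_cos (x := x)
    have e2 : x ^ 2 ≤ 1 / t := by
      have := pow_le_pow_left₀ hx.1 hx.2 2
      rwa [div_pow, one_pow, Real.sq_sqrt ht0.le] at this
    have e3 : t * x ^ 2 ≤ 1 := by
      have := mul_le_mul_of_nonneg_left e2 ht0.le
      rwa [mul_one_div_cancel ht0.ne'] at this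
    nlinarith
  rw [intervalIntegral.integral_const, sub_zero, smul_eq_mul] at h1
  have : Real.exp (-(1 / 2)) / √t = 1 / √t * Real.exp (-(1 / 2)) := by ring
  linarith

/-- The inequality `y e^{-y} ≤ e^{-y/2}` for `y = t (1 - cos x)`. -/
lemma mul_heat_le (t x : ℝ) : t * (1 - Real.cos x) * Real.exp (-t * (1 - Real.cos x))
    ≤ Real.exp (-(t / 2) * (1 - Real.cos x)) := by
  set y := t * (1 - Real.cos x)
  have h1 : y ≤ Real.exp (y / 2) := by
    have h2 := Real.add_one_le_exp (y / 4)
    rcases le_total y 0 with hy | hy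
    · exact hy.trans (Real.exp_pos _).le
    · have : Real.exp (y / 2) = Real.exp (y / 4) ^ 2 := by rw [← Real.exp_nat_mul]; congr 1; ring
      rw [this]
      nlinarith [sq_nonneg (y / 4 - 1)]
  rw [show -t * (1 - Real.cos x) = -y by ring,
    show -(t / 2) * (1 - Real.cos x) = y / 2 + -y by ring, Real.exp_add]
  exact mul_le_mul_of_nonneg_right h1 (Real.exp_pos _).le

lemma heatCoef_half_le {t : ℝ} (ht : 0 < t) : heatCoef (t / 2) 0 ≤ √2 * heatConst / √t := by
  refine (heatCoef_zero_le (half_pos ht)).trans_eq ?_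
  rw [Real.sqrt_div ht.le]
  have := (Real.sqrt_pos.2 ht).ne'
  field_simp

lemma abs_sin_nat_mul_le (n : ℕ) (y : ℝ) : |Real.sin (n * y)| ≤ n * |Real.sin y| := by
  induction n with
  | zero => simp
  | succ n ih =>
    push_cast
    rw [add_mul, one_mul, Real.sin_add]
    calc _ ≤ |Real.sin (n * y) * Real.cos y| + |Real.cos (n * y) * Real.sin y| := abs_add_le _ _
      _ ≤ |Real.sin (n * y)| * 1 + 1 * |Real.sin y| := by
        rw [abs_mul, abs_mul]
        gcongr <;> exact Real.abs_cos_le_one _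
      _ ≤ _ := by linarith

lemma one_sub_cos_int_mul_le (n : ℤ) (x : ℝ) :
    1 - Real.cos (n * x) ≤ (n : ℝ) ^ 2 * (1 - Real.cos x) := by
  have h : |Real.sin (n * x / 2)| ≤ |(n : ℝ)| * |Real.sin (x / 2)| := by
    have h1 := abs_sin_nat_mul_le n.natAbs (x / 2)
    have h2 : ((n.natAbs : ℕ) : ℝ) = |(n : ℝ)| := by simp [Nat.cast_natAbs]
    rw [h2] at h1
    rcases abs_cases (n : ℝ) with ⟨h3, -⟩ | ⟨h3, -⟩
    · rw [h3] at h1 ⊢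
      rwa [mul_div_assoc]
    · rw [h3] at h1 ⊢
      rwa [neg_mul, Real.sin_neg, abs_neg, ← mul_div_assoc] at h1
  rw [one_sub_cos_eq, one_sub_cos_eq]
  have := pow_le_pow_left₀ (abs_nonneg _) h 2
  rw [mul_pow, sq_abs, sq_abs, sq_abs] at this
  linarith

/-- Off-diagonal lower bound of the heat kernel: near the diagonal it is comparable to its
value on the diagonal. -/
lemma le_heatCoef {t : ℝ} (ht : 1 ≤ t) (n : ℤ) :
    Real.exp (-(1 / 2)) / √t - (n : ℝ) ^ 2 / t * (√2 * heatConst / √t) ≤ heatCoef t n := by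
  have ht0 : 0 < t := by linarith
  have h1 := abs_integral_heat_mul_le (B := (n : ℝ) ^ 2 / t) (s := t / 2)
    (g := fun x => Real.exp (-t * (1 - Real.cos x)) * (1 - Real.cos (n * x)))
    fun x => by
      have hc : 0 ≤ 1 - Real.cos (n * x) := by linarith [Real.cos_le_one (n * x)]
      rw [abs_of_nonneg (by positivity)]
      have h2 := one_sub_cos_int_mul_le n x
      have h3 := mul_heat_le t x
      calc _ ≤ Real.exp (-t * (1 - Real.cos x)) * ((n : ℝ) ^ 2 * (1 - Real.cos x)) := by gcongr
        _ = (n : ℝ) ^ 2 / t * (t * (1 - Real.cos x) * Real.exp (-t * (1 - Real.cos x))) := by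
          field_simp
        _ ≤ _ := by gcongr
  have h4 : ∫ x in (0 : ℝ)..(2 * Real.pi),
      Real.exp (-t * (1 - Real.cos x)) * (1 - Real.cos (n * x)) = heatCoef t 0 - heatCoef t n := by
    rw [heatCoef_zero_right, heatCoef, ← intervalIntegral.integral_sub
      ((continuous_heat t).intervalIntegrable _ _)
      (Continuous.intervalIntegrable (by fun_prop) _ _)]
    congr 1; ext x; ring
  rw [h4] at h1
  have h5 := (le_abs_self _).trans h1
  have h6 := mul_le_mul_of_nonneg_left (heatCoef_half_le ht0)
    (show 0 ≤ (n : ℝ) ^ 2 / t by positivity)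
  linarith [le_heatCoef_zero ht]

/-- In the diffusive regime `t ≥ K (1 + n²)` the heat kernel is bounded below by a multiple of
`t^{-1/2}`. -/
lemma exists_le_heatCoef : ∃ K c₀ : ℝ, 1 ≤ K ∧ 0 < c₀ ∧
    ∀ (n : ℤ) (t : ℝ), K * (1 + (n : ℝ) ^ 2) ≤ t → c₀ / √t ≤ heatCoef t n := by
  set E := Real.exp (-(1 / 2)) with hE
  have hE0 : 0 < E := Real.exp_pos _
  set A := √2 * heatConst with hA
  have hA0 : 0 < A := mul_pos (by positivity) heatConst_pos
  -- The correction `A n² / t` in `le_heatCoef` is at most half of the main term once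
  -- `t ≥ 2 A n² / E`; the summand `1` ensures `t ≥ 1`.
  refine ⟨1 + 2 * A / E, E / 2, by simp; positivity, by positivity, fun n t ht => ?_⟩
  have hq : 0 ≤ 2 * A / E := by positivity
  have ht1 : 1 ≤ t := by nlinarith [sq_nonneg (n : ℝ)]
  have ht0 : 0 < t := by linarith
  refine le_trans ?_ (le_heatCoef ht1 n)
  rw [← hE, ← hA]
  have h1 : 2 * A / E * (n : ℝ) ^ 2 ≤ t := by nlinarith [sq_nonneg (n : ℝ)]
  have h2 : (n : ℝ) ^ 2 / t * A ≤ E / 2 := by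
    rw [div_mul_eq_mul_div, div_le_iff₀ ht0]
    rw [div_mul_eq_mul_div, div_le_iff₀ hE0] at h1
    linarith
  have h3 : E / √t - (n : ℝ) ^ 2 / t * (A / √t) = (E - (n : ℝ) ^ 2 / t * A) / √t := by ring
  rw [h3]
  gcongr
  linarith

/-- Off-diagonal upper bound of the heat kernel, by two integrations by parts. -/
lemma sq_mul_abs_heatCoef_le {t : ℝ} (ht : 0 < t) (n : ℤ) :
    (n : ℝ) ^ 2 * |heatCoef t n| ≤ 3 * (√2 * heatConst) * √t := by
  set f : ℝ → ℝ := fun x => Real.exp (-t * (1 - Real.cos x)) with hf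
  set f₁ : ℝ → ℝ := fun x => -t * Real.sin x * f x with hf1
  set f₂ : ℝ → ℝ := fun x => (t ^ 2 * Real.sin x ^ 2 - t * Real.cos x) * f x with hf2
  have hd : ∀ x, HasDerivAt f (f₁ x) x := fun x => by
    have := (((Real.hasDerivAt_cos x).const_sub 1).const_mul (-t)).exp
    convert! this using 1
    simp only [hf1, hf]; ring
  have hd1 : ∀ x, HasDerivAt f₁ (f₂ x) x := fun x => by
    have := ((Real.hasDerivAt_sin x).const_mul (-t)).mul (hd x)
    convert! this using 1
    simp only [hf1, hf2]; ring
  have hs : ∀ x, HasDerivAt (fun x => Real.sin (n * x)) (Real.cos (n * x) * n) x := fun x => by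
    have := ((hasDerivAt_id x).const_mul (n : ℝ)).sin
    simpa using this
  have hcs : ∀ x, HasDerivAt (fun x => -Real.cos (n * x)) (Real.sin (n * x) * n) x := fun x => by
    have := (((hasDerivAt_id x).const_mul (n : ℝ)).cos).fun_neg
    simpa using this
  have hfc : Continuous f := by simp only [hf]; fun_prop
  have hf1c : Continuous f₁ := by simp only [hf1]; fun_prop
  have hf2c : Continuous f₂ := by simp only [hf2]; fun_prop
  have hsn : Real.sin (n * (2 * Real.pi)) = 0 := by
    rw [show (n : ℝ) * (2 * Real.pi) = ((2 * n : ℤ) : ℝ) * Real.pi by push_cast; ring]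
    exact Real.sin_int_mul_pi _
  have i1 := intervalIntegral.integral_mul_deriv_eq_deriv_mul (a := 0) (b := 2 * Real.pi)
    (fun x _ => hd x) (fun x _ => hs x) (hf1c.intervalIntegrable _ _)
    (Continuous.intervalIntegrable (by fun_prop) _ _)
  have i2 := intervalIntegral.integral_mul_deriv_eq_deriv_mul (a := 0) (b := 2 * Real.pi)
    (fun x _ => hd1 x) (fun x _ => hcs x) (hf2c.intervalIntegrable _ _)
    (Continuous.intervalIntegrable (by fun_prop) _ _)
  have e0 : f₁ 0 = 0 := by simp [hf1]
  have e1 : f₁ (2 * Real.pi) = 0 := by simp [hf1]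
  rw [hsn, mul_zero, mul_zero, Real.sin_zero, mul_zero, sub_zero, zero_sub] at i1
  rw [e0, e1, zero_mul, zero_mul, sub_zero, zero_sub] at i2
  have key : (n : ℝ) ^ 2 * heatCoef t n
      = ∫ x in (0 : ℝ)..(2 * Real.pi), f₂ x * -Real.cos (n * x) := by
    have j1 : (n : ℝ) * heatCoef t n
        = ∫ x in (0 : ℝ)..(2 * Real.pi), f x * (Real.cos (n * x) * n) := by
      rw [heatCoef, ← intervalIntegral.integral_const_mul]
      congr 1; ext x; simp only [hf]; ring
    have j2 : (n : ℝ) * ∫ x in (0 : ℝ)..(2 * Real.pi), f₁ x * Real.sin (n * x)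
        = ∫ x in (0 : ℝ)..(2 * Real.pi), f₁ x * (Real.sin (n * x) * n) := by
      rw [← intervalIntegral.integral_const_mul]
      congr 1; ext x; ring
    rw [sq, mul_assoc, j1, i1, mul_neg, j2, i2, neg_neg]
  have hb := abs_integral_heat_mul_le (B := 3 * t) (s := t / 2)
    (g := fun x => f₂ x * -Real.cos (n * x)) fun x => by
      have g1 := mul_heat_le t x
      have hc0 : 0 ≤ 1 - Real.cos x := by linarith [Real.cos_le_one x]
      have g2 : f x ≤ Real.exp (-(t / 2) * (1 - Real.cos x)) := by
        refine Real.exp_le_exp.2 ?_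
        nlinarith
      have hfx : 0 < f x := Real.exp_pos _
      have g3 : Real.sin x ^ 2 ≤ 2 * (1 - Real.cos x) := by
        nlinarith [Real.sin_sq_add_cos_sq x, sq_nonneg (1 - Real.cos x)]
      have g4 : |f₂ x| ≤ t ^ 2 * Real.sin x ^ 2 * f x + t * f x := by
        rw [hf2, abs_mul, abs_of_pos hfx, ← add_mul]
        refine mul_le_mul_of_nonneg_right ?_ hfx.le
        refine (abs_sub _ _).trans ?_
        rw [abs_of_nonneg (by positivity), abs_mul, abs_of_pos ht]
        have := Real.abs_cos_le_one x
        nlinarith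
      rw [abs_mul, abs_neg]
      have g5 : |f₂ x| * |Real.cos (n * x)| ≤ |f₂ x| :=
        mul_le_of_le_one_right (abs_nonneg _) (Real.abs_cos_le_one _)
      have g6 : t ^ 2 * Real.sin x ^ 2 * f x ≤ 2 * t * (t * (1 - Real.cos x) * f x) := by
        calc _ ≤ t ^ 2 * (2 * (1 - Real.cos x)) * f x := by gcongr
          _ = _ := by ring
      have g7 := mul_le_mul_of_nonneg_left g1 (show 0 ≤ 2 * t by positivity)
      have g8 := mul_le_mul_of_nonneg_left g2 ht.le
      linarith
  rw [← key, abs_mul, abs_of_nonneg (sq_nonneg _)] at hb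
  refine hb.trans ((mul_le_mul_of_nonneg_left (heatCoef_half_le ht) (by positivity)).trans_eq ?_)
  calc 3 * t * (√2 * heatConst / √t) = 3 * (√2 * heatConst) * (t / √t) := by ring
    _ = _ := by rw [Real.div_sqrt]

lemma cosMoment_nonneg (j : ℕ) (n : ℤ) :
    0 ≤ ∫ x in (0 : ℝ)..(2 * Real.pi), Real.cos x ^ j * Real.cos (n * x) := by
  induction j generalizing n with
  | zero =>
    by_cases hn : n = 0
    · subst hn; simp; positivity
    · have hn' : (n : ℝ) ≠ 0 := by exact_mod_cast hn
      have : ∫ x in (0 : ℝ)..(2 * Real.pi), Real.cos (n * x) = 0 := by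
        rw [intervalIntegral.integral_comp_mul_left _ hn', integral_cos,
          show (n : ℝ) * (2 * Real.pi) = ((2 * n : ℤ) : ℝ) * Real.pi by push_cast; ring,
          Real.sin_int_mul_pi]
        simp
      simp [this]
  | succ j ih =>
    have h : ∀ x : ℝ, Real.cos x ^ (j + 1) * Real.cos (n * x)
        = (1 / 2) * (Real.cos x ^ j * Real.cos ((n + 1 : ℤ) * x))
          + (1 / 2) * (Real.cos x ^ j * Real.cos ((n - 1 : ℤ) * x)) := fun x => by
      push_cast
      rw [add_mul, sub_mul, one_mul, Real.cos_add, Real.cos_sub]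
      ring
    simp only [h]
    rw [intervalIntegral.integral_add (Continuous.intervalIntegrable (by fun_prop) _ _)
      (Continuous.intervalIntegrable (by fun_prop) _ _), intervalIntegral.integral_const_mul,
      intervalIntegral.integral_const_mul]
    have := ih (n + 1)
    have := ih (n - 1)
    positivity

/-- The heat kernel is nonnegative: `e^{t cos x}` is a power series in `cos x` with nonnegative
coefficients. -/
lemma heatCoef_nonneg {t : ℝ} (ht : 0 ≤ t) (n : ℤ) : 0 ≤ heatCoef t n := by
  have h := intervalIntegral.hasSum_integral_of_dominated_convergence
    (μ := volume) (a := 0) (b := 2 * Real.pi)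
    (F := fun (j : ℕ) x => t ^ j / j.factorial * (Real.cos x ^ j * Real.cos (n * x)))
    (f := fun x => Real.exp (t * Real.cos x) * Real.cos (n * x))
    (fun j _ => t ^ j / j.factorial)
    (fun j => Continuous.aestronglyMeasurable (by fun_prop))
    (fun j => Eventually.of_forall fun x _ => by
      rw [norm_mul, Real.norm_of_nonneg (by positivity)]
      refine mul_le_of_le_one_right (by positivity) ?_
      rw [Real.norm_eq_abs, abs_mul, abs_pow]
      exact mul_le_one₀ (pow_le_one₀ (abs_nonneg _) (Real.abs_cos_le_one _)) (abs_nonneg _)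
        (Real.abs_cos_le_one _))
    (Eventually.of_forall fun x _ => Real.summable_pow_div_factorial t)
    (by simp)
    (Eventually.of_forall fun x _ => by
      have h1 := (NormedSpace.expSeries_div_hasSum_exp (t * Real.cos x)).mul_right (Real.cos (n * x))
      rw [← Real.exp_eq_exp_ℝ] at h1
      refine h1.congr_fun fun j => ?_
      rw [mul_pow]; ring)
  have h2 := h.nonneg fun j => by
    rw [intervalIntegral.integral_const_mul]
    exact mul_nonneg (by positivity) (cosMoment_nonneg j n)
  have h3 : heatCoef t n = Real.exp (-t) *
      ∫ x in (0 : ℝ)..(2 * Real.pi), Real.exp (t * Real.cos x) * Real.cos (n * x) := by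
    rw [heatCoef, ← intervalIntegral.integral_const_mul]
    congr 1; ext x
    rw [← mul_assoc, ← Real.exp_add]
    congr 2; ring
  rw [h3]
  exact mul_nonneg (Real.exp_pos _).le h2

/-! ### Fourier coefficients of convolution kernels -/

/-- The unnormalized Fourier coefficient `∫_0^{2π} w(u) e^{-ilu} du` of a function, that is, the
multiplier of the convolution with `w`. -/
noncomputable def convCoef (w : ℝ → ℂ) (l : ℤ) : ℂ :=
  ∫ u in (0 : ℝ)..(2 * Real.pi), w u * (expTest l).1 u

lemma integral_reflect (f : ℝ → ℂ) :
    ∫ u in (0 : ℝ)..(2 * Real.pi), f (2 * Real.pi - u) = ∫ u in (0 : ℝ)..(2 * Real.pi), f u := by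
  rw [intervalIntegral.integral_comp_sub_left]
  simp

lemma expTest_reflect (l : ℤ) (u : ℝ) : (expTest (-l)).1 (2 * Real.pi - u) = (expTest l).1 u := by
  rw [(expTest (-l)).2.2.sub_eq']
  simp [expTest_apply]

lemma conj_convCoef {w : ℝ → ℂ} (hw : ∀ u, (starRingEnd ℂ) (w u) = w u) (l : ℤ) :
    (starRingEnd ℂ) (convCoef w l) = convCoef w (-l) := by
  rw [convCoef, convCoef, ← intervalIntegral_conj]
  simp only [map_mul, hw, conj_expTest]

lemma convCoef_neg {w : ℝ → ℂ} (hw : ∀ u, w (2 * Real.pi - u) = w u) (l : ℤ) :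
    convCoef w (-l) = convCoef w l := by
  rw [convCoef, ← integral_reflect]
  simp only [hw, expTest_reflect]
  rfl

lemma norm_convCoef_le (w : ℝ → ℂ) (l : ℤ) :
    ‖convCoef w l‖ ≤ ∫ u in (0 : ℝ)..(2 * Real.pi), ‖w u‖ := by
  refine (intervalIntegral.norm_integral_le_integral_norm Real.two_pi_pos.le).trans_eq ?_
  simp only [norm_mul, norm_expTest, mul_one]

/-- The Riemann–Lebesgue lemma on the circle. -/
lemma tendsto_convCoef (w : ℝ → ℂ) : Tendsto (convCoef w) cofinite (𝓝 0) := by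
  have h := Real.tendsto_integral_exp_smul_cocompact
    ((Set.Ioc 0 (2 * Real.pi)).indicator w)
  have hne : (2 * Real.pi)⁻¹ ≠ 0 := inv_ne_zero Real.two_pi_pos.ne'
  have h1 : Tendsto (fun l : ℤ => (l : ℝ) * (2 * Real.pi)⁻¹) cofinite (cocompact ℝ) :=
    (Homeomorph.mulRight₀ _ hne).isClosedEmbedding.tendsto_cocompact.comp
      Int.tendsto_coe_cofinite
  refine (h.comp h1).congr fun l => ?_
  rw [convCoef, intervalIntegral.integral_of_le Real.two_pi_pos.le, Function.comp_apply,
    ← integral_indicator measurableSet_Ioc]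
  congr 1
  ext u
  by_cases hu : u ∈ Set.Ioc 0 (2 * Real.pi)
  · rw [Set.indicator_of_mem hu, Set.indicator_of_mem hu, Circle.smul_def, smul_eq_mul, mul_comm,
      Real.fourierChar_apply, expTest_apply]
    congr 2
    have := two_pi_ne_zero_complex
    push_cast
    field_simp
  · rw [Set.indicator_of_notMem hu, Set.indicator_of_notMem hu, smul_zero]

lemma mu_reflect (ξ φ : ℝ) : mu ξ (2 * Real.pi - φ) = mu ξ φ := by
  simp [mu, Real.cos_two_pi_sub]

lemma tFun_reflect (ξ : ℝ) (k : ℤ) (u : ℝ) : tFun ξ k (2 * Real.pi - u) = tFun ξ k u := by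
  simp [tFun, Real.cos_two_pi_sub]

lemma tFun_conj (ξ : ℝ) (k : ℤ) (u : ℝ) : (starRingEnd ℂ) (tFun ξ k u) = tFun ξ k u := by
  have h : ∀ φ : ℝ, Complex.exp (-(Complex.I * k * (φ : ℂ))) = (expTest k).1 φ := fun _ => rfl
  unfold tFun
  simp only [h]
  rw [← intervalIntegral_conj, ← integral_reflect]
  simp only [map_div₀, map_mul, Complex.conj_ofReal, conj_expTest, expTest_reflect, mu_reflect,
    Real.cos_two_pi_sub]

lemma conj_convCoef_tFun (ξ : ℝ) (k l : ℤ) :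
    (starRingEnd ℂ) (convCoef (tFun ξ k) l) = convCoef (tFun ξ k) l := by
  rw [conj_convCoef (tFun_conj ξ k), convCoef_neg (tFun_reflect ξ k)]

/-! ### The multiplier of `S_k` -/

/-- `e^{-t(1 - cos u)}` is even, so that its complex Fourier coefficients are the cosine
integrals. -/
lemma convCoef_heat (t : ℝ) (n : ℤ) :
    convCoef (fun u => ((Real.exp (-t * (1 - Real.cos u)) : ℝ) : ℂ)) n = (heatCoef t n : ℂ) := by
  set w : ℝ → ℂ := fun u => ((Real.exp (-t * (1 - Real.cos u)) : ℝ) : ℂ) with hw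
  have hwc : Continuous w := Complex.continuous_ofReal.comp (continuous_heat t)
  have h1 : convCoef w (-n) = convCoef w n :=
    convCoef_neg (fun u => by simp only [hw, Real.cos_two_pi_sub]) n
  have h2 : (heatCoef t n : ℂ) = (1 / 2) * (convCoef w n + convCoef w (-n)) := by
    have hi : ∀ m : ℤ, IntervalIntegrable (fun u => w u * (expTest m).1 u) volume 0 (2 * Real.pi) :=
      fun m => (hwc.mul (contTestFun (expTest m))).intervalIntegrable _ _
    rw [convCoef, convCoef, ← intervalIntegral.integral_add (hi n) (hi (-n)), heatCoef,
      ← intervalIntegral.integral_const_mul, ← intervalIntegral.integral_ofReal]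
    congr 1
    ext u
    simp only [hw, expTest_apply]
    push_cast
    have hcos : Complex.cos ((n : ℂ) * u)
        = (Complex.exp (n * u * Complex.I) + Complex.exp (-(n * u) * Complex.I)) / 2 := rfl
    rw [hcos, show (n : ℂ) * u * Complex.I = -(Complex.I * -n * u) by ring,
      show -((n : ℂ) * u) * Complex.I = -(Complex.I * n * u) by ring]
    ring
  rw [h2, h1]; ring

/-- The square `(0, 2π)²` with Lebesgue measure. -/
noncomputable abbrev squareMeasure : Measure (ℝ × ℝ) :=
  (volume.restrict (Set.Ioo 0 (2 * Real.pi))).prod (volume.restrict (Set.Ioo 0 (2 * Real.pi)))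

lemma ae_squareMeasure : ∀ᵐ q ∂squareMeasure,
    q.1 ∈ Set.Ioo 0 (2 * Real.pi) ∧ q.2 ∈ Set.Ioo 0 (2 * Real.pi) := by
  rw [squareMeasure, Measure.prod_restrict]
  filter_upwards [ae_restrict_mem (measurableSet_Ioo.prod measurableSet_Ioo)] with q hq
  exact hq

lemma measurable_mu (ξ : ℝ) : Measurable (mu ξ) := by
  unfold mu; fun_prop

/-- The kernel `(μ(φ) - cos η)^{-1/2}` is integrable on the square: it is dominated by a product of
integrable functions of one variable. -/
lemma integrable_kernel_square (ξ : Set.Ioo (0 : ℝ) 1) :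
    Integrable (fun q : ℝ × ℝ => ((mu ξ q.2 - Real.cos q.1) ^ (1 / 2 : ℝ))⁻¹) squareMeasure := by
  have hs : Integrable (fun x : ℝ => Real.sin (x / 2) ^ (-(1 / 2) : ℝ))
      (volume.restrict (Set.Ioo 0 (2 * Real.pi))) :=
    (intervalIntegrable_iff_integrableOn_Ioo_of_le Real.two_pi_pos.le).1 intervalIntegrable_sin_half
  have h := (hs.mul_prod hs).const_mul ((4 * √(1 / (ξ : ℝ) ^ 2 - 1)) ^ (-(1 / 2) : ℝ))
  have hm := measurable_mu ξ
  refine h.mono' (Measurable.aestronglyMeasurable (by fun_prop)) ?_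
  filter_upwards [ae_squareMeasure] with q hq
  obtain ⟨h1, h2⟩ := kernel_bound ξ hq.1 hq.2
  rw [Real.norm_of_nonneg (by positivity), ← mul_assoc]
  exact h2

lemma integral_rpow_neg_half_mul_exp {D : ℝ} (hD : 0 < D) :
    ∫ t in Set.Ioi (0 : ℝ), t ^ (-(1 / 2) : ℝ) * Real.exp (-(D * t))
      = √Real.pi * (D ^ (1 / 2 : ℝ))⁻¹ := by
  have h := Real.integral_rpow_mul_exp_neg_mul_Ioi (a := 1 / 2) (by norm_num) hD
  rw [Real.Gamma_one_half_eq, Real.div_rpow zero_le_one hD.le, Real.one_rpow] at h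
  rw [show (1 / 2 - 1 : ℝ) = -(1 / 2) by norm_num] at h
  rw [h]; ring

lemma integrableOn_rpow_neg_half_mul_exp {D : ℝ} (hD : 0 < D) :
    IntegrableOn (fun t : ℝ => t ^ (-(1 / 2) : ℝ) * Real.exp (-(D * t))) (Set.Ioi 0) := by
  have h := integrableOn_rpow_mul_exp_neg_mul_rpow (s := -(1 / 2)) (p := 1) (b := D)
    (by norm_num) one_pos hD
  simpa only [Real.rpow_one, neg_mul] using h

/-- The multiplier of `S_k` as an integral of products of heat kernels: write
`D^{-1/2} = π^{-1/2} ∫_0^∞ t^{-1/2} e^{-tD} dt` and integrate over the torus first. -/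
lemma convCoef_sFun (ξ : Set.Ioo (0 : ℝ) 1) (k l : ℤ) :
    IntegrableOn (fun t : ℝ => t ^ (-(1 / 2) : ℝ) *
      (heatCoef t l * heatCoef ((1 / (ξ : ℝ) ^ 2 - 1) * t) k)) (Set.Ioi 0) ∧
    convCoef (sFun ξ k) l = (((√Real.pi)⁻¹ * ∫ t in Set.Ioi (0 : ℝ), t ^ (-(1 / 2) : ℝ) *
      (heatCoef t l * heatCoef ((1 / (ξ : ℝ) ^ 2 - 1) * t) k) : ℝ) : ℂ) := by
  set c : ℝ := 1 / (ξ : ℝ) ^ 2 - 1 with hc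
  set D : ℝ × ℝ → ℝ := fun q => mu ξ q.2 - Real.cos q.1 with hDdef
  have hm := measurable_mu ξ
  have hDm : Measurable D := by fun_prop
  have hem : ∀ n, Measurable (expTest n).1 := fun n => (contTestFun _).measurable
  let E : ℝ × ℝ → ℂ := fun q => (expTest l).1 q.1 * (expTest k).1 q.2
  have hEm : Measurable E := ((hem l).comp measurable_fst).mul ((hem k).comp measurable_snd)
  have hE : ∀ q, ‖E q‖ = 1 := fun q => by
    simp only [E, norm_mul, norm_expTest, mul_one]
  let G : ℝ × (ℝ × ℝ) → ℂ := fun p =>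
    ((p.1 ^ (-(1 / 2) : ℝ) * Real.exp (-(D p.2 * p.1)) : ℝ) : ℂ) * E p.2
  have hGm : Measurable G := by
    refine (Complex.measurable_ofReal.comp ?_).mul (hEm.comp measurable_snd)
    have : Measurable fun p : ℝ × (ℝ × ℝ) => D p.2 := hDm.comp measurable_snd
    fun_prop
  have hpos : ∀ᵐ q ∂squareMeasure, 0 < D q := by
    filter_upwards [ae_squareMeasure] with q hq
    exact (kernel_bound ξ hq.1 hq.2).1
  have hnorm : ∀ q, 0 < D q → ∫ t in Set.Ioi (0 : ℝ), ‖G (t, q)‖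
      = √Real.pi * (D q ^ (1 / 2 : ℝ))⁻¹ := fun q hq => by
    rw [← integral_rpow_neg_half_mul_exp hq]
    refine setIntegral_congr_fun measurableSet_Ioi fun t ht => ?_
    have ht0 : (0 : ℝ) ≤ t := le_of_lt ht
    simp only [G]
    rw [norm_mul, hE, mul_one, Complex.norm_real, Real.norm_of_nonneg (by positivity)]
  have hGi : Integrable G ((volume.restrict (Set.Ioi 0)).prod squareMeasure) := by
    rw [integrable_prod_iff' hGm.aestronglyMeasurable]
    constructor
    · filter_upwards [hpos] with q hq
      exact (integrableOn_rpow_neg_half_mul_exp hq).ofReal.mul_const (E q)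
    · refine ((integrable_kernel_square ξ).const_mul (√Real.pi)).congr ?_
      filter_upwards [hpos] with q hq
      exact (hnorm q hq).symm
  have hGt : ∀ q, 0 < D q → ∫ t in Set.Ioi (0 : ℝ), G (t, q)
      = (√Real.pi : ℂ) * (((D q ^ (1 / 2 : ℝ))⁻¹ : ℝ) : ℂ) * E q := fun q hq => by
    simp only [G]
    rw [integral_mul_const, integral_complex_ofReal, integral_rpow_neg_half_mul_exp hq]
    push_cast; ring
  have hGq : ∀ t, ∫ q, G (t, q) ∂squareMeasure
      = ((t ^ (-(1 / 2) : ℝ) * (heatCoef t l * heatCoef (c * t) k) : ℝ) : ℂ) := fun t => by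
    have h1 : ∀ q : ℝ × ℝ, G (t, q) = ((t ^ (-(1 / 2) : ℝ) : ℝ) : ℂ) *
        ((((Real.exp (-t * (1 - Real.cos q.1)) : ℝ) : ℂ) * (expTest l).1 q.1) *
        (((Real.exp (-(c * t) * (1 - Real.cos q.2)) : ℝ) : ℂ) * (expTest k).1 q.2)) := fun q => by
      simp only [G, E, hDdef]
      rw [mu_sub_cos, ← hc, show -((c * (1 - Real.cos q.2) + (1 - Real.cos q.1)) * t)
        = -t * (1 - Real.cos q.1) + -(c * t) * (1 - Real.cos q.2) by ring, Real.exp_add]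
      push_cast
      ring
    simp only [h1]
    rw [integral_const_mul, integral_prod_mul
      (fun u => ((Real.exp (-t * (1 - Real.cos u)) : ℝ) : ℂ) * (expTest l).1 u)
      (fun φ => ((Real.exp (-(c * t) * (1 - Real.cos φ)) : ℝ) : ℂ) * (expTest k).1 φ),
      ← integral_Ioc_eq_integral_Ioo, ← integral_Ioc_eq_integral_Ioo,
      ← intervalIntegral.integral_of_le Real.two_pi_pos.le,
      ← intervalIntegral.integral_of_le Real.two_pi_pos.le]
    have e1 := convCoef_heat t l
    have e2 := convCoef_heat (c * t) k
    rw [convCoef] at e1 e2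
    rw [e1, e2]
    push_cast; rfl
  have hint : IntegrableOn (fun t : ℝ => t ^ (-(1 / 2) : ℝ) *
      (heatCoef t l * heatCoef (c * t) k)) (Set.Ioi 0) := by
    have h := hGi.integral_prod_left.re
    simp only [hGq] at h
    exact h
  refine ⟨hint, ?_⟩
  have hH : Integrable (fun q : ℝ × ℝ => (((D q ^ (1 / 2 : ℝ))⁻¹ : ℝ) : ℂ) * E q) squareMeasure := by
    refine (integrable_kernel_square ξ).norm.mono' ?_ (Eventually.of_forall fun q => ?_)
    · refine Measurable.aestronglyMeasurable ((Complex.measurable_ofReal.comp ?_).mul hEm)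
      fun_prop
    · rw [norm_mul, hE, mul_one, Complex.norm_real]
  have hsw := integral_integral_swap (f := fun t q => G (t, q)) hGi
  simp only [hGq] at hsw
  rw [integral_complex_ofReal] at hsw
  have hsw2 : ∫ q, (∫ t in Set.Ioi (0 : ℝ), G (t, q)) ∂squareMeasure
      = (√Real.pi : ℂ) * ∫ q, (((D q ^ (1 / 2 : ℝ))⁻¹ : ℝ) : ℂ) * E q ∂squareMeasure := by
    rw [← integral_const_mul]
    refine integral_congr_ae ?_
    filter_upwards [hpos] with q hq
    rw [hGt q hq, mul_assoc]
  have hlhs : convCoef (sFun ξ k) l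
      = ∫ q, (((D q ^ (1 / 2 : ℝ))⁻¹ : ℝ) : ℂ) * E q ∂squareMeasure := by
    rw [integral_prod _ hH, convCoef, intervalIntegral.integral_of_le Real.two_pi_pos.le,
      integral_Ioc_eq_integral_Ioo]
    refine setIntegral_congr_fun measurableSet_Ioo fun u _ => ?_
    simp only [sFun]
    rw [intervalIntegral.integral_of_le Real.two_pi_pos.le, integral_Ioc_eq_integral_Ioo,
      ← integral_mul_const]
    refine setIntegral_congr_fun measurableSet_Ioo fun φ _ => ?_
    simp only [E, hDdef, ← expTest_apply]
    push_cast
    ring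
  have hπ : (√Real.pi : ℂ) ≠ 0 := Complex.ofReal_ne_zero.2 (Real.sqrt_pos.2 Real.pi_pos).ne'
  rw [hsw2, ← hlhs] at hsw
  push_cast
  rw [eq_inv_mul_iff_mul_eq₀ hπ, ← hsw]

/-- The symbol `∫_0^{2π} s_k(η) e^{-ilη} dη` of `S_k`, defined through its heat kernel
representation, which shows that it is real and nonnegative; see `convCoef_sFun_eq`. -/
noncomputable def symbS (ξ : Set.Ioo (0 : ℝ) 1) (k l : ℤ) : ℝ :=
  (√Real.pi)⁻¹ * ∫ t in Set.Ioi (0 : ℝ), t ^ (-(1 / 2) : ℝ) *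
    (heatCoef t l * heatCoef ((1 / (ξ : ℝ) ^ 2 - 1) * t) k)

lemma convCoef_sFun_eq (ξ : Set.Ioo (0 : ℝ) 1) (k l : ℤ) :
    convCoef (sFun ξ k) l = (symbS ξ k l : ℂ) := (convCoef_sFun ξ k l).2

lemma rpow_neg_half_eq {t : ℝ} (ht : 0 < t) : t ^ (-(1 / 2) : ℝ) = 1 / √t := by
  rw [Real.rpow_neg ht.le, Real.sqrt_eq_rpow, one_div (t ^ (1 / 2 : ℝ))]

lemma inv_mul_sqrt_eq {t : ℝ} (ht : 0 < t) : 1 / (t * √t) = t ^ (-(3 / 2) : ℝ) := by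
  rw [Real.sqrt_eq_rpow, Real.rpow_neg ht.le, one_div]
  congr 1
  rw [show (3 / 2 : ℝ) = 1 + 1 / 2 by norm_num, Real.rpow_add ht, Real.rpow_one]

/-- Lower bound of the symbol: only the times `t ≥ d (1 + l²)`, at which both heat kernels are
comparable to `t^{-1/2}`, are kept. -/
lemma exists_le_symbS (ξ : Set.Ioo (0 : ℝ) 1) (k : ℤ) :
    ∃ a : ℝ, 0 < a ∧ ∀ l : ℤ, a * (1 + (l : ℝ) ^ 2) ^ (-1 / 2 : ℝ) ≤ symbS ξ k l := by
  obtain ⟨K, c₀, hK, hc₀, hlow⟩ := exists_le_heatCoef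
  have hc := coef_pos ξ
  set c : ℝ := 1 / (ξ : ℝ) ^ 2 - 1 with hcdef
  -- For `t ≥ d (1 + l²)` both `t ≥ K (1 + l²)` and `c t ≥ K (1 + k²)` hold.
  set d : ℝ := K * (1 + (1 + (k : ℝ) ^ 2) / c) with hd
  have hd0 : 0 < d := by positivity
  have hπ := Real.sqrt_pos.2 Real.pi_pos
  refine ⟨(√Real.pi)⁻¹ * (c₀ ^ 2 / √c * 2 * d ^ (-(1 / 2) : ℝ)), by positivity, fun l => ?_⟩
  have hl : (0 : ℝ) < 1 + (l : ℝ) ^ 2 := by positivity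
  have hint := (convCoef_sFun ξ k l).1
  rw [← hcdef] at hint
  have hpos : ∀ t ∈ Set.Ioi (0 : ℝ), 0 ≤ t ^ (-(1 / 2) : ℝ) * (heatCoef t l * heatCoef (c * t) k) :=
    fun t ht => by
      have ht0 : (0 : ℝ) < t := ht
      exact mul_nonneg (Real.rpow_nonneg ht0.le _) (mul_nonneg (heatCoef_nonneg ht0.le _)
        (heatCoef_nonneg (by positivity) _))
  have hT : 0 < d * (1 + (l : ℝ) ^ 2) := by positivity
  have h1 : ∫ t in Set.Ioi (d * (1 + (l : ℝ) ^ 2)), c₀ ^ 2 / √c * t ^ (-(3 / 2) : ℝ)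
      ≤ ∫ t in Set.Ioi (0 : ℝ), t ^ (-(1 / 2) : ℝ) * (heatCoef t l * heatCoef (c * t) k) := by
    have hsub : Set.Ioi (d * (1 + (l : ℝ) ^ 2)) ⊆ Set.Ioi 0 := Set.Ioi_subset_Ioi hT.le
    refine le_trans (setIntegral_mono_on
      ((integrableOn_Ioi_rpow_of_lt (by norm_num) hT).const_mul _) (hint.mono_set hsub)
      measurableSet_Ioi fun t ht => ?_) (setIntegral_mono_set hint
        ((ae_restrict_iff' measurableSet_Ioi).2 (Eventually.of_forall hpos))
        hsub.eventuallyLE)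
    have ht0 : 0 < t := hsub ht
    have htT : d * (1 + (l : ℝ) ^ 2) < t := ht
    have hq : 0 ≤ (1 + (k : ℝ) ^ 2) / c := by positivity
    have e1 : K * (1 + (l : ℝ) ^ 2) ≤ t := by
      refine le_trans ?_ htT.le
      rw [hd]
      refine mul_le_mul_of_nonneg_right ?_ hl.le
      nlinarith
    have e2 : K * (1 + (k : ℝ) ^ 2) ≤ c * t := by
      have : d ≤ t := le_trans (by nlinarith [sq_nonneg (l : ℝ)]) htT.le
      calc K * (1 + (k : ℝ) ^ 2) = c * (K * ((1 + (k : ℝ) ^ 2) / c)) := by field_simp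
        _ ≤ c * d := by
          rw [hd]
          gcongr
          linarith
        _ ≤ c * t := by gcongr
    have f1 := hlow l t e1
    have f2 := hlow k (c * t) e2
    rw [Real.sqrt_mul hc.le] at f2
    have hst := Real.sqrt_pos.2 ht0
    have hsc := Real.sqrt_pos.2 hc
    rw [← inv_mul_sqrt_eq ht0, rpow_neg_half_eq ht0]
    calc c₀ ^ 2 / √c * (1 / (t * √t)) = 1 / √t * (c₀ / √t * (c₀ / (√c * √t))) := by
          have h3 := Real.mul_self_sqrt ht0.le
          nth_rewrite 1 [← h3]
          field_simp
      _ ≤ _ := by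
          gcongr
          exact heatCoef_nonneg ht0.le _
  rw [integral_const_mul, integral_Ioi_rpow_of_lt (by norm_num) hT] at h1
  rw [symbS, mul_assoc]
  refine mul_le_mul_of_nonneg_left (le_trans (le_of_eq ?_) h1) (by positivity)
  rw [Real.mul_rpow hd0.le hl.le]
  norm_num
  ring

/-- Upper bound of the symbol: the integral over `t` is split at `t = l²`, with the off-diagonal
bound of the heat kernel before and the diagonal bound after. -/
lemma exists_symbS_le (ξ : Set.Ioo (0 : ℝ) 1) (k : ℤ) :
    ∃ b : ℝ, 0 < b ∧ ∀ l : ℤ, symbS ξ k l ≤ b * (1 + (l : ℝ) ^ 2) ^ (-1 / 2 : ℝ) := by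
  have hc := coef_pos ξ
  set c : ℝ := 1 / (ξ : ℝ) ^ 2 - 1 with hcdef
  have hh := heatConst_pos
  set A : ℝ := heatConst / √c with hA
  have hA0 : 0 < A := by positivity
  set B : ℝ := 3 * (√2 * heatConst) with hB
  have hB0 : 0 < B := by positivity
  have hπ := Real.sqrt_pos.2 Real.pi_pos
  have hmain : ∀ l : ℤ, l ≠ 0 →
      symbS ξ k l ≤ (√Real.pi)⁻¹ * (2 * A * (B + heatConst)) / |(l : ℝ)| := fun l hl => by
    have hl1 : 0 < |(l : ℝ)| := abs_pos.2 (by exact_mod_cast hl)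
    set N : ℝ := (l : ℝ) ^ 2 with hN
    have hN0 : 0 < N := by rw [hN, ← sq_abs]; positivity
    have hint := (convCoef_sFun ξ k l).1
    rw [← hcdef] at hint
    have hk : ∀ t : ℝ, 0 < t → heatCoef (c * t) k ≤ A / √t := fun t ht => by
      refine (le_abs_self _).trans ((abs_heatCoef_le _ _).trans
        ((heatCoef_zero_le (by positivity)).trans_eq ?_))
      rw [Real.sqrt_mul hc.le, hA, div_div]
    have hfac : ∀ t : ℝ, 0 < t → ∀ x : ℝ, heatCoef t l ≤ x →
        t ^ (-(1 / 2) : ℝ) * (heatCoef t l * heatCoef (c * t) k) ≤ A / t * x := fun t ht x hx => by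
      rw [rpow_neg_half_eq ht]
      have h0 := heatCoef_nonneg ht.le l
      have hst := Real.sqrt_pos.2 ht
      calc 1 / √t * (heatCoef t l * heatCoef (c * t) k) ≤ 1 / √t * (x * (A / √t)) := by
            exact mul_le_mul_of_nonneg_left (mul_le_mul hx (hk t ht)
              (heatCoef_nonneg (by positivity) _) (h0.trans hx)) (by positivity)
        _ = A / (√t * √t) * x := by field_simp
        _ = A / t * x := by rw [Real.mul_self_sqrt ht.le]
    have hle1 : ∀ t ∈ Set.Ioc (0 : ℝ) N, t ^ (-(1 / 2) : ℝ) * (heatCoef t l * heatCoef (c * t) k)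
        ≤ A * B / N * t ^ (-(1 / 2) : ℝ) := fun t ht => by
      have ht0 : (0 : ℝ) < t := ht.1
      have hst := Real.sqrt_pos.2 ht0
      refine (hfac t ht0 (B * √t / N) ?_).trans_eq ?_
      · rw [le_div_iff₀ hN0, mul_comm]
        exact (mul_le_mul_of_nonneg_left (le_abs_self _) hN0.le).trans (sq_mul_abs_heatCoef_le ht0 l)
      · rw [rpow_neg_half_eq ht0]
        have h3 := Real.mul_self_sqrt ht0.le
        nth_rewrite 1 [← h3]
        field_simp
    have hle2 : ∀ t ∈ Set.Ioi N, t ^ (-(1 / 2) : ℝ) * (heatCoef t l * heatCoef (c * t) k)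
        ≤ A * heatConst * t ^ (-(3 / 2) : ℝ) := fun t ht => by
      have ht0 : (0 : ℝ) < t := hN0.trans ht
      refine (hfac t ht0 (heatConst / √t) ?_).trans_eq ?_
      · exact (le_abs_self _).trans ((abs_heatCoef_le _ _).trans (heatCoef_zero_le ht0))
      · rw [← inv_mul_sqrt_eq ht0]
        field_simp
    have hsplit := setIntegral_union (Set.Ioc_disjoint_Ioi (a := 0) (le_refl N)) measurableSet_Ioi
      (hint.mono_set Set.Ioc_subset_Ioi_self)
      (hint.mono_set (Set.Ioi_subset_Ioi hN0.le))
    rw [Set.Ioc_union_Ioi_eq_Ioi hN0.le] at hsplit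
    have hi1 : IntervalIntegrable (fun t : ℝ => A * B / N * t ^ (-(1 / 2) : ℝ)) volume 0 N :=
      (intervalIntegral.intervalIntegrable_rpow' (by norm_num)).const_mul _
    have hsqN : √N = |(l : ℝ)| := Real.sqrt_sq_eq_abs _
    have hb1 : ∫ t in Set.Ioc 0 N, t ^ (-(1 / 2) : ℝ) * (heatCoef t l * heatCoef (c * t) k)
        ≤ 2 * A * B / |(l : ℝ)| := by
      refine (setIntegral_mono_on (hint.mono_set Set.Ioc_subset_Ioi_self)
        ((intervalIntegrable_iff_integrableOn_Ioc_of_le hN0.le).1 hi1) measurableSet_Ioc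
        hle1).trans_eq ?_
      rw [← intervalIntegral.integral_of_le hN0.le, intervalIntegral.integral_const_mul,
        integral_rpow (Or.inl (by norm_num)), Real.zero_rpow (by norm_num), sub_zero,
        show (-(1 / 2) + 1 : ℝ) = 1 / 2 by norm_num, ← Real.sqrt_eq_rpow, hsqN, hN, ← sq_abs]
      field_simp
    have hb2 : ∫ t in Set.Ioi N, t ^ (-(1 / 2) : ℝ) * (heatCoef t l * heatCoef (c * t) k)
        ≤ 2 * A * heatConst / |(l : ℝ)| := by
      refine (setIntegral_mono_on (hint.mono_set (Set.Ioi_subset_Ioi hN0.le))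
        ((integrableOn_Ioi_rpow_of_lt (by norm_num) hN0).const_mul _) measurableSet_Ioi
        hle2).trans_eq ?_
      rw [integral_const_mul, integral_Ioi_rpow_of_lt (by norm_num) hN0,
        show (-(3 / 2) + 1 : ℝ) = -(1 / 2) by norm_num, rpow_neg_half_eq hN0, hsqN]
      field_simp
    rw [symbS, ← hcdef, hsplit, mul_div_assoc]
    refine mul_le_mul_of_nonneg_left ?_ (by positivity)
    calc _ ≤ 2 * A * B / |(l : ℝ)| + 2 * A * heatConst / |(l : ℝ)| := add_le_add hb1 hb2
      _ = _ := by ring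
  set M : ℝ := (√Real.pi)⁻¹ * (2 * A * (B + heatConst)) with hM
  have hM0 : 0 < M := by positivity
  refine ⟨√2 * M + |symbS ξ k 0|, by positivity, fun l => ?_⟩
  -- The splitting at `t = l²` needs `l ≠ 0`; the value at `l = 0` only enters the constant.
  by_cases hl : l = 0
  · subst hl
    have : 0 ≤ √2 * M := by positivity
    simp only [Int.cast_zero, ne_eq, OfNat.ofNat_ne_zero, not_false_eq_true, zero_pow, add_zero,
      Real.one_rpow, mul_one]
    linarith [le_abs_self (symbS ξ k 0)]
  · have hl1 : 1 ≤ |(l : ℝ)| := by exact_mod_cast Int.one_le_abs hl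
    have hlp : (0 : ℝ) < 1 + (l : ℝ) ^ 2 := by positivity
    refine (hmain l hl).trans ?_
    have e : (1 + (l : ℝ) ^ 2) ^ (-1 / 2 : ℝ) = 1 / √(1 + (l : ℝ) ^ 2) := by
      rw [neg_div]; exact rpow_neg_half_eq hlp
    rw [e, mul_one_div, div_le_div_iff₀ (by linarith) (Real.sqrt_pos.2 hlp)]
    have h2 : √(1 + (l : ℝ) ^ 2) ≤ √2 * |(l : ℝ)| := by
      rw [← Real.sqrt_sq_eq_abs, ← Real.sqrt_mul zero_le_two]
      refine Real.sqrt_le_sqrt ?_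
      rw [← sq_abs]
      nlinarith
    calc M * √(1 + (l : ℝ) ^ 2) ≤ M * (√2 * |(l : ℝ)|) := by gcongr
      _ = √2 * M * |(l : ℝ)| := by ring
      _ ≤ _ := by
        gcongr
        linarith [abs_nonneg (symbS ξ k 0)]

/-! ### Convolution operators on distributions -/

lemma regularKernel_shift {w : ℝ → ℂ} (hp : Function.Periodic w (2 * Real.pi))
    (hw : IntervalIntegrable w volume 0 (2 * Real.pi)) : RegularKernel (fun η x => w (η - x)) := by
  refine (regularKernel_conv hp hw (expTest 0)).congr fun x => Eventually.of_forall fun η => ?_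
  simp [expTest_apply]

/-- The convolution `g ↦ ∫_0^{2π} w(· - η') g(η') dη'` with an integrable periodic function, on
distributions. -/
noncomputable def convDist {w : ℝ → ℂ} (hp : Function.Periodic w (2 * Real.pi))
    (hw : IntervalIntegrable w volume 0 (2 * Real.pi)) : PerDist →ₗ[ℂ] PerDist :=
  kernelOp (fun η x => w (η - x)) (regularKernel_shift hp hw)

lemma opS_eq (ξ : Set.Ioo (0 : ℝ) 1) (k : ℤ) :
    opS ξ k = convDist (sFun_periodic ξ k) (sFun_integrable ξ k) := rfl

/-- Convolution operators act on Fourier coefficients by multiplication. -/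
lemma fourierCoef_convDist {w : ℝ → ℂ} (hp : Function.Periodic w (2 * Real.pi))
    (hw : IntervalIntegrable w volume 0 (2 * Real.pi)) (l : ℤ) (u : PerDist) :
    fourierCoef l (convDist hp hw u) = convCoef w l * fourierCoef l u := by
  have h : kernelTest (fun η x => w (η - x)) (regularKernel_shift hp hw) (expTest l)
      = convCoef w l • expTest l := by
    ext x
    change ∫ η in (0 : ℝ)..(2 * Real.pi), w (η - x) * (expTest l).1 η
      = convCoef w l * (expTest l).1 x
    have h1 : ∀ η : ℝ, (expTest l).1 η = (expTest l).1 (η - x) * (expTest l).1 x := fun η => by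
      simp only [expTest_apply, ← Complex.exp_add]
      congr 1; push_cast; ring
    have h2 : ∀ η : ℝ, w (η - x) * (expTest l).1 η
        = (fun u => w u * (expTest l).1 u) (η - x) * (expTest l).1 x := fun η => by
      rw [h1 η, mul_assoc]
    simp only [h2]
    rw [intervalIntegral.integral_mul_const, intervalIntegral.integral_comp_sub_right
      (fun u => w u * (expTest l).1 u) x]
    have hper : Function.Periodic (fun u => w u * (expTest l).1 u) (2 * Real.pi) :=
      hp.mul (expTest l).2.2
    have h3 := hper.intervalIntegral_add_eq (0 - x) 0
    rw [show 0 - x + 2 * Real.pi = 2 * Real.pi - x by ring, zero_add] at h3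
    rw [h3]
    rfl
  rw [fourierCoef_apply, fourierCoef_apply]
  change _ * u.1 (kernelTest _ _ (expTest l)) = _
  rw [h, map_smul, smul_eq_mul]
  ring

/-- The decomposition `A_k = ψ⁻¹ S_k - ξ⁻² T_k`, where `T_k` is another convolution. -/
lemma opA_eq (ξ : Set.Ioo (0 : ℝ) 1) (k : ℤ) (g : PerDist) :
    opA ξ k g = mulDist (psiPow ξ (-1)) (opS ξ k g) -
      ((1 / (ξ : ℝ) ^ 2 : ℝ) : ℂ) • convDist (tFun_periodic ξ k) (tFun_integrable ξ k) g := by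
  have hs := sKernel_regular ξ k
  have ht := regularKernel_shift (tFun_periodic ξ k) (tFun_integrable ξ k)
  have h : ∀ φ, kernelTest (aKernel ξ k) (aKernel_regular ξ k) φ
      = kernelTest _ hs (mulTest (psiPow ξ (-1)) φ)
        - ((1 / (ξ : ℝ) ^ 2 : ℝ) : ℂ) • kernelTest _ ht φ := fun φ => by
    ext x
    change ∫ η in (0 : ℝ)..(2 * Real.pi), aKernel ξ k η x * φ.1 η
      = (∫ η in (0 : ℝ)..(2 * Real.pi), sFun ξ k (η - x) * (mulTest (psiPow ξ (-1)) φ).1 η)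
        - ((1 / (ξ : ℝ) ^ 2 : ℝ) : ℂ) *
          ∫ η in (0 : ℝ)..(2 * Real.pi), tFun ξ k (η - x) * φ.1 η
    rw [← intervalIntegral.integral_const_mul, ← intervalIntegral.integral_sub
      (hs.integrable x _) ((ht.integrable x φ).const_mul _)]
    refine intervalIntegral.integral_congr_ae ?_
    filter_upwards [ae_cos_ne_one x] with η hη _
    rw [aKernel_eq ξ k hη]
    change _ = sFun ξ k (η - x) * (((psi ξ η ^ (-1 : ℝ) : ℝ) : ℂ) * φ.1 η) - _
    ring
  ext φ
  change g.1 (kernelTest (aKernel ξ k) (aKernel_regular ξ k) φ) = g.1 _ - _ * g.1 _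
  rw [h, map_sub, map_smul, smul_eq_mul]

/-! ### Integral operators on smooth functions -/

/-- The integrand of a convolution with an integrable periodic function is integrable on the
square, so that Fubini's theorem applies. -/
lemma integrable_shift_square {w : ℝ → ℂ} (hp : Function.Periodic w (2 * Real.pi))
    (hw : IntervalIntegrable w volume 0 (2 * Real.pi)) (m n : TestFun) :
    Integrable (fun q : ℝ × ℝ => w (q.1 - q.2) * (m.1 q.1 * n.1 q.2)) squareMeasure := by
  set I : Set ℝ := Set.Ioo 0 (2 * Real.pi)
  -- On the square `η - η'` stays in `J`, so `w` may be cut off outside `J`.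
  set J : Set ℝ := Set.Ioc (-(2 * Real.pi)) (2 * Real.pi)
  have hn : Integrable (I.indicator n.1) := by
    rw [integrable_indicator_iff measurableSet_Ioo]
    exact ((contTestFun n).integrableOn_Icc (a := 0) (b := 2 * Real.pi)).mono_set
      Set.Ioo_subset_Icc_self
  have hwJ : Integrable (J.indicator w) := by
    rw [integrable_indicator_iff measurableSet_Ioc]
    have h0 : IntervalIntegrable w volume (-(2 * Real.pi)) (2 * Real.pi) :=
      hp.intervalIntegrable₀ Real.two_pi_pos.ne' hw _ _
    exact (intervalIntegrable_iff_integrableOn_Ioc_of_le (by linarith [Real.pi_pos])).1 h0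
  have h1 := (hn.convolution_integrand (ContinuousLinearMap.mul ℂ ℂ) hwJ).restrict
    (s := I ×ˢ I)
  rw [← Measure.prod_restrict] at h1
  obtain ⟨M, hM⟩ := exists_bound_of_periodic (contTestFun m) m.2.2
  have h2 := h1.bdd_mul (f := fun q : ℝ × ℝ => m.1 q.1) (c := M)
    ((contTestFun m).comp continuous_fst).aestronglyMeasurable
    (Eventually.of_forall fun q => hM _)
  refine h2.congr ?_
  filter_upwards [ae_squareMeasure] with q hq
  have hq1 : q.1 - q.2 ∈ J := ⟨by linarith [hq.1.1, hq.2.2], by linarith [hq.1.2, hq.2.1]⟩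
  rw [Set.indicator_of_mem hq.2, Set.indicator_of_mem hq1, ContinuousLinearMap.mul_apply']
  ring

/-- On smooth functions, the operator defined by transposition is the integral operator. -/
lemma kernelOp_ofTest {K : ℝ → ℝ → ℂ} (hK : RegularKernel K) (g φ : TestFun)
    (h : Integrable (fun q : ℝ × ℝ => K q.1 q.2 * (φ.1 q.1 * g.1 q.2)) squareMeasure) :
    (kernelOp K hK (ofTest g)).1 φ = ∫ η in (0 : ℝ)..(2 * Real.pi),
      (∫ η' in (0 : ℝ)..(2 * Real.pi), K η η' * g.1 η') * φ.1 η := by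
  have hsw := integral_integral_swap (f := fun η η' => K η η' * (φ.1 η * g.1 η')) h
  change ∫ x in (0 : ℝ)..(2 * Real.pi),
    g.1 x * ∫ η in (0 : ℝ)..(2 * Real.pi), K η x * φ.1 η = _
  simp only [intervalIntegral.integral_of_le Real.two_pi_pos.le, integral_Ioc_eq_integral_Ioo,
    ← integral_const_mul, ← integral_mul_const]
  simp only [show ∀ x η, g.1 x * (K η x * φ.1 η) = K η x * (φ.1 η * g.1 x) from
      fun _ _ => by ring,
    show ∀ η η', K η η' * g.1 η' * φ.1 η = K η η' * (φ.1 η * g.1 η') from fun _ _ => by ring]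
  exact hsw.symm

lemma opA_ofTest (ξ : Set.Ioo (0 : ℝ) 1) (k : ℤ) (g φ : TestFun) :
    (opA ξ k (ofTest g)).1 φ = ∫ η in (0 : ℝ)..(2 * Real.pi),
      (∫ η' in (0 : ℝ)..(2 * Real.pi), aKernel ξ k η η' * g.1 η') * φ.1 η := by
  refine kernelOp_ofTest (aKernel_regular ξ k) g φ ?_
  have h1 := integrable_shift_square (sFun_periodic ξ k) (sFun_integrable ξ k)
    (mulTest (psiPow ξ (-1)) φ) g
  have h2 := (integrable_shift_square (tFun_periodic ξ k) (tFun_integrable ξ k) φ g).const_mul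
    ((1 / (ξ : ℝ) ^ 2 : ℝ) : ℂ)
  have hne : ∀ᵐ q ∂squareMeasure, Real.cos (q.1 - q.2) ≠ 1 := by
    have hmeas : MeasurableSet {q : ℝ × ℝ | Real.cos (q.1 - q.2) ≠ 1} :=
      (isOpen_ne.preimage (by fun_prop : Continuous fun q : ℝ × ℝ =>
        Real.cos (q.1 - q.2))).measurableSet
    rw [Measure.ae_prod_iff_ae_ae hmeas]
    refine Eventually.of_forall fun x => ae_restrict_of_ae ?_
    filter_upwards [ae_cos_ne_one x] with η hη
    rwa [← Real.cos_neg, neg_sub]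
  refine (h1.sub h2).congr ?_
  filter_upwards [hne] with q hq
  rw [aKernel_eq ξ k hq]
  change sFun ξ k (q.1 - q.2) * ((((psi ξ q.1 ^ (-1 : ℝ) : ℝ) : ℂ) * φ.1 q.1) * g.1 q.2)
    - _ * (tFun ξ k (q.1 - q.2) * (φ.1 q.1 * g.1 q.2)) = _
  ring

lemma sFun_neg (ξ : ℝ) (k : ℤ) (u : ℝ) : sFun ξ k (-u) = sFun ξ k u := by
  simp [sFun]

/-- The complex conjugate of a test function. -/
noncomputable def conjTest (φ : TestFun) : TestFun :=
  ⟨fun x => (starRingEnd ℂ) (φ.1 x), Complex.conjCLE.contDiff.comp φ.2.1,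
    fun x => congrArg _ (φ.2.2 x)⟩

lemma testCoef_conjTest (l : ℤ) (φ : TestFun) :
    testCoef (-l) (conjTest φ) = (starRingEnd ℂ) (testCoef l φ) := by
  rw [testCoef_apply, testCoef_apply, map_mul, ← intervalIntegral_conj]
  congr 1
  · simp [Complex.conj_ofNat]
  · refine intervalIntegral.integral_congr fun x _ => ?_
    change (starRingEnd ℂ) (φ.1 x) * (expTest (-l)).1 x
      = (starRingEnd ℂ) (φ.1 x * (expTest l).1 x)
    rw [map_mul, conj_expTest]

/-- Parseval's identity: for smooth functions the duality pairing is the integral. -/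
lemma pairing_ofTest (u : PerDist) (h : TestFun) :
    pairing u (ofTest h) = u.1 (conjTest h) := by
  rw [← (hasSum_dist_apply u (conjTest h)).tsum_eq, pairing]
  congr 1
  ext l
  rw [pairingTerm, testCoef_conjTest, fourierCoef_ofTest]
  ring

lemma ofTest_mem_HT (ξ : Set.Ioo (0 : ℝ) 1) (g : TestFun) : ofTest g ∈ HT ξ := by
  rw [mem_HT_iff, mem_sobolev_iff]
  obtain ⟨M, hM⟩ := exists_bound_of_periodic (contTestFun g) g.2.2
  refine Summable.of_nonneg_of_le (fun l => by positivity) (fun l => ?_)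
    ((summable_norm_testCoef g).mul_left M)
  have h1 : (1 + (l : ℝ) ^ 2) ^ (-1 / 2 : ℝ) ≤ 1 :=
    Real.rpow_le_one_of_one_le_of_nonpos (by nlinarith [sq_nonneg (l : ℝ)]) (by norm_num)
  rw [fourierCoef_ofTest]
  have h2 := norm_testCoef_le hM l
  calc _ ≤ 1 * ‖testCoef l g‖ ^ 2 := by gcongr
    _ = ‖testCoef l g‖ * ‖testCoef l g‖ := by ring
    _ ≤ _ := by gcongr

lemma formK_ofTest (ξ : Set.Ioo (0 : ℝ) 1) (k : ℤ) (g₁ g₂ : TestFun) :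
    formK ξ k (ofTest g₁) (ofTest g₂) = ∫ η in (0 : ℝ)..(2 * Real.pi), g₁.1 η *
      (starRingEnd ℂ) (∫ η' in (0 : ℝ)..(2 * Real.pi), sFun ξ k (η - η') * g₂.1 η') := by
  set h : TestFun := kernelTest _ (sKernel_regular ξ k) g₂
  have hval : ∀ η, h.1 η
      = ∫ η' in (0 : ℝ)..(2 * Real.pi), sFun ξ k (η - η') * g₂.1 η' := fun η => by
    change ∫ η' in (0 : ℝ)..(2 * Real.pi), sFun ξ k (η' - η) * g₂.1 η' = _
    simp only [← sFun_neg (ξ : ℝ) k (_ - η), neg_sub]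
  have hS : opS ξ k (ofTest g₂) = ofTest h := by
    ext φ
    rw [opS, kernelOp_ofTest _ _ _
      (integrable_shift_square (sFun_periodic ξ k) (sFun_integrable ξ k) φ g₂), ofTest_apply]
    simp only [hval]
  rw [formK, hS, pairing_ofTest, ofTest_apply]
  simp only [← hval]
  rfl

/-! ### The sesquilinear form -/

lemma fourierCoef_opS (ξ : Set.Ioo (0 : ℝ) 1) (k l : ℤ) (u : PerDist) :
    fourierCoef l (opS ξ k u) = (symbS ξ k l : ℂ) * fourierCoef l u := by
  rw [opS_eq, fourierCoef_convDist, convCoef_sFun_eq]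

lemma symbS_pos (ξ : Set.Ioo (0 : ℝ) 1) (k l : ℤ) : 0 < symbS ξ k l := by
  obtain ⟨a, ha, h⟩ := exists_le_symbS ξ k
  exact lt_of_lt_of_le (by positivity) (h l)

lemma pairingTerm_opS (ξ : Set.Ioo (0 : ℝ) 1) (k : ℤ) (u v : PerDist) (l : ℤ) :
    pairingTerm u (opS ξ k v) l = 2 * (Real.pi : ℂ) *
      ((symbS ξ k l : ℂ) * (fourierCoef l u * (starRingEnd ℂ) (fourierCoef l v))) := by
  rw [pairingTerm, fourierCoef_opS, map_mul, Complex.conj_ofReal]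
  ring

lemma summable_pairingTerm_opS (ξ : Set.Ioo (0 : ℝ) 1) (k : ℤ) {u v : PerDist} (hu : u ∈ HT ξ)
    (hv : v ∈ HT ξ) : Summable (pairingTerm u (opS ξ k v)) := by
  rw [mem_HT_iff, mem_sobolev_iff] at hu hv
  obtain ⟨b, hb, h⟩ := exists_symbS_le ξ k
  refine Summable.of_norm_bounded ((hu.add hv).mul_left (2 * Real.pi * b)) fun l => ?_
  have hσ := symbS_pos ξ k l
  have hW : 0 ≤ (1 + (l : ℝ) ^ 2) ^ (-1 / 2 : ℝ) := Real.rpow_nonneg (by positivity) _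
  have hxy : ‖fourierCoef l u‖ * ‖fourierCoef l v‖
      ≤ ‖fourierCoef l u‖ ^ 2 + ‖fourierCoef l v‖ ^ 2 := by
    nlinarith [sq_nonneg (‖fourierCoef l u‖ - ‖fourierCoef l v‖),
      sq_nonneg ‖fourierCoef l u‖, sq_nonneg ‖fourierCoef l v‖]
  have h2π : ‖2 * (Real.pi : ℂ)‖ = 2 * Real.pi := by simp [abs_of_pos Real.pi_pos]
  rw [pairingTerm_opS, norm_mul, h2π, norm_mul, norm_mul, RCLike.norm_conj, Complex.norm_real,
    Real.norm_of_nonneg hσ.le, mul_assoc (2 * Real.pi)]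
  refine mul_le_mul_of_nonneg_left ?_ Real.two_pi_pos.le
  calc _ ≤ b * (1 + (l : ℝ) ^ 2) ^ (-1 / 2 : ℝ)
        * (‖fourierCoef l u‖ ^ 2 + ‖fourierCoef l v‖ ^ 2) :=
        mul_le_mul (h l) hxy (by positivity) (by positivity)
    _ = _ := by ring

lemma formK_add_right (ξ : Set.Ioo (0 : ℝ) 1) (k : ℤ) {u v w : PerDist} (hu : u ∈ HT ξ)
    (hv : v ∈ HT ξ) (hw : w ∈ HT ξ) :
    formK ξ k w (u + v) = formK ξ k w u + formK ξ k w v := by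
  rw [formK, formK, formK, pairing, pairing, pairing, ← (summable_pairingTerm_opS ξ k hw
    hu).tsum_add (summable_pairingTerm_opS ξ k hw hv)]
  congr 1; ext l
  simp only [pairingTerm, map_add]
  ring

lemma formK_smul_right (ξ : Set.Ioo (0 : ℝ) 1) (k : ℤ) (c : ℂ) (u w : PerDist) :
    formK ξ k w (c • u) = (starRingEnd ℂ) c * formK ξ k w u := by
  rw [formK, formK, pairing, pairing, ← tsum_mul_left]
  congr 1; ext l
  simp only [pairingTerm, map_smul, smul_eq_mul, map_mul]
  ring

lemma conj_formK (ξ : Set.Ioo (0 : ℝ) 1) (k : ℤ) (u v : PerDist) :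
    (starRingEnd ℂ) (formK ξ k u v) = formK ξ k v u := by
  rw [formK, formK, pairing, pairing, Complex.conj_tsum]
  congr 1; ext l
  simp only [pairingTerm_opS, map_mul, Complex.conj_ofReal, Complex.conj_conj, Complex.conj_ofNat]
  ring

lemma hasSum_formK_re (ξ : Set.Ioo (0 : ℝ) 1) (k : ℤ) {g : PerDist} (hg : g ∈ HT ξ) :
    HasSum (fun l => 2 * Real.pi * (symbS ξ k l * ‖fourierCoef l g‖ ^ 2)) (formK ξ k g g).re := by
  have h := Complex.hasSum_re (summable_pairingTerm_opS ξ k hg hg).hasSum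
  refine h.congr_fun fun l => ?_
  rw [pairingTerm_opS, Complex.mul_conj, Complex.normSq_eq_norm_sq, ← Complex.ofReal_ofNat,
    ← Complex.ofReal_mul, ← Complex.ofReal_mul, ← Complex.ofReal_mul, Complex.ofReal_re]

/-- The quadratic form of `S_k` is equivalent to the squared norm of `H^{-1/2}(T)`. -/
lemma exists_formK_bounds (ξ : Set.Ioo (0 : ℝ) 1) (k : ℤ) : ∃ a b : ℝ, 0 < a ∧ 0 < b ∧
    ∀ g ∈ HT ξ, a * sobSq g ≤ (formK ξ k g g).re ∧ (formK ξ k g g).re ≤ b * sobSq g := by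
  obtain ⟨a, ha, h1⟩ := exists_le_symbS ξ k
  obtain ⟨b, hb, h2⟩ := exists_symbS_le ξ k
  refine ⟨2 * Real.pi * a, 2 * Real.pi * b, by positivity, by positivity, fun g hg => ?_⟩
  have hs := hasSum_formK_re ξ k hg
  have hW := ((mem_sobolev_iff g).1 ((mem_HT_iff ξ g).1 hg)).hasSum
  constructor
  · refine hasSum_le (fun l => ?_) (hW.mul_left (2 * Real.pi * a)) hs
    calc _ = 2 * Real.pi * (a * (1 + (l : ℝ) ^ 2) ^ (-1 / 2 : ℝ) * ‖fourierCoef l g‖ ^ 2) := by ring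
      _ ≤ _ := by gcongr; exact h1 l
  · refine hasSum_le (fun l => ?_) hs (hW.mul_left (2 * Real.pi * b))
    calc _ ≤ 2 * Real.pi * (b * (1 + (l : ℝ) ^ 2) ^ (-1 / 2 : ℝ) * ‖fourierCoef l g‖ ^ 2) := by
          gcongr; exact h2 l
      _ = _ := by ring

lemma exists_formK_norm_bounds (ξ : Set.Ioo (0 : ℝ) 1) (k : ℤ) : ∃ C : ℝ, 1 < C ∧ ∀ g : HT ξ,
    C⁻¹ * ‖g‖ ^ 2 ≤ (formK ξ k g.1 g.1).re ∧ (formK ξ k g.1 g.1).re ≤ C * ‖g‖ ^ 2 := by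
  obtain ⟨a, b, ha, hb, h⟩ := exists_formK_bounds ξ k
  obtain ⟨C, hC, h1⟩ := exists_sobSq_le_norm_sq ξ
  obtain ⟨D, hD, h2⟩ := exists_norm_sq_le_sobSq ξ
  have hDa : 0 ≤ D / a := by positivity
  have hbC : 0 ≤ b * C := by positivity
  refine ⟨2 + D / a + b * C, by linarith, fun g => ?_⟩
  obtain ⟨e1, e2⟩ := h g.1 g.2
  have e3 := h1 g
  have e4 := h2 g
  have hq : 0 ≤ ‖g‖ ^ 2 := sq_nonneg _
  constructor
  · rw [inv_mul_le_iff₀ (by linarith)]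
    have h0 : 0 ≤ sobSq g.1 := tsum_nonneg fun l => by positivity
    have e5 : sobSq g.1 ≤ (formK ξ k g.1 g.1).re / a := by rw [le_div_iff₀ ha]; linarith
    have h0' : 0 ≤ (formK ξ k g.1 g.1).re := le_trans (by positivity) e1
    calc ‖g‖ ^ 2 ≤ D * sobSq g.1 := e4
      _ ≤ D * ((formK ξ k g.1 g.1).re / a) := by gcongr
      _ = D / a * (formK ξ k g.1 g.1).re := by ring
      _ ≤ _ := by gcongr; linarith
  · calc _ ≤ b * sobSq g.1 := e2
      _ ≤ b * (C * ‖g‖ ^ 2) := by gcongr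
      _ = b * C * ‖g‖ ^ 2 := by ring
      _ ≤ _ := by gcongr; linarith

/-- A distribution in `H(T)` on which the quadratic form vanishes is zero. -/
lemma eq_zero_of_formK_self (ξ : Set.Ioo (0 : ℝ) 1) (k : ℤ) {g : PerDist} (hg : g ∈ HT ξ)
    (h : formK ξ k g g = 0) : g = 0 := by
  have hs := hasSum_formK_re ξ k hg
  have hnn : ∀ l, 0 ≤ 2 * Real.pi * (symbS ξ k l * ‖fourierCoef l g‖ ^ 2) := fun l => by
    have := symbS_pos ξ k l
    positivity
  rw [h, Complex.zero_re, hasSum_zero_iff_of_nonneg hnn] at hs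
  refine perDist_ext fun l => ?_
  have h1 := congrFun hs l
  have h2 := (symbS_pos ξ k l).ne'
  have h3 := Real.pi_ne_zero
  simpa [h2, h3] using h1

lemma exists_formK_core (ξ : Set.Ioo (0 : ℝ) 1) (k : ℤ) :
    ∃ c : InnerProductSpace.Core ℂ (HT ξ),
      ∀ g₁ g₂ : HT ξ, c.inner g₂ g₁ = formK ξ k g₁.1 g₂.1 := by
  refine ⟨{
    inner := fun x y => formK ξ k y.1 x.1
    conj_inner_symm := fun x y => conj_formK ξ k _ _
    re_inner_nonneg := fun x => ?_
    add_left := fun x y z => formK_add_right ξ k x.2 y.2 z.2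
    smul_left := fun x y r => formK_smul_right ξ k r _ _
    definite := fun x hx => Subtype.ext (eq_zero_of_formK_self ξ k x.2 hx) }, fun _ _ => rfl⟩
  obtain ⟨a, b, ha, -, h⟩ := exists_formK_bounds ξ k
  exact (mul_nonneg ha.le (tsum_nonneg fun l => by positivity)).trans (h x.1 x.2).1

/-! ### Compactness and self-adjointness of `A_k` -/

/-- The convolution with the second kernel `t_k` in the decomposition of `A_k`. -/
noncomputable def opT (ξ : Set.Ioo (0 : ℝ) 1) (k : ℤ) : PerDist →ₗ[ℂ] PerDist :=
  convDist (tFun_periodic ξ k) (tFun_integrable ξ k)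

lemma exists_isCompactOperator_opS (ξ : Set.Ioo (0 : ℝ) 1) (k : ℤ) :
    ∃ h : ∀ g ∈ HT ξ, opS ξ k g ∈ HT ξ, IsCompactOperator ((opS ξ k).restrict h) :=
  isCompactOperator_multiplier ξ (opS ξ k) (convCoef (sFun ξ k))
    (fourierCoef_convDist (sFun_periodic ξ k) (sFun_integrable ξ k)) _ (norm_convCoef_le _)
    (tendsto_convCoef _)

lemma exists_isCompactOperator_opT (ξ : Set.Ioo (0 : ℝ) 1) (k : ℤ) :
    ∃ h : ∀ g ∈ HT ξ, opT ξ k g ∈ HT ξ, IsCompactOperator ((opT ξ k).restrict h) :=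
  isCompactOperator_multiplier ξ (opT ξ k) (convCoef (tFun ξ k))
    (fourierCoef_convDist (tFun_periodic ξ k) (tFun_integrable ξ k)) _ (norm_convCoef_le _)
    (tendsto_convCoef _)

/-- `A_k = ψ⁻¹ S_k - ξ⁻² T_k` preserves `H(T)` and is compact there, since `S_k` and `T_k` are and
multiplication by `ψ⁻¹` is continuous. -/
lemma exists_isCompactOperator_opA (ξ : Set.Ioo (0 : ℝ) 1) (k : ℤ) :
    ∃ h : ∀ g ∈ HT ξ, opA ξ k g ∈ HT ξ, IsCompactOperator ((opA ξ k).restrict h) := by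
  obtain ⟨hS, hSc⟩ := exists_isCompactOperator_opS ξ k
  obtain ⟨hT, hTc⟩ := exists_isCompactOperator_opT ξ k
  obtain ⟨M, hM⟩ := exists_clm_mulDist ξ (psiPow ξ (-1))
  have hA : ∀ g : HT ξ, opA ξ k g.1 = (M ((opS ξ k).restrict hS g)
      - ((1 / (ξ : ℝ) ^ 2 : ℝ) : ℂ) • (opT ξ k).restrict hT g : HT ξ) := fun g => by
    rw [opA_eq, Submodule.coe_sub, hM, Submodule.coe_smul, LinearMap.coe_restrict_apply,
      LinearMap.coe_restrict_apply]
    rfl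
  have hmem : ∀ g ∈ HT ξ, opA ξ k g ∈ HT ξ := fun g hg => by
    rw [hA ⟨g, hg⟩]
    exact Subtype.mem _
  refine ⟨hmem, ?_⟩
  have h := (hSc.clm_comp M).sub (hTc.smul ((1 / (ξ : ℝ) ^ 2 : ℝ) : ℂ))
  convert! h using 1
  ext g : 1
  refine Subtype.ext ?_
  rw [LinearMap.coe_restrict_apply, hA]
  rfl

/-- `S_k` maps `H(T)` into `L²(T)`. -/
lemma summable_norm_fourierCoef_opS (ξ : Set.Ioo (0 : ℝ) 1) (k : ℤ) {g : PerDist} (hg : g ∈ HT ξ) :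
    Summable fun l => ‖fourierCoef l (opS ξ k g)‖ ^ 2 := by
  obtain ⟨b, hb, h⟩ := exists_symbS_le ξ k
  refine Summable.of_nonneg_of_le (fun l => sq_nonneg _) (fun l => ?_)
    (((mem_sobolev_iff g).1 ((mem_HT_iff ξ g).1 hg)).mul_left (b ^ 2))
  have hσ := symbS_pos ξ k l
  have hW : 0 ≤ (1 + (l : ℝ) ^ 2) ^ (-1 / 2 : ℝ) := Real.rpow_nonneg (by positivity) _
  have hW1 : (1 + (l : ℝ) ^ 2) ^ (-1 / 2 : ℝ) ≤ 1 :=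
    Real.rpow_le_one_of_one_le_of_nonpos (by nlinarith [sq_nonneg (l : ℝ)]) (by norm_num)
  rw [fourierCoef_opS, norm_mul, mul_pow, Complex.norm_real, Real.norm_of_nonneg hσ.le, ← mul_assoc]
  refine mul_le_mul_of_nonneg_right ?_ (sq_nonneg _)
  calc symbS ξ k l ^ 2 ≤ (b * (1 + (l : ℝ) ^ 2) ^ (-1 / 2 : ℝ)) ^ 2 := by
        gcongr; exact h l
    _ = b ^ 2 * ((1 + (l : ℝ) ^ 2) ^ (-1 / 2 : ℝ) * (1 + (l : ℝ) ^ 2) ^ (-1 / 2 : ℝ)) := by ring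
    _ ≤ b ^ 2 * ((1 + (l : ℝ) ^ 2) ^ (-1 / 2 : ℝ) * 1) := by gcongr
    _ = _ := by ring

/-- Self-adjointness of `A_k`: both `S_k ψ⁻¹ S_k` and `S_k T_k` are symmetric, because `ψ` is real
and the multipliers of `S_k` and `T_k` are real. -/
lemma formK_opA_symm (ξ : Set.Ioo (0 : ℝ) 1) (k : ℤ) {g₁ g₂ : PerDist} (h₁ : g₁ ∈ HT ξ)
    (h₂ : g₂ ∈ HT ξ) : formK ξ k (opA ξ k g₁) g₂ = formK ξ k g₁ (opA ξ k g₂) := by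
  obtain ⟨hT, -⟩ := exists_isCompactOperator_opT ξ k
  obtain ⟨s, hs1, hs2⟩ := pairing_mulDist (m := psiPow ξ (-1)) (fun x => Complex.conj_ofReal _)
    (summable_norm_fourierCoef_opS ξ k h₁) (summable_norm_fourierCoef_opS ξ k h₂)
  have ht := ((summable_pairingTerm_opS ξ k (hT g₁ h₁) h₂).mul_left
    ((1 / (ξ : ℝ) ^ 2 : ℝ) : ℂ)).hasSum
  have e1 := hs1.sub ht
  have e2 := hs2.sub ht
  rw [formK, formK, pairing, pairing]
  have c1 : pairingTerm (opA ξ k g₁) (opS ξ k g₂) = fun l =>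
      pairingTerm (mulDist (psiPow ξ (-1)) (opS ξ k g₁)) (opS ξ k g₂) l -
        ((1 / (ξ : ℝ) ^ 2 : ℝ) : ℂ) * pairingTerm (opT ξ k g₁) (opS ξ k g₂) l := by
    ext l
    rw [opA_eq, opT]
    simp only [pairingTerm, map_sub, map_smul, smul_eq_mul]
    ring
  have c2 : pairingTerm g₁ (opS ξ k (opA ξ k g₂)) = fun l =>
      pairingTerm (opS ξ k g₁) (mulDist (psiPow ξ (-1)) (opS ξ k g₂)) l -
        ((1 / (ξ : ℝ) ^ 2 : ℝ) : ℂ) * pairingTerm (opT ξ k g₁) (opS ξ k g₂) l := by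
    ext l
    rw [pairingTerm_opS, pairingTerm_opS, opA_eq, opT, fourierCoef_convDist]
    simp only [pairingTerm, map_sub, map_smul, smul_eq_mul, fourierCoef_convDist, map_mul,
      conj_convCoef_tFun, Complex.conj_ofReal, fourierCoef_opS]
    ring
  rw [c1, c2, e1.tsum_eq, e2.tsum_eq]

end ToroidalNP
open ToroidalNP
theorem mainTheorem3 (ξ : Set.Ioo (0 : ℝ) 1) (k : ℤ) :
    -- the pairing of `g₁` with `S_k[g₂]` is well defined on `H(T)`
    (∀ g₁ ∈ HT ξ, ∀ g₂ ∈ HT ξ, Summable (pairingTerm g₁ (opS ξ k g₂))) ∧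
    -- for smooth functions it is the integral
    (∀ g₁ g₂ : TestFun, ofTest g₁ ∈ HT ξ ∧
      formK ξ k (ofTest g₁) (ofTest g₂) =
        ∫ η in (0 : ℝ)..(2 * Real.pi), g₁.1 η *
          (starRingEnd ℂ) (∫ η' in (0 : ℝ)..(2 * Real.pi), sFun ξ k (η - η') * g₂.1 η')) ∧
    -- `⟨·, ·⟩_k` is an inner product on `H(T)` (Mathlib's are linear in the second variable)
    (∃ c : InnerProductSpace.Core ℂ (HT ξ),
      ∀ g₁ g₂ : HT ξ, c.inner g₂ g₁ = formK ξ k g₁.1 g₂.1) ∧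
    -- equivalence with the norm of `H(T)`
    (∃ C : ℝ, 1 < C ∧ ∀ g : HT ξ,
      C⁻¹ * ‖g‖ ^ 2 ≤ (formK ξ k g.1 g.1).re ∧ (formK ξ k g.1 g.1).re ≤ C * ‖g‖ ^ 2) ∧
    -- for smooth functions `A_k` is the integral operator
    (∀ g φ : TestFun, (opA ξ k (ofTest g)).1 φ =
      ∫ η in (0 : ℝ)..(2 * Real.pi),
        (∫ η' in (0 : ℝ)..(2 * Real.pi), aKernel ξ k η η' * g.1 η') * φ.1 η) ∧
    -- `A_k` maps `H(T)` to itself, is compact, and is self-adjoint for `⟨·, ·⟩_k`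
    (∃ hA : ∀ g ∈ HT ξ, opA ξ k g ∈ HT ξ,
      IsCompactOperator ((opA ξ k).restrict hA) ∧
      ∀ g₁ g₂ : HT ξ, formK ξ k (opA ξ k g₁.1) g₂.1 = formK ξ k g₁.1 (opA ξ k g₂.1)) := by
  obtain ⟨hA, hAc⟩ := exists_isCompactOperator_opA ξ k
  exact ⟨fun g₁ h₁ g₂ h₂ => summable_pairingTerm_opS ξ k h₁ h₂,
    fun g₁ g₂ => ⟨ofTest_mem_HT ξ g₁, formK_ofTest ξ k g₁ g₂⟩,
    exists_formK_core ξ k,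
    exists_formK_norm_bounds ξ k,
    opA_ofTest ξ k,
    hA, hAc, fun g₁ g₂ => formK_opA_symm ξ k g₁.2 g₂.2⟩
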